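/- Conventions. All algebras are unital associative algebras over $\mathbb{C}$, ideals are two-sided unless said otherwise. A differential calculus $\Gamma(A)$ over an algebra $A$ is an $\mathbb{N}$-graded algebra $\Gamma(A)=\bigoplus_n\Gamma^n(A)$ with $\Gamma^0(A)=A$ and a graded derivation $d$ of degree $1$ with $d^2=0$, generated as an algebra by $A$ and the elements $da$, $a\in A$. $\Omega(A)$ is the universal calculus; a differential ideal is a graded $d$-invariant ideal; the differential ideal $J(A)\subset\Omega(A)$ corresponding to $\Gamma(A)$ is the kernel of the canonical map $\Omega(A)\to\Gamma(A)$. For a homomorphism $f$ of algebras, $f_\Omega$ is its extension to the universal calculi. $\Gamma(A)\hat\otimes\Gamma(B)$ is $\Gamma(A)\otimes\Gamma(B)$ with product $(\gamma\hat\otimes\rho)(\omega\hat\otimes\tau)=(-1)^{mn}\gamma\omega\hat\otimes\rho\tau$ ($\rho$ of degree $m$, $\omega$ of degree $n$) and differential $d(\gamma\hat\otimes\rho)=d\gamma\hat\otimes\rho+(-1)^n\gamma\hat\otimes d\rho$ ($\gamma$ of degree $n$), a calculus over $A\otimes B$. A complete covering of an algebra $B$ is a finite family of ideals $(J_i)_{i\in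 I}$ with $\bigcap_iJ_i=0$ such that every family $(b_i)\in\prod_iB/J_i$ whose members $b_i,b_j$ agree in $B/(J_i+J_j)$ for all $i,j$ comes from an element of $B$. Setting. Let $H$ be a Hopf algebra with invertible antipode $S$ and counit $\varepsilon$, and let $\mathcal P$ be a locally trivial quantum principal fibre bundle with structure group $H$ over an algebra $B$ with complete covering $(J_i)_{i\in I}$: $\mathcal P$ is a right $H$-comodule algebra with coaction $\Delta_{\mathcal P}$, and, with $B_i=B/J_i$ and $\pi_i:B\to B_i$ the projection, there are surjective homomorphisms $\chi_i:\mathcal P\to B_i\otimes H$ with $(id\otimes\Delta)\circ\chi_i=(\chi_i\otimes id)\circ\Delta_{\mathcal P}$ such that $(\ker\chi_i)_{i\in I}$ is a complete covering of $\mathcal P$, and an injective homomorphism $\iota:B\to\mathcal P$ with $\chi_i(\iota(a))=\pi_i(a)\otimes1$ and $\iota(B)=\{f:\Delta_{\mathcal P}(f)=f\otimes1\}$. Put $B_{ij}=B_{ji}=B/(J_i+J_j)$ and let $\pi^i_j:B_i\to B_{ij}$ be the projection. The map $(\pi^i_j\otimes id)\circ\chi_i$ induces an isomorphism $\chi^i_{ij}:\mathcal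 P/(\ker\chi_i+\ker\chi_j)\to B_{ij}\otimes H$; put $\phi_{ij}=\chi^i_{ij}\circ(\chi^j_{ij})^{-1}$, and let $\tau_{ji}:H\to B_{ij}$, $\tau_{ji}(h)=(id\otimes\varepsilon)\phi_{ij}(1\otimes h)$, be the transition functions. Let differential calculi $\Gamma(B_i)$, $i\in I$, be given, with corresponding differential ideals $J(B_i)$. Let $R\subset\ker\varepsilon\subset H$ be a right ideal, let $J(H)\subset\Omega(H)$ be the differential ideal generated by $\{\sum S^{-1}(r_2)\,dr_1: r\in R\}$, and let $\Gamma(H)=\Omega(H)/J(H)$. Let $\Gamma(\mathcal P)=\Omega(\mathcal P)/\bigcap_i\ker\bigl(\Omega(\mathcal P)\to\Gamma(B_i)\hat\otimes\Gamma(H)\bigr)$, where the maps are the extensions of the $\chi_i$; let $\chi_{i_\Gamma}:\Gamma(\mathcal P)\to\Gamma(B_i)\hat\otimes\Gamma(H)$ be the induced maps; and let $$\Gamma^i(B_{ij}\otimes H)=(\Gamma(B_i)\hat\otimes\Gamma(H))/\chi_{i_\Gamma}(\ker\chi_{j_\Gamma}),\qquad \Gamma^j(B_{ij}\otimes H)=(\Gamma(B_j)\hat\otimes\Gamma(H))/\chi_{j_\Gamma}(\ker\chi_{i_\Gamma}),$$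 which are differential calculi over $B_{ij}\otimes H$. Proposition. Suppose that $$\sum\tau_{ij}(S(r_1)r_3)\otimes r_2\in B_{ij}\otimes R\qquad\text{for all } r\in R \text{ and all } i,j\in I. \qquad(*)$$ For $i,j\in I$ let $J_m(B_{ij})\subset\Omega(B_{ij})$ be the differential ideal generated by $$(\pi^i_j)_\Omega(J(B_i)),\quad (\pi^j_i)_\Omega(J(B_j)),\quad \Bigl\{\sum\tau_{ji}(r_1)\,d\tau_{ij}(r_2): r\in R\Bigr\},\quad \{(d\tau_{ji}(h))\,a-a\,d\tau_{ji}(h): a\in B_{ij},\ h\in H\},$$ and put $\Gamma_m(B_{ij})=\Omega(B_{ij})/J_m(B_{ij})$. Then, for all $i,j\in I$, $$\Gamma^i(B_{ij}\otimes H)=\Gamma^j(B_{ij}\otimes H)\cong\Gamma_m(B_{ij})\hat\otimes\Gamma(H),$$ where the equality means that the two calculi have the same corresponding differential ideal in $\Omega(B_{ij}\otimes H)$, and $\cong$ is an isomorphism of differential calculi over $B_{ij}\otimes H$ (the identity on $B_{ij}\otimes H$). Moreover, exchanging $i$ and $j$ in the definition gives the same differential ideal $J_m(B_{ij})$. Condition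 $(*)$ holds whenever the calculus $\Gamma(H)$ determined by $R$ is bicovariant. -/

import Mathlib

open scoped TensorProduct DirectSum

noncomputable section

/-! ## Graded vector spaces -/

/-- A family of subspaces, each given by a set of homogeneous generators, together with a linear map
that sends every generator to its own component, is a decomposition. -/
abbrev decompositionOfSpan {M : Type*} [AddCommGroup M] [Module ℂ M] (gr : ℕ → Submodule ℂ M)
    (s : ℕ → Set M) (hs : ∀ n, gr n = Submodule.span ℂ (s n))
    (dec : M →ₗ[ℂ] ⨁ n, gr n)
    (hdec : ∀ n x (hx : x ∈ gr n), x ∈ s n → dec x = DirectSum.lof ℂ ℕ (fun n => gr n) n ⟨x, hx⟩)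
    (htop : Submodule.span ℂ (⋃ n, s n) = ⊤) : DirectSum.Decomposition gr :=
  DirectSum.Decomposition.ofLinearMap gr dec
    (by
      refine LinearMap.ext_on_range (v := fun x : (⋃ n, s n : Set M) => (x : M))
        (by rw [Subtype.range_coe]; exact htop) ?_
      rintro ⟨x, hx⟩
      obtain ⟨n, hn⟩ := Set.mem_iUnion.1 hx
      have hx' : x ∈ gr n := by rw [hs]; exact Submodule.subset_span hn
      simp [hdec n x hx' hn])
    (by
      refine DirectSum.linearMap_ext _ fun n => ?_
      ext1 ⟨x, hx⟩
      have key : ∀ y (hy : y ∈ Submodule.span ℂ (s n)),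
          dec y = DirectSum.lof ℂ ℕ (fun n => gr n) n ⟨y, (hs n).symm ▸ hy⟩ := by
        intro y hy
        induction hy using Submodule.span_induction with
        | mem y h => exact hdec n y _ h
        | zero => rw [map_zero]; exact (map_zero _).symm
        | add y z _ _ h1 h2 => rw [map_add, h1, h2, ← map_add]; rfl
        | smul c y _ h => rw [map_smul, h, ← map_smul]; rfl
      simpa using key x (hs n ▸ hx))

/-! ## Differential calculi -/

universe u v w

/-- A differential calculus over a complex unital algebra `A`: an `ℕ`-graded algebra
`Γ = ⨁ₙ Γⁿ` with `Γ⁰ = A` (through the embedding `ι`), with a graded derivation `d` of degree `1`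
with `d² = 0`, which is generated as an algebra by `A` and the elements `d a`, `a ∈ A`. -/
structure DiffCalculus (A : Type u) [Ring A] [Algebra ℂ A] where
  Carrier : Type v
  [ring : Ring Carrier]
  [algebra : Algebra ℂ Carrier]
  gr : ℕ → Submodule ℂ Carrier
  [graded : GradedAlgebra gr]
  d : Carrier →ₗ[ℂ] Carrier
  d_mem : ∀ n, ∀ x ∈ gr n, d x ∈ gr (n + 1)
  d_d : ∀ x, d (d x) = 0
  leibniz : ∀ n, ∀ x ∈ gr n, ∀ y, d (x * y) = d x * y + (-1 : ℂ) ^ n • (x * d y)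
  ι : A →ₐ[ℂ] Carrier
  ι_injective : Function.Injective ι
  gr_zero : gr 0 = LinearMap.range ι.toLinearMap
  generated : Algebra.adjoin ℂ (Set.range ι ∪ Set.range fun a => d (ι a)) = ⊤

attribute [instance] DiffCalculus.ring DiffCalculus.algebra DiffCalculus.graded

namespace DiffCalculus

variable {A : Type*} [Ring A] [Algebra ℂ A] (Γ : DiffCalculus A)

lemma ι_mem (a : A) : Γ.ι a ∈ Γ.gr 0 := by
  rw [Γ.gr_zero]; exact ⟨a, rfl⟩

lemma dι_mem (a : A) : Γ.d (Γ.ι a) ∈ Γ.gr 1 := Γ.d_mem 0 _ (Γ.ι_mem a)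

lemma leibniz_zero (a : A) (y : Γ.Carrier) :
    Γ.d (Γ.ι a * y) = Γ.d (Γ.ι a) * y + Γ.ι a * Γ.d y := by
  simpa using Γ.leibniz 0 _ (Γ.ι_mem a) y

/-- The homogeneous component of degree `n`. -/
def proj (n : ℕ) : Γ.Carrier →ₗ[ℂ] Γ.Carrier := GradedAlgebra.proj Γ.gr n

lemma proj_of_mem {n : ℕ} {x : Γ.Carrier} (hx : x ∈ Γ.gr n) (m : ℕ) :
    Γ.proj m x = if n = m then x else 0 := by
  unfold proj
  rw [GradedAlgebra.proj_apply]
  split_ifs with h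
  · subst h; exact DirectSum.decompose_of_mem_same _ hx
  · exact DirectSum.decompose_of_mem_ne _ hx h

lemma proj_mem (n : ℕ) (x : Γ.Carrier) : Γ.proj n x ∈ Γ.gr n := by
  unfold proj
  rw [GradedAlgebra.proj_apply]
  exact SetLike.coe_mem _

lemma gr_induction {p : Γ.Carrier → Prop} (h0 : p 0) (h1 : ∀ n, ∀ x ∈ Γ.gr n, p x)
    (h2 : ∀ x y, p x → p y → p (x + y)) (x : Γ.Carrier) : p x :=
  DirectSum.Decomposition.inductionOn Γ.gr h0 (fun m => h1 _ _ m.2) h2 x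

lemma hom_ext_gr {M : Type*} [AddCommGroup M] [Module ℂ M] {f g : Γ.Carrier →ₗ[ℂ] M}
    (h : ∀ n, ∀ x ∈ Γ.gr n, f x = g x) : f = g := by
  ext x
  exact Γ.gr_induction (p := fun x => f x = g x) (by simp) h
    (fun x y hx hy => by rw [map_add, map_add, hx, hy]) x

/-- The grading involution `x ↦ (-1)ⁿ x` for `x` of degree `n`. -/
def sgn : Γ.Carrier →ₗ[ℂ] Γ.Carrier :=
  DirectSum.toModule ℂ ℕ Γ.Carrier (fun n => (-1 : ℂ) ^ n • (Γ.gr n).subtype) ∘ₗ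
    (DirectSum.decomposeLinearEquiv Γ.gr).toLinearMap

lemma sgn_of_mem {n : ℕ} {x : Γ.Carrier} (hx : x ∈ Γ.gr n) : Γ.sgn x = (-1 : ℂ) ^ n • x := by
  unfold sgn
  simp only [LinearMap.comp_apply, LinearEquiv.coe_coe, DirectSum.decomposeLinearEquiv_apply]
  rw [DirectSum.decompose_of_mem _ hx, ← DirectSum.lof_eq_of ℂ, DirectSum.toModule_lof]
  simp

lemma leibniz_sgn (x y : Γ.Carrier) : Γ.d (x * y) = Γ.d x * y + Γ.sgn x * Γ.d y := by
  refine Γ.gr_induction (p := fun x => Γ.d (x * y) = Γ.d x * y + Γ.sgn x * Γ.d y)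
    (by simp) ?_ ?_ x
  · intro n x hx
    rw [Γ.leibniz n x hx, Γ.sgn_of_mem hx, smul_mul_assoc]
  · intro x z hx hz
    rw [add_mul, map_add, map_add, map_add, hx, hz]; noncomm_ring

end DiffCalculus

/-- Homomorphisms of differential algebras: algebra homomorphisms of degree `0` that commute with
the differentials. -/
structure DiffHom {A A' : Type*} [Ring A] [Algebra ℂ A] [Ring A'] [Algebra ℂ A']
    (Γ : DiffCalculus A) (Γ' : DiffCalculus A') where
  toAlgHom : Γ.Carrier →ₐ[ℂ] Γ'.Carrier
  map_d : ∀ x, toAlgHom (Γ.d x) = Γ'.d (toAlgHom x)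
  map_gr : ∀ n, ∀ x ∈ Γ.gr n, toAlgHom x ∈ Γ'.gr n

/-- A differential ideal: a `d`-invariant graded two-sided ideal. -/
structure DiffIdeal {A : Type*} [Ring A] [Algebra ℂ A] (Γ : DiffCalculus A) where
  toIdeal : Ideal Γ.Carrier
  [isTwoSided : toIdeal.IsTwoSided]
  d_mem : ∀ x ∈ toIdeal, Γ.d x ∈ toIdeal
  proj_mem : ∀ x ∈ toIdeal, ∀ n, Γ.proj n x ∈ toIdeal

attribute [instance] DiffIdeal.isTwoSided

section DiffIdeal

variable {A A' : Type*} [Ring A] [Algebra ℂ A] [Ring A'] [Algebra ℂ A']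
  {Γ : DiffCalculus A} {Γ' : DiffCalculus A'}

lemma DiffHom.map_proj (F : DiffHom Γ Γ') (n : ℕ) (x : Γ.Carrier) :
    F.toAlgHom (Γ.proj n x) = Γ'.proj n (F.toAlgHom x) := by
  have : F.toAlgHom.toLinearMap ∘ₗ Γ.proj n = Γ'.proj n ∘ₗ F.toAlgHom.toLinearMap := by
    refine Γ.hom_ext_gr fun m x hx => ?_
    simp only [LinearMap.comp_apply, AlgHom.toLinearMap_apply]
    rw [Γ.proj_of_mem hx, Γ'.proj_of_mem (F.map_gr m x hx)]
    split_ifs <;> simp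
  exact LinearMap.congr_fun this x

/-- The kernel of a homomorphism of differential algebras. -/
def DiffHom.ker (F : DiffHom Γ Γ') : DiffIdeal Γ where
  toIdeal := RingHom.ker F.toAlgHom
  isTwoSided := inferInstance
  d_mem x hx := by
    rw [RingHom.mem_ker] at hx ⊢
    rw [F.map_d, hx, map_zero]
  proj_mem x hx n := by
    rw [RingHom.mem_ker] at hx ⊢
    rw [F.map_proj, hx, map_zero]

/-- The image of a differential ideal under a surjective homomorphism. -/
def DiffIdeal.map (F : DiffHom Γ Γ') (hF : Function.Surjective F.toAlgHom) (J : DiffIdeal Γ) :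
    DiffIdeal Γ' where
  toIdeal :=
    { carrier := {y | ∃ x ∈ J.toIdeal, F.toAlgHom x = y}
      add_mem' := by
        rintro _ _ ⟨x, hx, rfl⟩ ⟨y, hy, rfl⟩
        exact ⟨x + y, add_mem hx hy, map_add _ _ _⟩
      zero_mem' := ⟨0, zero_mem _, map_zero _⟩
      smul_mem' := by
        rintro c _ ⟨x, hx, rfl⟩
        obtain ⟨c, rfl⟩ := hF c
        exact ⟨c * x, J.toIdeal.mul_mem_left c hx, map_mul _ _ _⟩ }
  isTwoSided := ⟨by
    rintro _ c ⟨x, hx, rfl⟩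
    obtain ⟨c, rfl⟩ := hF c
    exact ⟨x * c, J.toIdeal.mul_mem_right c hx, map_mul _ _ _⟩⟩
  d_mem := by
    rintro _ ⟨x, hx, rfl⟩
    exact ⟨Γ.d x, J.d_mem x hx, F.map_d x⟩
  proj_mem := by
    rintro _ ⟨x, hx, rfl⟩ n
    exact ⟨Γ.proj n x, J.proj_mem x hx n, F.map_proj n x⟩

lemma DiffIdeal.mem_map {F : DiffHom Γ Γ'} {hF : Function.Surjective F.toAlgHom}
    {J : DiffIdeal Γ} {y : Γ'.Carrier} :
    y ∈ (J.map F hF).toIdeal ↔ ∃ x ∈ J.toIdeal, F.toAlgHom x = y := Iff.rfl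

/-- The intersection of a family of differential ideals. -/
def DiffIdeal.iInf {I : Type*} (J : I → DiffIdeal Γ) : DiffIdeal Γ where
  toIdeal := ⨅ i, (J i).toIdeal
  isTwoSided := inferInstance
  d_mem x hx := by
    simp only [Ideal.mem_iInf] at hx ⊢
    exact fun i => (J i).d_mem x (hx i)
  proj_mem x hx n := by
    simp only [Ideal.mem_iInf] at hx ⊢
    exact fun i => (J i).proj_mem x (hx i) n

lemma DiffIdeal.mem_iInf {I : Type*} {J : I → DiffIdeal Γ} {x : Γ.Carrier} :
    x ∈ (DiffIdeal.iInf J).toIdeal ↔ ∀ i, x ∈ (J i).toIdeal := Ideal.mem_iInf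

/-- The differential ideal generated by a set: the smallest differential ideal containing it. -/
def DiffIdeal.generate (Γ : DiffCalculus A) (S : Set Γ.Carrier) : DiffIdeal Γ :=
  DiffIdeal.iInf (I := {J : DiffIdeal Γ // S ⊆ J.toIdeal}) fun J => J.1

lemma proj_zero_mul (x y : Γ.Carrier) : Γ.proj 0 (x * y) = Γ.proj 0 x * Γ.proj 0 y :=
  map_mul (GradedRing.projZeroRingHom Γ.gr) x y

/-- The differential ideal of all elements of positive degree. -/
def DiffIdeal.positive (Γ : DiffCalculus A) : DiffIdeal Γ where
  toIdeal :=
    { carrier := {x | Γ.proj 0 x = 0}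
      add_mem' := by
        intro x y hx hy
        simp only [Set.mem_ofPred_eq] at hx hy ⊢
        rw [map_add, hx, hy, add_zero]
      zero_mem' := map_zero _
      smul_mem' := by
        intro c x hx
        simp only [Set.mem_ofPred_eq] at hx ⊢
        rw [smul_eq_mul, proj_zero_mul, hx, mul_zero] }
  isTwoSided := ⟨by
    intro x c hx
    change Γ.proj 0 (x * c) = 0
    rw [proj_zero_mul, show Γ.proj 0 x = 0 from hx, zero_mul]⟩
  d_mem x _ := by
    change Γ.proj 0 (Γ.d x) = 0
    have : Γ.proj 0 ∘ₗ Γ.d = 0 := by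
      refine Γ.hom_ext_gr fun n x hx => ?_
      simp [Γ.proj_of_mem (Γ.d_mem n x hx)]
    exact LinearMap.congr_fun this x
  proj_mem x hx n := by
    change Γ.proj 0 (Γ.proj n x) = 0
    rw [Γ.proj_of_mem (Γ.proj_mem n x)]
    split_ifs with h
    · subst h; exact hx
    · rfl

lemma DiffIdeal.ι_mem_generate {S : Set Γ.Carrier} (hS : ∀ x ∈ S, Γ.proj 0 x = 0) {a : A} :
    Γ.ι a ∈ (DiffIdeal.generate Γ S).toIdeal ↔ a = 0 := by
  constructor
  · intro h
    have := DiffIdeal.mem_iInf.1 h ⟨DiffIdeal.positive Γ, hS⟩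
    have h2 : Γ.proj 0 (Γ.ι a) = 0 := this
    rw [Γ.proj_of_mem (Γ.ι_mem a), if_pos rfl] at h2
    exact Γ.ι_injective (by rw [h2, map_zero])
  · rintro rfl
    rw [map_zero]; exact zero_mem _

end DiffIdeal

/-! ## Factor calculi -/

section Quot

/-- Factorization of an algebra homomorphism through a surjective one. -/
def surjLift {A A' C : Type*} [Ring A] [Algebra ℂ A] [Ring A'] [Algebra ℂ A'] [Ring C]
    [Algebra ℂ C] (f : A →ₐ[ℂ] A') (hf : Function.Surjective f) (g : A →ₐ[ℂ] C)
    (h : ∀ a, f a = 0 → g a = 0) : A' →ₐ[ℂ] C :=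
  (Ideal.Quotient.liftₐ (RingHom.ker f) g fun a ha => h a ha).comp
    (Ideal.quotientKerAlgEquivOfSurjective hf).symm.toAlgHom

lemma surjLift_apply {A A' C : Type*} [Ring A] [Algebra ℂ A] [Ring A'] [Algebra ℂ A'] [Ring C]
    [Algebra ℂ C] (f : A →ₐ[ℂ] A') (hf : Function.Surjective f) (g : A →ₐ[ℂ] C)
    (h : ∀ a, f a = 0 → g a = 0) (a : A) : surjLift f hf g h (f a) = g a := by
  have : (Ideal.quotientKerAlgEquivOfSurjective hf).symm (f a) =
      Ideal.Quotient.mk (RingHom.ker f) a := by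
    rw [AlgEquiv.symm_apply_eq]
    rfl
  exact congrArg (Ideal.Quotient.liftₐ (RingHom.ker f) g fun a ha => h a ha) this

/-- Linear maps on the quotient of an algebra by an ideal. -/
def quotLinLift {C M : Type*} [Ring C] [Algebra ℂ C] [AddCommMonoid M] [Module ℂ M]
    (I : Ideal C) [I.IsTwoSided] (f : C →ₗ[ℂ] M) (h : ∀ x ∈ I, f x = 0) : (C ⧸ I) →ₗ[ℂ] M where
  toFun := QuotientAddGroup.lift I.toAddSubgroup f.toAddMonoidHom h
  map_add' := map_add _
  map_smul' := by
    rintro c ⟨x⟩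
    exact f.map_smul c x

lemma quotLinLift_mk {C M : Type*} [Ring C] [Algebra ℂ C] [AddCommMonoid M] [Module ℂ M]
    (I : Ideal C) [I.IsTwoSided] (f : C →ₗ[ℂ] M) (h : ∀ x ∈ I, f x = 0) (x : C) :
    quotLinLift I f h (Ideal.Quotient.mkₐ ℂ I x) = f x := rfl

variable {A A' : Type*} [Ring A] [Algebra ℂ A] [Ring A'] [Algebra ℂ A']
  (Γ : DiffCalculus A) (J : DiffIdeal Γ)

/-- The grading of `Γ/J`. -/
def quotGr (n : ℕ) : Submodule ℂ (Γ.Carrier ⧸ J.toIdeal) :=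
  (Γ.gr n).map (Ideal.Quotient.mkₐ ℂ J.toIdeal).toLinearMap

instance quotGr_gradedMonoid : SetLike.GradedMonoid (quotGr Γ J) where
  one_mem := ⟨1, SetLike.one_mem_graded _, map_one (Ideal.Quotient.mkₐ ℂ J.toIdeal)⟩
  mul_mem := by
    rintro i j _ _ ⟨x, hx, rfl⟩ ⟨y, hy, rfl⟩
    exact ⟨x * y, SetLike.mul_mem_graded hx hy, map_mul (Ideal.Quotient.mkₐ ℂ J.toIdeal) x y⟩

/-- The decomposition of the class of `x` into homogeneous components. -/
def quotPreDec : Γ.Carrier →ₗ[ℂ] ⨁ n, quotGr Γ J n :=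
  DirectSum.toModule ℂ ℕ _ (fun n => DirectSum.lof ℂ ℕ (fun n => quotGr Γ J n) n ∘ₗ
    LinearMap.restrict (p := Γ.gr n) (q := quotGr Γ J n)
      (Ideal.Quotient.mkₐ ℂ J.toIdeal).toLinearMap fun x hx => ⟨x, hx, rfl⟩) ∘ₗ
      (DirectSum.decomposeLinearEquiv Γ.gr).toLinearMap

lemma quotPreDec_of_mem {n : ℕ} {x : Γ.Carrier} (hx : x ∈ Γ.gr n) :
    quotPreDec Γ J x = DirectSum.lof ℂ ℕ (fun n => quotGr Γ J n) n
      ⟨Ideal.Quotient.mkₐ ℂ J.toIdeal x, x, hx, rfl⟩ := by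
  unfold quotPreDec
  simp only [LinearMap.comp_apply, LinearEquiv.coe_coe, DirectSum.decomposeLinearEquiv_apply]
  rw [DirectSum.decompose_of_mem _ hx, ← DirectSum.lof_eq_of ℂ, DirectSum.toModule_lof]
  rfl

lemma quotPreDec_apply (n : ℕ) (x : Γ.Carrier) :
    (quotPreDec Γ J x n : Γ.Carrier ⧸ J.toIdeal) =
      Ideal.Quotient.mkₐ ℂ J.toIdeal (Γ.proj n x) := by
  have : (quotGr Γ J n).subtype ∘ₗ DirectSum.component ℂ ℕ (fun n => quotGr Γ J n) n ∘ₗ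
      quotPreDec Γ J = (Ideal.Quotient.mkₐ ℂ J.toIdeal).toLinearMap ∘ₗ Γ.proj n := by
    refine Γ.hom_ext_gr fun m x hx => ?_
    simp only [LinearMap.comp_apply]
    rw [quotPreDec_of_mem Γ J hx, Γ.proj_of_mem hx]
    split_ifs with h
    · subst h
      rw [DirectSum.component.lof_self]; rfl
    · rw [DirectSum.component.of, dif_neg h]
      simp
  exact LinearMap.congr_fun this x

lemma quotPreDec_eq_zero (x : Γ.Carrier) (hx : x ∈ J.toIdeal) : quotPreDec Γ J x = 0 := by
  refine DFinsupp.ext (β := fun n => quotGr Γ J n) fun n => ?_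
  apply Subtype.ext
  refine (quotPreDec_apply Γ J n x).trans ?_
  exact (Ideal.Quotient.eq_zero_iff_mem).2 (J.proj_mem x hx n)

/-- The decomposition of `Γ/J` into homogeneous components. -/
def quotDec : (Γ.Carrier ⧸ J.toIdeal) →ₗ[ℂ] ⨁ n, quotGr Γ J n :=
  quotLinLift J.toIdeal (quotPreDec Γ J) (quotPreDec_eq_zero Γ J)

instance quotGr_decomposition : DirectSum.Decomposition (quotGr Γ J) :=
  decompositionOfSpan (quotGr Γ J) (fun n => (quotGr Γ J n : Set _)) (fun n => by simp)
    (quotDec Γ J)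
    (by
      rintro n _ hx ⟨x, hx', rfl⟩
      exact quotPreDec_of_mem Γ J hx')
    (by
      rw [eq_top_iff]
      rintro x -
      obtain ⟨x, rfl⟩ := Ideal.Quotient.mkₐ_surjective ℂ J.toIdeal x
      refine Γ.gr_induction (p := fun x => Ideal.Quotient.mkₐ ℂ J.toIdeal x ∈ _) (by simp) ?_ ?_ x
      · intro n x hx
        exact Submodule.subset_span (Set.mem_iUnion.2 ⟨n, x, hx, rfl⟩)
      · intro x y hx hy
        rw [map_add]; exact add_mem hx hy)

instance quotGr_gradedAlgebra : GradedAlgebra (quotGr Γ J) where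

/-- The embedding of `A'` into `Γ/J`. -/
def quotι (f : A →ₐ[ℂ] A') (hf : Function.Surjective f)
    (hJ : ∀ a, Γ.ι a ∈ J.toIdeal ↔ f a = 0) : A' →ₐ[ℂ] Γ.Carrier ⧸ J.toIdeal :=
  surjLift f hf ((Ideal.Quotient.mkₐ ℂ J.toIdeal).comp Γ.ι) fun a ha =>
    Ideal.Quotient.eq_zero_iff_mem.2 ((hJ a).2 ha)

lemma quotι_apply (f : A →ₐ[ℂ] A') (hf : Function.Surjective f)
    (hJ : ∀ a, Γ.ι a ∈ J.toIdeal ↔ f a = 0) (a : A) :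
    quotι Γ J f hf hJ (f a) = Ideal.Quotient.mkₐ ℂ J.toIdeal (Γ.ι a) :=
  surjLift_apply _ _ _ _ a

/-- The factor calculus `Γ/J`, as a differential calculus over the image `A'` of a surjective
homomorphism `f : A → A'` whose kernel is the degree zero component of `J`. -/
def DiffCalculus.quot (f : A →ₐ[ℂ] A') (hf : Function.Surjective f)
    (hJ : ∀ a, Γ.ι a ∈ J.toIdeal ↔ f a = 0) : DiffCalculus A' where
  Carrier := Γ.Carrier ⧸ J.toIdeal
  gr := quotGr Γ J
  d := quotLinLift J.toIdeal ((Ideal.Quotient.mkₐ ℂ J.toIdeal).toLinearMap ∘ₗ Γ.d)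
    fun x hx => Ideal.Quotient.eq_zero_iff_mem.2 (J.d_mem x hx)
  d_mem := by
    rintro n _ ⟨x, hx, rfl⟩
    exact ⟨Γ.d x, Γ.d_mem n x hx, rfl⟩
  d_d := by
    intro x
    obtain ⟨x, rfl⟩ := Ideal.Quotient.mkₐ_surjective ℂ J.toIdeal x
    change Ideal.Quotient.mkₐ ℂ J.toIdeal (Γ.d (Γ.d x)) = 0
    rw [Γ.d_d, map_zero]
  leibniz := by
    rintro n _ ⟨x, hx, rfl⟩ y
    obtain ⟨y, rfl⟩ := Ideal.Quotient.mkₐ_surjective ℂ J.toIdeal y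
    change Ideal.Quotient.mkₐ ℂ J.toIdeal (Γ.d (x * y)) = _
    rw [Γ.leibniz n x hx y, map_add, map_smul, map_mul, map_mul]
    rfl
  ι := quotι Γ J f hf hJ
  ι_injective := by
    rw [injective_iff_map_eq_zero]
    intro a ha
    obtain ⟨a, rfl⟩ := hf a
    rw [quotι_apply] at ha
    exact (hJ a).1 (Ideal.Quotient.eq_zero_iff_mem.1 ha)
  gr_zero := by
    ext x
    constructor
    · rintro ⟨x, hx, rfl⟩
      rw [SetLike.mem_coe, Γ.gr_zero] at hx
      obtain ⟨a, rfl⟩ := hx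
      exact ⟨f a, quotι_apply Γ J f hf hJ a⟩
    · rintro ⟨a, rfl⟩
      obtain ⟨a, rfl⟩ := hf a
      exact ⟨Γ.ι a, Γ.ι_mem a, (quotι_apply Γ J f hf hJ a).symm⟩
  generated := by
    have h := congrArg (Subalgebra.map (Ideal.Quotient.mkₐ ℂ J.toIdeal)) Γ.generated
    rw [AlgHom.map_adjoin, Algebra.map_top,
      (AlgHom.range_eq_top _).2 (Ideal.Quotient.mkₐ_surjective ℂ J.toIdeal)] at h
    rw [eq_top_iff, ← h]
    apply Algebra.adjoin_mono
    rintro _ ⟨x, ⟨a, rfl⟩ | ⟨a, rfl⟩, rfl⟩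
    · exact Or.inl ⟨f a, quotι_apply Γ J f hf hJ a⟩
    · refine Or.inr ⟨f a, ?_⟩
      simp only
      rw [quotι_apply]
      rfl

/-- The canonical projection `Γ → Γ/J`. -/
def DiffCalculus.quotMk (f : A →ₐ[ℂ] A') (hf : Function.Surjective f)
    (hJ : ∀ a, Γ.ι a ∈ J.toIdeal ↔ f a = 0) : DiffHom Γ (Γ.quot J f hf hJ) where
  toAlgHom := Ideal.Quotient.mkₐ ℂ J.toIdeal
  map_d _ := rfl
  map_gr _ x hx := ⟨x, hx, rfl⟩

end Quot

/-! ## The universal differential calculus -/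

section Omega

variable (A : Type u) [Ring A] [Algebra ℂ A]

/-- The relations of the universal differential calculus in the free algebra on linear symbols
`a = (a, 0)` and `da = (0, a)`: the unit and the product of `A`, and the Leibniz rule. -/
inductive OmegaRel : TensorAlgebra ℂ (A × A) → TensorAlgebra ℂ (A × A) → Prop
  | one : OmegaRel (TensorAlgebra.ι ℂ (1, 0)) 1
  | mul (a b : A) : OmegaRel (TensorAlgebra.ι ℂ (a * b, 0))
      (TensorAlgebra.ι ℂ (a, 0) * TensorAlgebra.ι ℂ (b, 0))
  | leibniz (a b : A) : OmegaRel (TensorAlgebra.ι ℂ (0, a * b))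
      (TensorAlgebra.ι ℂ (0, a) * TensorAlgebra.ι ℂ (b, 0) +
        TensorAlgebra.ι ℂ (a, 0) * TensorAlgebra.ι ℂ (0, b))

/-- The underlying algebra of the universal differential calculus: generated by `A` and symbols
`da`, linear in `a`, with `d(ab) = (da) b + a (db)`. -/
def OmegaAlg : Type u := RingQuot (OmegaRel A)

instance : Ring (OmegaAlg A) := inferInstanceAs (Ring (RingQuot (OmegaRel A)))
instance : Algebra ℂ (OmegaAlg A) := inferInstanceAs (Algebra ℂ (RingQuot (OmegaRel A)))

namespace OmegaAlg

def mk : TensorAlgebra ℂ (A × A) →ₐ[ℂ] OmegaAlg A := RingQuot.mkAlgHom ℂ (OmegaRel A)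

variable {A} in
lemma mk_rel {x y : TensorAlgebra ℂ (A × A)} (h : OmegaRel A x y) : mk A x = mk A y :=
  RingQuot.mkAlgHom_rel ℂ h

/-- The embedding of `A`. -/
def of : A →ₐ[ℂ] OmegaAlg A :=
  AlgHom.ofLinearMap ((mk A).toLinearMap ∘ₗ TensorAlgebra.ι ℂ ∘ₗ LinearMap.inl ℂ A A)
    ((mk_rel OmegaRel.one).trans (map_one _))
    (fun a b => (mk_rel (OmegaRel.mul a b)).trans (map_mul _ _ _))

/-- The differential `a ↦ da` in degree zero. -/
def del : A →ₗ[ℂ] OmegaAlg A :=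
  (mk A).toLinearMap ∘ₗ TensorAlgebra.ι ℂ ∘ₗ LinearMap.inr ℂ A A

variable {A}

lemma del_mul (a b : A) : del A (a * b) = del A a * of A b + of A a * del A b :=
  (mk_rel (OmegaRel.leibniz a b)).trans ((map_add _ _ _).trans
    (congrArg₂ _ (map_mul _ _ _) (map_mul _ _ _)))

section lift

variable {C : Type*} [Semiring C] [Algebra ℂ C] (f : A →ₐ[ℂ] C) (D : A →ₗ[ℂ] C)
  (h : ∀ a b, D (a * b) = D a * f b + f a * D b)

/-- The universal property: an algebra homomorphism `f : A → C` and an `f`-derivation `D : A → C`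
extend to a homomorphism with `a ↦ f a` and `da ↦ D a`. -/
def lift : OmegaAlg A →ₐ[ℂ] C :=
  RingQuot.liftAlgHom ℂ ⟨TensorAlgebra.lift ℂ (LinearMap.coprod f.toLinearMap D), by
    rintro _ _ (_ | ⟨a, b⟩ | ⟨a, b⟩)
    · simp
    · simp
    · simp [h]⟩

lemma lift_of (a : A) : lift f D h (of A a) = f a := by
  change RingQuot.liftAlgHom ℂ _ (RingQuot.mkAlgHom ℂ (OmegaRel A) (TensorAlgebra.ι ℂ (a, 0))) = _
  rw [RingQuot.liftAlgHom_mkAlgHom_apply]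
  simp

lemma lift_del (a : A) : lift f D h (del A a) = D a := by
  change RingQuot.liftAlgHom ℂ _ (RingQuot.mkAlgHom ℂ (OmegaRel A) (TensorAlgebra.ι ℂ (0, a))) = _
  rw [RingQuot.liftAlgHom_mkAlgHom_apply]
  simp

end lift

lemma hom_ext {C : Type*} [Ring C] [Algebra ℂ C] {f g : OmegaAlg A →ₐ[ℂ] C}
    (h0 : ∀ a, f (of A a) = g (of A a)) (h1 : ∀ a, f (del A a) = g (del A a)) : f = g := by
  refine RingQuot.ringQuot_ext' ℂ f g ?_
  refine TensorAlgebra.hom_ext (LinearMap.ext fun x => ?_)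
  have hx : (TensorAlgebra.ι ℂ x : TensorAlgebra ℂ (A × A)) =
      TensorAlgebra.ι ℂ (x.1, 0) + TensorAlgebra.ι ℂ (0, x.2) := by
    rw [← map_add]; simp
  simp only [LinearMap.comp_apply, AlgHom.toLinearMap_apply, hx, map_add]
  exact congrArg₂ _ (h0 x.1) (h1 x.2)

lemma adjoin_eq_top :
    Algebra.adjoin ℂ (Set.range (of A) ∪ Set.range (del A)) = ⊤ := by
  set S := Algebra.adjoin ℂ (Set.range (of A) ∪ Set.range (del A)) with hS
  have m0 : ∀ a, of A a ∈ S := fun a => Algebra.subset_adjoin (Or.inl ⟨a, rfl⟩)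
  have m1 : ∀ a, del A a ∈ S := fun a => Algebra.subset_adjoin (Or.inr ⟨a, rfl⟩)
  let F : OmegaAlg A →ₐ[ℂ] S := lift ((of A).codRestrict S m0)
    ((del A).codRestrict (Subalgebra.toSubmodule S) m1)
    (fun a b => Subtype.ext (del_mul a b))
  have hF : S.val.comp F = AlgHom.id ℂ _ := by
    refine hom_ext (fun a => ?_) (fun a => ?_)
    · simp only [F, AlgHom.comp_apply, lift_of]; rfl
    · simp only [F, AlgHom.comp_apply, lift_del]; rfl
  rw [eq_top_iff]
  rintro x -
  have := DFunLike.congr_fun hF x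
  rw [AlgHom.id_apply] at this
  rw [← this]
  exact (F x).2

/-- The sign automorphism `a ↦ a`, `da ↦ -da`. -/
def sign : OmegaAlg A →ₐ[ℂ] OmegaAlg A :=
  lift (of A) (-del A) fun a b => by
    simp only [LinearMap.neg_apply, del_mul]; noncomm_ring

/-- The homomorphism `x ↦ (sign x, dx; 0, x)`, which encodes the graded Leibniz rule. -/
def dMatrix : OmegaAlg A →ₐ[ℂ] Matrix (Fin 2) (Fin 2) (OmegaAlg A) :=
  lift
    (AlgHom.ofLinearMap
      { toFun := fun a => !![of A a, del A a; 0, of A a]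
        map_add' := fun a b => by simp
        map_smul' := fun a b => by simp }
      (by
        have h : del A (1 : A) = 0 := by
          have := del_mul (1 : A) 1
          simpa using this
        simp [h, Matrix.one_fin_two])
      (fun a b => by
        simp [del_mul,
          add_comm]))
    { toFun := fun a => !![-del A a, 0; 0, del A a]
      map_add' := fun a b => by simp [add_comm]
      map_smul' := fun a b => by simp }
    (fun a b => by
      simp [del_mul,
        add_comm])

lemma dMatrix_of (a : A) : dMatrix (of A a) = !![of A a, del A a; 0, of A a] := lift_of _ _ _ a

lemma dMatrix_del (a : A) : dMatrix (del A a) = !![-del A a, 0; 0, del A a] := lift_del _ _ _ a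

/-- The differential. -/
def d : OmegaAlg A →ₗ[ℂ] OmegaAlg A where
  toFun x := dMatrix x 0 1
  map_add' x y := by simp
  map_smul' c x := by simp

lemma d_of (a : A) : d (of A a) = del A a := by
  change dMatrix (of A a) 0 1 = _
  rw [dMatrix_of]; simp

lemma d_del (a : A) : d (del A a) = 0 := by
  change dMatrix (del A a) 0 1 = _
  rw [dMatrix_del]; simp

lemma induction {p : OmegaAlg A → Prop} (h0 : ∀ a, p (of A a)) (h1 : ∀ a, p (del A a))
    (hadd : ∀ x y, p x → p y → p (x + y)) (hmul : ∀ x y, p x → p y → p (x * y))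
    (x : OmegaAlg A) : p x := by
  have hx : x ∈ Algebra.adjoin ℂ (Set.range (of A) ∪ Set.range (del A)) := by
    rw [adjoin_eq_top]; trivial
  induction hx using Algebra.adjoin_induction with
  | mem x hx =>
    rcases hx with ⟨a, rfl⟩ | ⟨a, rfl⟩
    · exact h0 a
    · exact h1 a
  | algebraMap r =>
    have := h0 (algebraMap ℂ A r)
    rwa [AlgHom.commutes] at this
  | add x y _ _ hx hy => exact hadd x y hx hy
  | mul x y _ _ hx hy => exact hmul x y hx hy

lemma dMatrix_eq (x : OmegaAlg A) : dMatrix x = !![sign x, d x; 0, x] := by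
  refine induction (p := fun x => dMatrix x = !![sign x, d x; 0, x]) ?_ ?_ ?_ ?_ x
  · intro a; rw [dMatrix_of, d_of, sign, lift_of]
  · intro a; rw [dMatrix_del, d_del, sign, lift_del]; simp
  · intro x y hx hy
    rw [map_add, hx, hy, map_add, map_add]
    simp
  · intro x y hx hy
    have h : dMatrix (x * y) = !![sign x * sign y, sign x * d y + d x * y; 0, x * y] := by
      rw [map_mul, hx, hy]
      simp
    have h' : d (x * y) = sign x * d y + d x * y := by
      change dMatrix (x * y) 0 1 = _
      rw [h]; simp
    rw [h, h', map_mul]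

lemma d_mul (x y : OmegaAlg A) : d (x * y) = d x * y + sign x * d y := by
  change dMatrix (x * y) 0 1 = _
  rw [map_mul, dMatrix_eq, dMatrix_eq]
  simp [Matrix.mul_apply, Fin.sum_univ_two, add_comm]

lemma d_sign (x : OmegaAlg A) : d (sign x) = -sign (d x) := by
  refine induction (p := fun x => d (sign x) = -sign (d x)) ?_ ?_ ?_ ?_ x
  · intro a
    simp only [sign, lift_of, d_of, lift_del]; simp
  · intro a
    simp only [sign, lift_del, d_del]; simp [d_del]
  · intro x y hx hy
    rw [map_add, map_add, hx, hy, map_add, map_add, neg_add]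
  · intro x y hx hy
    rw [map_mul, d_mul, d_mul, hx, hy, map_add, map_mul, map_mul]
    noncomm_ring

lemma d_d (x : OmegaAlg A) : d (d x) = 0 := by
  refine induction (p := fun x => d (d x) = 0) ?_ ?_ ?_ ?_ x
  · intro a; rw [d_of, d_del]
  · intro a; rw [d_del, map_zero]
  · intro x y hx hy; rw [map_add, map_add, hx, hy, add_zero]
  · intro x y hx hy
    rw [d_mul, map_add, d_mul, d_mul, hx, hy, d_sign]
    noncomm_ring

variable (A) in
/-- The component of degree `n`, spanned by the elements `a₀ da₁ ⋯ daₙ` (defined recursively by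
`Ωⁿ⁺¹ = Ωⁿ dA`, `Ω⁰ = A`). -/
def gr : ℕ → Submodule ℂ (OmegaAlg A)
  | 0 => LinearMap.range (of A).toLinearMap
  | n + 1 => gr n * LinearMap.range (del A)

lemma gr_mul_of (n : ℕ) {x : OmegaAlg A} (hx : x ∈ gr A n) (a : A) : x * of A a ∈ gr A n := by
  induction n generalizing x a with
  | zero =>
    obtain ⟨b, rfl⟩ := hx
    exact ⟨b * a, map_mul (of A) _ _⟩
  | succ n ih =>
    refine Submodule.mul_induction_on (C := fun x => x * of A a ∈ gr A (n + 1)) hx ?_ ?_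
    · rintro y hy _ ⟨b, rfl⟩
      have h : y * del A b * of A a = y * del A (b * a) - y * of A b * del A a := by
        rw [del_mul]; noncomm_ring
      rw [h]
      exact sub_mem (Submodule.mul_mem_mul hy ⟨_, rfl⟩)
        (Submodule.mul_mem_mul (ih hy b) ⟨_, rfl⟩)
    · intro y z hy hz
      rw [add_mul]; exact add_mem hy hz

instance gr_gradedMonoid : SetLike.GradedMonoid (gr A) where
  one_mem := ⟨1, map_one (of A)⟩
  mul_mem := by
    intro i j x y hx hy
    induction j generalizing y with
    | zero =>
      obtain ⟨a, rfl⟩ := hy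
      exact gr_mul_of i hx a
    | succ j ih =>
      refine Submodule.mul_induction_on (C := fun y => x * y ∈ gr A (i + (j + 1))) hy ?_ ?_
      · rintro y hy b hb
        rw [← mul_assoc]
        exact Submodule.mul_mem_mul (ih hy) hb
      · intro y z hy hz
        rw [mul_add]; exact add_mem hy hz

lemma del_mem (a : A) : del A a ∈ gr A 1 := by
  have := Submodule.mul_mem_mul (M := gr A 0) (N := LinearMap.range (del A))
    (SetLike.one_mem_graded (gr A)) ⟨a, rfl⟩
  rwa [one_mul] at this

/-- The embedding of `A` as the component of degree zero. -/
def decOf : A →ₐ[ℂ] ⨁ n, gr A n :=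
  AlgHom.ofLinearMap (DirectSum.lof ℂ ℕ (fun n => gr A n) 0 ∘ₗ
        (of A).toLinearMap.codRestrict (gr A 0) fun a => ⟨a, rfl⟩)
      (by
        refine congrArg (DirectSum.of (fun n => gr A n) 0) ?_
        exact Subtype.ext (map_one (of A)))
      (fun a b => by
        refine Eq.trans ?_ (DirectSum.of_mul_of (A := fun n => gr A n) (i := 0) (j := 0) _ _).symm
        exact DirectSum.of_eq_of_gradedMonoid_eq (Sigma.subtype_ext rfl (map_mul (of A) a b)))

/-- The differential of degree zero elements, as homogeneous elements of degree one. -/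
def decDel : A →ₗ[ℂ] ⨁ n, gr A n :=
  DirectSum.lof ℂ ℕ (fun n => gr A n) 1 ∘ₗ (del A).codRestrict (gr A 1) del_mem

lemma decDel_mul (a b : A) : decDel (a * b) = decDel a * decOf b + decOf a * decDel b := by
  have h1 : del A a * of A b ∈ gr A 1 :=
    SetLike.mul_mem_graded (A := gr A) (i := 1) (j := 0) (del_mem a) ⟨b, rfl⟩
  have h2 : of A a * del A b ∈ gr A 1 := by
    have := SetLike.mul_mem_graded (A := gr A) (i := 0) (j := 1) ⟨a, rfl⟩ (del_mem b)
    rwa [zero_add] at this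
  have e1 : decDel a * decOf b = DirectSum.of (fun n => gr A n) 1 ⟨_, h1⟩ :=
    DirectSum.of_mul_of (A := fun n => gr A n) (i := 1) (j := 0) ⟨_, del_mem a⟩ ⟨_, b, rfl⟩
  have e2 : decOf a * decDel b = DirectSum.of (fun n => gr A n) 1 ⟨_, h2⟩ :=
    (DirectSum.of_mul_of (A := fun n => gr A n) (i := 0) (j := 1) ⟨_, a, rfl⟩
      ⟨_, del_mem b⟩).trans
      (DirectSum.of_eq_of_gradedMonoid_eq (Sigma.subtype_ext (zero_add 1) rfl))
  rw [e1, e2, ← map_add]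
  exact congrArg (DirectSum.of (fun n => gr A n) 1) (Subtype.ext (del_mul a b))

/-- The decomposition into homogeneous components. -/
def dec : OmegaAlg A →ₐ[ℂ] ⨁ n, gr A n := lift decOf decDel decDel_mul

lemma dec_of (a : A) :
    dec (of A a) = DirectSum.of (fun n => gr A n) 0 ⟨of A a, a, rfl⟩ :=
  lift_of decOf decDel decDel_mul a

lemma dec_del (a : A) :
    dec (del A a) = DirectSum.of (fun n => gr A n) 1 ⟨del A a, del_mem a⟩ :=
  lift_del decOf decDel decDel_mul a

instance gr_gradedAlgebra : GradedAlgebra (gr A) :=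
  GradedAlgebra.ofAlgHom (gr A) dec
    (by
      refine hom_ext (fun a => ?_) (fun a => ?_)
      · rw [AlgHom.comp_apply, dec_of]; simp
      · rw [AlgHom.comp_apply, dec_del]; simp)
    (by
      rintro n ⟨x, hx⟩
      change dec x = _
      induction n generalizing x with
      | zero =>
        obtain ⟨a, rfl⟩ := id hx
        exact dec_of a
      | succ n ih =>
        have key : ∀ x (hx : x ∈ gr A n * LinearMap.range (del A)),
            dec x = DirectSum.of (fun n => gr A n) (n + 1) ⟨x, hx⟩ := by
          intro x hx
          induction hx using Submodule.mul_induction_on' with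
          | mem_mul_mem y hy z hz =>
            obtain ⟨b, rfl⟩ := id hz
            rw [map_mul, ih y hy, dec_del, DirectSum.of_mul_of]
            rfl
          | add y hy z hz h1 h2 => rw [map_add, h1, h2, ← map_add]; rfl
        exact key x hx)

lemma d_mem (n : ℕ) (x : OmegaAlg A) (hx : x ∈ gr A n) : d x ∈ gr A (n + 1) := by
  induction n generalizing x with
  | zero =>
    obtain ⟨a, rfl⟩ := hx
    change d (of A a) ∈ _
    rw [d_of]; exact del_mem a
  | succ n ih =>
    refine Submodule.mul_induction_on (C := fun x => d x ∈ gr A (n + 1 + 1)) hx ?_ ?_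
    · rintro y hy _ ⟨b, rfl⟩
      rw [d_mul, d_del, mul_zero, add_zero]
      exact Submodule.mul_mem_mul (ih y hy) ⟨b, rfl⟩
    · intro y z hy hz
      rw [map_add]; exact add_mem hy hz

lemma sign_of_mem (n : ℕ) (x : OmegaAlg A) (hx : x ∈ gr A n) : sign x = (-1 : ℂ) ^ n • x := by
  induction n generalizing x with
  | zero =>
    obtain ⟨a, rfl⟩ := hx
    change sign (of A a) = (-1 : ℂ) ^ 0 • of A a
    rw [sign, lift_of]; simp
  | succ n ih =>
    refine Submodule.mul_induction_on (C := fun x => sign x = (-1 : ℂ) ^ (n + 1) • x) hx ?_ ?_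
    · rintro y hy _ ⟨b, rfl⟩
      rw [map_mul, ih y hy]
      simp only [sign, lift_del]
      simp [pow_succ]
    · intro y z hy hz
      rw [map_add, hy, hz, smul_add]

lemma of_injective : Function.Injective (of A) := by
  have h : ∀ a, lift (AlgHom.id ℂ A) 0 (by simp) (of A a) = a := fun a => lift_of _ _ _ a
  exact Function.LeftInverse.injective h

end OmegaAlg

/-- The universal differential calculus `Ω(A)`. -/
def Omega : DiffCalculus A where
  Carrier := OmegaAlg A
  gr := OmegaAlg.gr A
  d := OmegaAlg.d
  d_mem := OmegaAlg.d_mem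
  d_d := OmegaAlg.d_d
  leibniz n x hx y := by
    rw [OmegaAlg.d_mul, OmegaAlg.sign_of_mem n x hx, smul_mul_assoc]
  ι := OmegaAlg.of A
  ι_injective := OmegaAlg.of_injective
  gr_zero := rfl
  generated := by
    have : (fun a => OmegaAlg.d (OmegaAlg.of A a)) = OmegaAlg.del A := funext OmegaAlg.d_of
    rw [this]
    exact OmegaAlg.adjoin_eq_top

end Omega

section ext

variable {A A' : Type*} [Ring A] [Algebra ℂ A] [Ring A'] [Algebra ℂ A']

namespace OmegaAlg

variable (ψ : A →ₐ[ℂ] A') (Γ : DiffCalculus A')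

/-- The algebra homomorphism underlying the differential extension. -/
def ext : OmegaAlg A →ₐ[ℂ] Γ.Carrier :=
  lift (Γ.ι.comp ψ) (Γ.d ∘ₗ Γ.ι.toLinearMap ∘ₗ ψ.toLinearMap) fun a b => by
    simp only [LinearMap.comp_apply, AlgHom.toLinearMap_apply, AlgHom.comp_apply, map_mul]
    exact Γ.leibniz_zero _ _

lemma ext_of (a : A) : ext ψ Γ (of A a) = Γ.ι (ψ a) := lift_of _ _ _ a

lemma ext_del (a : A) : ext ψ Γ (del A a) = Γ.d (Γ.ι (ψ a)) := lift_del _ _ _ a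

lemma ext_gr (n : ℕ) (x : OmegaAlg A) (hx : x ∈ gr A n) : ext ψ Γ x ∈ Γ.gr n := by
  induction n generalizing x with
  | zero =>
    obtain ⟨a, rfl⟩ := hx
    exact (ext_of ψ Γ a) ▸ Γ.ι_mem _
  | succ n ih =>
    refine Submodule.mul_induction_on (C := fun x => ext ψ Γ x ∈ Γ.gr (n + 1)) hx ?_ ?_
    · rintro y hy _ ⟨b, rfl⟩
      rw [map_mul, ext_del]
      exact SetLike.mul_mem_graded (ih y hy) (Γ.dι_mem _)
    · intro y z hy hz
      rw [map_add]; exact add_mem hy hz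

lemma ext_sign (x : OmegaAlg A) : ext ψ Γ (sign x) = Γ.sgn (ext ψ Γ x) := by
  refine DirectSum.Decomposition.inductionOn (gr A)
    (motive := fun x => ext ψ Γ (sign x) = Γ.sgn (ext ψ Γ x)) (by simp) ?_ ?_ x
  · rintro n ⟨x, hx⟩
    rw [sign_of_mem n x hx, Γ.sgn_of_mem (ext_gr ψ Γ n x hx), map_smul]
  · intro x y hx hy
    rw [map_add, map_add, hx, hy, map_add, map_add]

lemma ext_d (x : OmegaAlg A) : ext ψ Γ (d x) = Γ.d (ext ψ Γ x) := by
  refine induction (p := fun x => ext ψ Γ (d x) = Γ.d (ext ψ Γ x)) ?_ ?_ ?_ ?_ x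
  · intro a; rw [d_of, ext_del, ext_of]
  · intro a; rw [d_del, ext_del, Γ.d_d, map_zero]
  · intro x y hx hy
    rw [map_add, map_add, hx, hy, map_add, map_add]
  · intro x y hx hy
    rw [d_mul, map_mul (ext ψ Γ) x y, Γ.leibniz_sgn, map_add, map_mul, map_mul, ext_sign, hx, hy]

end OmegaAlg

/-- The differential extension `Ω(A) → Γ(A')` of an algebra homomorphism `ψ : A → A'`: the
homomorphism of differential algebras with `a₀ da₁ ⋯ daₙ ↦ ψ(a₀) dψ(a₁) ⋯ dψ(aₙ)`. -/
def Omega.ext (ψ : A →ₐ[ℂ] A') (Γ : DiffCalculus A') : DiffHom (Omega A) Γ where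
  toAlgHom := OmegaAlg.ext ψ Γ
  map_gr := OmegaAlg.ext_gr ψ Γ
  map_d := OmegaAlg.ext_d ψ Γ

lemma Omega.ext_ι (ψ : A →ₐ[ℂ] A') (Γ : DiffCalculus A') (a : A) :
    (Omega.ext ψ Γ).toAlgHom ((Omega A).ι a) = Γ.ι (ψ a) := OmegaAlg.ext_of ψ Γ a

lemma Omega.ext_surjective (ψ : A →ₐ[ℂ] A') (hψ : Function.Surjective ψ) (Γ : DiffCalculus A') :
    Function.Surjective (Omega.ext ψ Γ).toAlgHom := by
  rw [← AlgHom.range_eq_top, eq_top_iff, ← Γ.generated, Algebra.adjoin_le_iff]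
  rintro _ (⟨a, rfl⟩ | ⟨a, rfl⟩)
  · obtain ⟨a, rfl⟩ := hψ a
    exact ⟨(Omega A).ι a, OmegaAlg.ext_of ψ Γ a⟩
  · obtain ⟨a, rfl⟩ := hψ a
    exact ⟨(Omega A).d ((Omega A).ι a), (OmegaAlg.ext_d ψ Γ _).trans (congrArg Γ.d (OmegaAlg.ext_of ψ Γ a))⟩

/-- The differential ideal `J(A) ⊆ Ω(A)` corresponding to a differential calculus over `A`, the
kernel of `Ω(A) → Γ(A)`. -/
def DiffCalculus.ideal (Γ : DiffCalculus A) : DiffIdeal (Omega A) :=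
  (Omega.ext (AlgHom.id ℂ A) Γ).ker

lemma DiffCalculus.proj_zero_of_mem_ideal (Γ : DiffCalculus A) {x : (Omega A).Carrier}
    (hx : x ∈ Γ.ideal.toIdeal) : (Omega A).proj 0 x = 0 := by
  have h : (Omega.ext (AlgHom.id ℂ A) Γ).toAlgHom ((Omega A).proj 0 x) = 0 :=
    Γ.ideal.proj_mem x hx 0
  have h0 := (Omega A).proj_mem 0 x
  rw [(Omega A).gr_zero] at h0
  obtain ⟨a, ha⟩ := h0
  rw [AlgHom.toLinearMap_apply] at ha
  rw [← ha, Omega.ext_ι, AlgHom.id_apply] at h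
  rw [← ha, Γ.ι_injective (h.trans (map_zero _).symm), map_zero]

end ext

/-! ## The skew tensor product of differential calculi -/

section Skew

open GradedTensorProduct

variable {A B : Type*} [Ring A] [Algebra ℂ A] [Ring B] [Algebra ℂ B]
  (Γ : DiffCalculus A) (Δ : DiffCalculus B)

/-- The graded tensor product algebra, with `(γ ⊗ ρ)(ω ⊗ τ) = (-1)^{mn} γω ⊗ ρτ` for `ρ` of degree
`m` and `ω` of degree `n`. -/
abbrev SkewAlg : Type _ := Γ.gr ᵍ⊗[ℂ] Δ.gr

lemma smul_gtmul (c : ℂ) (a : Γ.Carrier) (b : Δ.Carrier) :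
    ((c • a) ᵍ⊗ₜ[ℂ] b : SkewAlg Γ Δ) = c • (a ᵍ⊗ₜ[ℂ] b) := by
  rw [tmul, ← TensorProduct.smul_tmul', map_smul]

lemma zero_gtmul (b : Δ.Carrier) : ((0 : Γ.Carrier) ᵍ⊗ₜ[ℂ] b : SkewAlg Γ Δ) = 0 := by
  rw [tmul, TensorProduct.zero_tmul, map_zero]

lemma gtmul_zero (a : Γ.Carrier) : (a ᵍ⊗ₜ[ℂ] (0 : Δ.Carrier) : SkewAlg Γ Δ) = 0 := by
  rw [tmul, TensorProduct.tmul_zero, map_zero]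

lemma skew_mul {q p : ℕ} (a : Γ.Carrier) {b : Δ.Carrier} (hb : b ∈ Δ.gr q)
    {a' : Γ.Carrier} (ha' : a' ∈ Γ.gr p) (b' : Δ.Carrier) :
    ((a ᵍ⊗ₜ[ℂ] b : SkewAlg Γ Δ) * (a' ᵍ⊗ₜ[ℂ] b')) =
      ((-1 : ℂ) ^ (q * p)) • ((a * a') ᵍ⊗ₜ[ℂ] (b * b')) := by
  have := tmul_coe_mul_coe_tmul (R := ℂ) Γ.gr Δ.gr a ⟨b, hb⟩ ⟨a', ha'⟩ b'
  refine this.trans ?_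
  rcases Nat.even_or_odd (q * p) with h | h
  · simp [h.neg_one_pow]
  · simp [h.neg_one_pow, Units.smul_def]

/-- Homogeneous generators of the skew tensor product. -/
def skewGen (n : ℕ) : Set (SkewAlg Γ Δ) :=
  {x | ∃ p q, p + q = n ∧ ∃ a ∈ Γ.gr p, ∃ b ∈ Δ.gr q, x = a ᵍ⊗ₜ[ℂ] b}

/-- The component of degree `n` of the skew tensor product: the sum of all `Γᵖ ⊗ Δ^q`,
`p + q = n`. -/
def skewGr (n : ℕ) : Submodule ℂ (SkewAlg Γ Δ) := Submodule.span ℂ (skewGen Γ Δ n)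

variable {Γ Δ} in
lemma tmul_mem_skewGr {p q n : ℕ} (h : p + q = n) {a : Γ.Carrier} (ha : a ∈ Γ.gr p)
    {b : Δ.Carrier} (hb : b ∈ Δ.gr q) : (a ᵍ⊗ₜ[ℂ] b : SkewAlg Γ Δ) ∈ skewGr Γ Δ n :=
  Submodule.subset_span ⟨p, q, h, a, ha, b, hb, rfl⟩

instance skewGr_gradedMonoid : SetLike.GradedMonoid (skewGr Γ Δ) where
  one_mem := tmul_mem_skewGr (add_zero 0) (SetLike.one_mem_graded Γ.gr)
    (SetLike.one_mem_graded Δ.gr)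
  mul_mem := by
    intro i j x y hx hy
    have h := Submodule.mul_mem_mul hx hy
    unfold skewGr at h
    rw [Submodule.span_mul_span] at h
    refine Submodule.span_le.2 ?_ h
    rintro _ ⟨_, ⟨p, q, rfl, a, ha, b, hb, rfl⟩, _, ⟨p', q', rfl, a', ha', b', hb', rfl⟩, rfl⟩
    simp only
    rw [skew_mul Γ Δ a hb ha' b']
    exact Submodule.smul_mem _ _ (tmul_mem_skewGr (by omega)
      (SetLike.mul_mem_graded ha ha') (SetLike.mul_mem_graded hb hb'))

/-- The bilinear map `Γᵖ × Δ^q → ⨁ₙ` into the component of degree `p + q`. -/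
def skewDecAux (p q : ℕ) : Γ.gr p →ₗ[ℂ] Δ.gr q →ₗ[ℂ] ⨁ n, skewGr Γ Δ n :=
  LinearMap.mk₂ ℂ
    (fun a b => DirectSum.lof ℂ ℕ (fun n => skewGr Γ Δ n) (p + q)
      ⟨(a : Γ.Carrier) ᵍ⊗ₜ[ℂ] (b : Δ.Carrier), tmul_mem_skewGr rfl a.2 b.2⟩)
    (fun a a' b => by
      rw [← map_add]
      exact congrArg _ (Subtype.ext (by simp [tmul, TensorProduct.add_tmul])))
    (fun c a b => by
      rw [← map_smul]
      exact congrArg _ (Subtype.ext (smul_gtmul Γ Δ c _ _)))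
    (fun a b b' => by
      rw [← map_add]
      exact congrArg _ (Subtype.ext (by simp [tmul, TensorProduct.tmul_add])))
    (fun c a b => by
      rw [← map_smul]
      exact congrArg _ (Subtype.ext (by simp [tmul, TensorProduct.tmul_smul])))

/-- The decomposition of the skew tensor product into homogeneous components. -/
def skewDec : SkewAlg Γ Δ →ₗ[ℂ] ⨁ n, skewGr Γ Δ n :=
  TensorProduct.lift
    (DirectSum.toModule ℂ ℕ _ (fun p => LinearMap.flip
      (DirectSum.toModule ℂ ℕ _ (fun q => (skewDecAux Γ Δ p q).flip) ∘ₗ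
        (DirectSum.decomposeLinearEquiv Δ.gr).toLinearMap)) ∘ₗ
      (DirectSum.decomposeLinearEquiv Γ.gr).toLinearMap) ∘ₗ
  ((GradedTensorProduct.of ℂ Γ.gr Δ.gr).symm : SkewAlg Γ Δ →ₗ[ℂ] Γ.Carrier ⊗[ℂ] Δ.Carrier)

lemma skewDec_tmul {p q : ℕ} {a : Γ.Carrier} (ha : a ∈ Γ.gr p) {b : Δ.Carrier} (hb : b ∈ Δ.gr q) :
    skewDec Γ Δ (a ᵍ⊗ₜ[ℂ] b) = DirectSum.lof ℂ ℕ (fun n => skewGr Γ Δ n) (p + q)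
      ⟨a ᵍ⊗ₜ[ℂ] b, tmul_mem_skewGr rfl ha hb⟩ := by
  unfold skewDec
  simp only [LinearMap.comp_apply, LinearEquiv.coe_coe, of_symm_of, TensorProduct.lift.tmul,
    DirectSum.decomposeLinearEquiv_apply]
  rw [DirectSum.decompose_of_mem _ ha, ← DirectSum.lof_eq_of ℂ, DirectSum.toModule_lof,
    LinearMap.flip_apply]
  simp only [LinearMap.comp_apply, LinearEquiv.coe_coe, DirectSum.decomposeLinearEquiv_apply]
  rw [DirectSum.decompose_of_mem _ hb, ← DirectSum.lof_eq_of ℂ, DirectSum.toModule_lof]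
  rfl

lemma skew_induction {p : SkewAlg Γ Δ → Prop} (h0 : p 0) (hadd : ∀ x y, p x → p y → p (x + y))
    (h : ∀ m n, ∀ a ∈ Γ.gr m, ∀ b ∈ Δ.gr n, p (a ᵍ⊗ₜ[ℂ] b)) (x : SkewAlg Γ Δ) : p x := by
  obtain ⟨x, rfl⟩ := (GradedTensorProduct.of ℂ Γ.gr Δ.gr).surjective x
  induction x using TensorProduct.induction_on with
  | zero => rw [map_zero]; exact h0
  | add x y hx hy => rw [map_add]; exact hadd _ _ hx hy
  | tmul a b =>
    refine Γ.gr_induction (p := fun a => p (GradedTensorProduct.of ℂ Γ.gr Δ.gr (a ⊗ₜ b)))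
      (by rw [TensorProduct.zero_tmul, map_zero]; exact h0) ?_
      (fun x y hx hy => by rw [TensorProduct.add_tmul, map_add]; exact hadd _ _ hx hy) a
    intro m a ha
    refine Δ.gr_induction (p := fun b => p (GradedTensorProduct.of ℂ Γ.gr Δ.gr (a ⊗ₜ b)))
      (by rw [TensorProduct.tmul_zero, map_zero]; exact h0) ?_
      (fun x y hx hy => by rw [TensorProduct.tmul_add, map_add]; exact hadd _ _ hx hy) b
    intro n b hb
    exact h m n a ha b hb

instance skewGr_decomposition : DirectSum.Decomposition (skewGr Γ Δ) :=
  decompositionOfSpan (skewGr Γ Δ) (skewGen Γ Δ) (fun _ => rfl) (skewDec Γ Δ)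
    (by
      rintro n _ hx ⟨p, q, rfl, a, ha, b, hb, rfl⟩
      exact skewDec_tmul Γ Δ ha hb)
    (by
      rw [eq_top_iff]
      rintro x -
      refine skew_induction Γ Δ (p := fun x => x ∈ _) (zero_mem _)
        (fun x y hx hy => add_mem hx hy) ?_ x
      intro m n a ha b hb
      exact Submodule.subset_span (Set.mem_iUnion.2 ⟨m + n, m, n, rfl, a, ha, b, hb, rfl⟩))

instance skewGr_gradedAlgebra : GradedAlgebra (skewGr Γ Δ) where

/-- The differential `d(γ ⊗ ρ) = dγ ⊗ ρ + (-1)ⁿ γ ⊗ dρ` for `γ` of degree `n`. -/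
def skewD : SkewAlg Γ Δ →ₗ[ℂ] SkewAlg Γ Δ :=
  (GradedTensorProduct.of ℂ Γ.gr Δ.gr).toLinearMap ∘ₗ
    (TensorProduct.map Γ.d LinearMap.id + TensorProduct.map Γ.sgn Δ.d) ∘ₗ
      ((GradedTensorProduct.of ℂ Γ.gr Δ.gr).symm : SkewAlg Γ Δ →ₗ[ℂ] Γ.Carrier ⊗[ℂ] Δ.Carrier)

lemma skewD_tmul {p : ℕ} {a : Γ.Carrier} (ha : a ∈ Γ.gr p) (b : Δ.Carrier) :
    skewD Γ Δ (a ᵍ⊗ₜ[ℂ] b) = Γ.d a ᵍ⊗ₜ[ℂ] b + (-1 : ℂ) ^ p • (a ᵍ⊗ₜ[ℂ] Δ.d b) := by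
  rw [← smul_gtmul, ← Γ.sgn_of_mem ha]
  simp [skewD]

/-- The embedding of `A ⊗ B` as the component of degree zero. -/
def skewι : A ⊗[ℂ] B →ₐ[ℂ] SkewAlg Γ Δ :=
  Algebra.TensorProduct.lift ((includeLeft Γ.gr Δ.gr).comp Γ.ι) ((includeRight Γ.gr Δ.gr).comp Δ.ι)
    (fun a b => by
      change (Γ.ι a ᵍ⊗ₜ[ℂ] 1 : SkewAlg Γ Δ) * (1 ᵍ⊗ₜ[ℂ] Δ.ι b) =
        (1 ᵍ⊗ₜ[ℂ] Δ.ι b) * (Γ.ι a ᵍ⊗ₜ[ℂ] 1)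
      rw [tmul_one_mul_one_tmul, skew_mul Γ Δ 1 (Δ.ι_mem b) (Γ.ι_mem a) 1]
      simp)

lemma skewι_tmul (a : A) (b : B) :
    skewι Γ Δ (a ⊗ₜ b) = (Γ.ι a ᵍ⊗ₜ[ℂ] Δ.ι b : SkewAlg Γ Δ) := by
  refine (Algebra.TensorProduct.lift_tmul _ _ _ a b).trans ?_
  exact tmul_one_mul_one_tmul Γ.gr Δ.gr (Γ.ι a) (Δ.ι b)

lemma skewι_eq (x : A ⊗[ℂ] B) : skewι Γ Δ x =
    GradedTensorProduct.of ℂ Γ.gr Δ.gr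
      (TensorProduct.map Γ.ι.toLinearMap Δ.ι.toLinearMap x) := by
  induction x using TensorProduct.induction_on with
  | zero => simp
  | add x y hx hy => rw [map_add, map_add, map_add, hx, hy]
  | tmul a b => exact skewι_tmul Γ Δ a b

/-- The skew tensor product `Γ ⊗̂ Δ`, a differential calculus over `A ⊗ B`. -/
def skew : DiffCalculus (A ⊗[ℂ] B) where
  Carrier := SkewAlg Γ Δ
  gr := skewGr Γ Δ
  d := skewD Γ Δ
  d_mem := by
    intro n x hx
    refine (Submodule.span_le (p := (skewGr Γ Δ (n + 1)).comap (skewD Γ Δ))).2 ?_ hx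
    rintro _ ⟨p, q, rfl, a, ha, b, hb, rfl⟩
    rw [SetLike.mem_coe, Submodule.mem_comap, skewD_tmul Γ Δ ha]
    exact add_mem (tmul_mem_skewGr (by omega) (Γ.d_mem p a ha) hb)
      (Submodule.smul_mem _ _ (tmul_mem_skewGr (by omega) ha (Δ.d_mem q b hb)))
  d_d := by
    intro x
    refine skew_induction Γ Δ (p := fun x => skewD Γ Δ (skewD Γ Δ x) = 0) (by simp)
      (fun x y hx hy => by rw [map_add, map_add, hx, hy, add_zero]) ?_ x
    intro m n a ha b hb
    rw [skewD_tmul Γ Δ ha, map_add, map_smul, skewD_tmul Γ Δ (Γ.d_mem m a ha), skewD_tmul Γ Δ ha,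
      Γ.d_d, Δ.d_d, zero_gtmul, gtmul_zero, pow_succ]
    module
  leibniz := by
    intro n x hx y
    refine (Submodule.span_le (p := LinearMap.eqLocus
      (skewD Γ Δ ∘ₗ (LinearMap.mul ℂ (SkewAlg Γ Δ)).flip y)
      ((LinearMap.mul ℂ (SkewAlg Γ Δ)).flip y ∘ₗ skewD Γ Δ +
        (-1 : ℂ) ^ n • (LinearMap.mul ℂ (SkewAlg Γ Δ)).flip (skewD Γ Δ y)))).2 ?_ hx
    rintro _ ⟨p, q, rfl, a, ha, b, hb, rfl⟩
    simp only [SetLike.mem_coe, LinearMap.mem_eqLocus, LinearMap.comp_apply, LinearMap.flip_apply,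
      LinearMap.mul_apply', LinearMap.add_apply, LinearMap.smul_apply]
    refine skew_induction Γ Δ (p := fun y => skewD Γ Δ ((a ᵍ⊗ₜ[ℂ] b) * y) =
      skewD Γ Δ (a ᵍ⊗ₜ[ℂ] b) * y + (-1 : ℂ) ^ (p + q) • ((a ᵍ⊗ₜ[ℂ] b) * skewD Γ Δ y))
      (by simp) (fun x y hx hy => by
        rw [mul_add, map_add, hx, hy, map_add, mul_add, mul_add, smul_add]; abel) ?_ y
    intro p' q' a' ha' b' hb'
    rw [skew_mul Γ Δ a hb ha' b', map_smul, skewD_tmul Γ Δ (SetLike.mul_mem_graded ha ha'),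
      skewD_tmul Γ Δ ha, skewD_tmul Γ Δ ha', add_mul, mul_add, smul_mul_assoc, mul_smul_comm,
      skew_mul Γ Δ _ hb ha' b', skew_mul Γ Δ _ (Δ.d_mem q b hb) ha' b',
      skew_mul Γ Δ _ hb (Γ.d_mem p' a' ha') b', skew_mul Γ Δ _ hb ha' _,
      Γ.leibniz p a ha, Δ.leibniz q b hb]
    have h1 : ((Γ.d a * a' + (-1 : ℂ) ^ p • (a * Γ.d a')) ᵍ⊗ₜ[ℂ] (b * b') : SkewAlg Γ Δ) =
        (Γ.d a * a') ᵍ⊗ₜ[ℂ] (b * b') + (-1 : ℂ) ^ p • ((a * Γ.d a') ᵍ⊗ₜ[ℂ] (b * b')) := by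
      rw [← smul_gtmul, ← map_add, ← TensorProduct.add_tmul]
    have h2 : ((a * a') ᵍ⊗ₜ[ℂ] (Δ.d b * b' + (-1 : ℂ) ^ q • (b * Δ.d b')) : SkewAlg Γ Δ) =
        (a * a') ᵍ⊗ₜ[ℂ] (Δ.d b * b') + (-1 : ℂ) ^ q • ((a * a') ᵍ⊗ₜ[ℂ] (b * Δ.d b')) := by
      simp [tmul, TensorProduct.tmul_add, TensorProduct.tmul_smul]
    rw [h1, h2]
    have hq : ((-1 : ℂ) ^ q) * ((-1 : ℂ) ^ q) = 1 := by rw [← mul_pow]; simp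
    have e1 : (-1 : ℂ) ^ ((q + 1) * p') = (-1) ^ (q * p') * (-1) ^ p' := by
      rw [← pow_add]; congr 1; ring
    have e2 : (-1 : ℂ) ^ (q * (p' + 1)) = (-1) ^ (q * p') * (-1) ^ q := by
      rw [← pow_add]; congr 1
    rw [e1, e2, pow_add, pow_add]
    simp only [smul_add, smul_smul]
    have e3 : (-1 : ℂ) ^ p * (-1) ^ q * ((-1) ^ (q * p') * (-1) ^ q) =
        (-1) ^ (q * p') * (-1) ^ p := by
      linear_combination ((-1 : ℂ) ^ p * (-1) ^ (q * p')) * hq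
    rw [e3]
    module
  ι := skewι Γ Δ
  ι_injective := by
    have h : Function.Injective (TensorProduct.map Γ.ι.toLinearMap Δ.ι.toLinearMap) := by
      have : TensorProduct.map Γ.ι.toLinearMap Δ.ι.toLinearMap =
          LinearMap.lTensor _ Δ.ι.toLinearMap ∘ₗ LinearMap.rTensor _ Γ.ι.toLinearMap :=
        (LinearMap.lTensor_comp_rTensor _ _ _).symm
      rw [this, LinearMap.coe_comp]
      exact (Module.Flat.lTensor_preserves_injective_linearMap _ Δ.ι_injective).comp
        (Module.Flat.rTensor_preserves_injective_linearMap _ Γ.ι_injective)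
    intro x y hxy
    rw [skewι_eq, skewι_eq] at hxy
    exact h ((GradedTensorProduct.of ℂ Γ.gr Δ.gr).injective hxy)
  gr_zero := by
    apply le_antisymm
    · refine Submodule.span_le.2 ?_
      rintro _ ⟨p, q, hpq, a, ha, b, hb, rfl⟩
      obtain ⟨rfl, rfl⟩ : p = 0 ∧ q = 0 := by omega
      rw [Γ.gr_zero] at ha
      rw [Δ.gr_zero] at hb
      obtain ⟨a, rfl⟩ := ha
      obtain ⟨b, rfl⟩ := hb
      exact ⟨a ⊗ₜ b, skewι_tmul Γ Δ a b⟩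
    · rintro _ ⟨x, rfl⟩
      induction x using TensorProduct.induction_on with
      | zero => rw [map_zero]; exact zero_mem _
      | add x y hx hy => rw [map_add]; exact add_mem hx hy
      | tmul a b =>
        have := tmul_mem_skewGr (add_zero 0) (Γ.ι_mem a) (Δ.ι_mem b)
        rwa [← skewι_tmul] at this
  generated := by
    set S := Algebra.adjoin ℂ (Set.range (skewι Γ Δ) ∪
      Set.range fun a => skewD Γ Δ (skewι Γ Δ a)) with hS
    have hL : ∀ x, includeLeft Γ.gr Δ.gr x ∈ S := by
      intro x
      have hx : x ∈ Algebra.adjoin ℂ (Set.range Γ.ι ∪ Set.range fun a => Γ.d (Γ.ι a)) := by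
        rw [Γ.generated]; trivial
      refine (Algebra.adjoin_le_iff (S := S.comap (includeLeft Γ.gr Δ.gr))).2 ?_ hx
      rintro _ (⟨a, rfl⟩ | ⟨a, rfl⟩)
      · refine Algebra.subset_adjoin (Or.inl ⟨a ⊗ₜ 1, ?_⟩)
        rw [skewι_tmul, map_one]; rfl
      · refine Algebra.subset_adjoin (Or.inr ⟨a ⊗ₜ 1, ?_⟩)
        simp only
        rw [skewι_tmul, map_one, skewD_tmul Γ Δ (Γ.ι_mem a)]
        have : Δ.d 1 = 0 := by
          have := Δ.leibniz_zero 1 1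
          simpa using this
        simp [this, gtmul_zero]
    have hR : ∀ x, includeRight Γ.gr Δ.gr x ∈ S := by
      intro x
      have hx : x ∈ Algebra.adjoin ℂ (Set.range Δ.ι ∪ Set.range fun a => Δ.d (Δ.ι a)) := by
        rw [Δ.generated]; trivial
      refine (Algebra.adjoin_le_iff (S := S.comap (includeRight Γ.gr Δ.gr))).2 ?_ hx
      rintro _ (⟨a, rfl⟩ | ⟨a, rfl⟩)
      · refine Algebra.subset_adjoin (Or.inl ⟨1 ⊗ₜ a, ?_⟩)
        rw [skewι_tmul, map_one]; rfl
      · refine Algebra.subset_adjoin (Or.inr ⟨1 ⊗ₜ a, ?_⟩)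
        simp only
        rw [skewι_tmul, skewD_tmul Γ Δ (Γ.ι_mem 1), map_one]
        have : Γ.d 1 = 0 := by
          have := Γ.leibniz_zero 1 1
          simpa using this
        simp [this, zero_gtmul]
    rw [eq_top_iff]
    rintro x -
    refine skew_induction Γ Δ (p := fun x => x ∈ S) (zero_mem _)
      (fun x y hx hy => add_mem hx hy) ?_ x
    intro m n a _ b _
    rw [← tmul_one_mul_one_tmul]
    exact mul_mem (hL a) (hR b)

end Skew

/-! ## Locally trivial quantum principal fibre bundles -/

section Bundle

open Coalgebra

instance supIsTwoSided {B : Type*} [Ring B] (J K : Ideal B) [J.IsTwoSided] [K.IsTwoSided] :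
    (J ⊔ K).IsTwoSided := ⟨by
  intro a b h
  obtain ⟨x, hx, y, hy, rfl⟩ := Submodule.mem_sup.1 h
  rw [add_mul]
  exact add_mem (Submodule.mem_sup_left (J.mul_mem_right b hx))
    (Submodule.mem_sup_right (K.mul_mem_right b hy))⟩

/-- A complete covering of an algebra: two-sided ideals `Jᵢ` with zero intersection such that every
family `aᵢ ∈ B/Jᵢ` which agrees in all `B/(Jᵢ + Jⱼ)` comes from an element of `B`. -/
structure IsCompleteCovering {I B : Type*} [Ring B] (J : I → Ideal B) [∀ i, (J i).IsTwoSided] :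
    Prop where
  iInf_eq_bot : ⨅ i, J i = ⊥
  exists_glue : ∀ a : (∀ i, B ⧸ J i),
    (∀ i j, Ideal.Quotient.factor (le_sup_left : J i ≤ J i ⊔ J j) (a i) =
      Ideal.Quotient.factor (le_sup_right : J j ≤ J i ⊔ J j) (a j)) →
    ∃ b, ∀ i, Ideal.Quotient.mk (J i) b = a i

/-- A locally trivial quantum principal fibre bundle over the base algebra `B` with the Hopf algebra
`H` as structure group: a right `H`-comodule algebra `P` with coaction `coact`, a complete covering
`J` of `B`, surjective local trivializations `χ i : P → B/Jᵢ ⊗ H`, and an embedding `ι : B → P` onto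
the coinvariants. -/
structure LocTrivQPFB (I : Type*) (B : Type*) (H : Type*) [Ring B] [Algebra ℂ B] [Ring H]
    [HopfAlgebra ℂ H] where
  P : Type*
  [ring : Ring P]
  [algebra : Algebra ℂ P]
  coact : P →ₐ[ℂ] P ⊗[ℂ] H
  coact_coassoc : ∀ f, TensorProduct.assoc ℂ P H H (coact.toLinearMap.rTensor H (coact f)) =
    (comul : H →ₗ[ℂ] H ⊗[ℂ] H).lTensor P (coact f)
  coact_counit : ∀ f,
    TensorProduct.rid ℂ P ((counit : H →ₗ[ℂ] ℂ).lTensor P (coact f)) = f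
  J : I → Ideal B
  [isTwoSided : ∀ i, (J i).IsTwoSided]
  covering : IsCompleteCovering J
  χ : ∀ i, P →ₐ[ℂ] (B ⧸ J i) ⊗[ℂ] H
  χ_surjective : ∀ i, Function.Surjective (χ i)
  ι : B →ₐ[ℂ] P
  ι_injective : Function.Injective ι
  χ_coact : ∀ i f, (comul : H →ₗ[ℂ] H ⊗[ℂ] H).lTensor (B ⧸ J i) (χ i f) =
    TensorProduct.assoc ℂ (B ⧸ J i) H H ((χ i).toLinearMap.rTensor H (coact f))
  χ_ι : ∀ i a, χ i (ι a) = Ideal.Quotient.mk (J i) a ⊗ₜ 1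
  covering_ker : IsCompleteCovering fun i => RingHom.ker (χ i)
  coinvariants : ∀ f, f ∈ Set.range ι ↔ coact f = f ⊗ₜ 1

attribute [instance] LocTrivQPFB.ring LocTrivQPFB.algebra LocTrivQPFB.isTwoSided

namespace LocTrivQPFB

variable {I B H : Type*} [Ring B] [Algebra ℂ B] [Ring H] [HopfAlgebra ℂ H]
  (Q : LocTrivQPFB I B H)

/-- `Bᵢ = B/Jᵢ`. -/
abbrev Bl (i : I) : Type _ := B ⧸ Q.J i

/-- `Bᵢⱼ = B/(Jᵢ + Jⱼ)`. -/
abbrev Bov (i j : I) : Type _ := B ⧸ (Q.J i ⊔ Q.J j)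

section

variable {Q} {i j k l : I}

/-- The canonical projection `B_k → B_ij`, for `J_k + J_l = J_i + J_j`. -/
def res (h : Q.J k ⊔ Q.J l = Q.J i ⊔ Q.J j) : Q.Bl k →ₐ[ℂ] Q.Bov i j :=
  Ideal.Quotient.factorₐ ℂ (h ▸ le_sup_left)

/-- The canonical projection `B_k ⊗ H → B_ij ⊗ H`. -/
def resH (h : Q.J k ⊔ Q.J l = Q.J i ⊔ Q.J j) : Q.Bl k ⊗[ℂ] H →ₐ[ℂ] Q.Bov i j ⊗[ℂ] H :=
  Algebra.TensorProduct.map (res h) (AlgHom.id ℂ H)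

lemma res_surjective (h : Q.J k ⊔ Q.J l = Q.J i ⊔ Q.J j) : Function.Surjective (res h) := by
  intro x
  obtain ⟨b, rfl⟩ := Ideal.Quotient.mk_surjective x
  exact ⟨Ideal.Quotient.mk _ b, rfl⟩

lemma res_mk (h : Q.J k ⊔ Q.J l = Q.J i ⊔ Q.J j) (b : B) :
    res h (Ideal.Quotient.mk _ b) = Ideal.Quotient.mk _ b := rfl

lemma resH_eq (h : Q.J k ⊔ Q.J l = Q.J i ⊔ Q.J j) (x : Q.Bl k ⊗[ℂ] H) :
    resH h x = (res h).toLinearMap.rTensor H x := rfl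

lemma resH_surjective (h : Q.J k ⊔ Q.J l = Q.J i ⊔ Q.J j) : Function.Surjective (resH h) :=
  LinearMap.rTensor_surjective H (res_surjective h)

end

/-- An element of `P ⊗ H` that vanishes in all charts is zero. -/
lemma rTensor_χ_injective (x : Q.P ⊗[ℂ] H)
    (hx : ∀ i, (Q.χ i).toLinearMap.rTensor H x = 0) : x = 0 := by
  classical
  let b := Module.Basis.ofVectorSpace ℂ H
  have key : ∀ {M N : Type _} [AddCommGroup M] [Module ℂ M] [AddCommGroup N] [Module ℂ N]
      (f : M →ₗ[ℂ] N) (y : M ⊗[ℂ] H) (n),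
      TensorProduct.equivFinsuppOfBasisRight b (f.rTensor H y) n =
        f (TensorProduct.equivFinsuppOfBasisRight b y n) := by
    intro M N _ _ _ _ f y n
    induction y using TensorProduct.induction_on with
    | zero => simp
    | add y z hy hz => simp only [map_add, Finsupp.add_apply, hy, hz]
    | tmul m h =>
      rw [LinearMap.rTensor_tmul, TensorProduct.equivFinsuppOfBasisRight_apply_tmul_apply,
        TensorProduct.equivFinsuppOfBasisRight_apply_tmul_apply, map_smul]
  apply (TensorProduct.equivFinsuppOfBasisRight b).injective
  rw [map_zero]
  ext n
  have h0 : TensorProduct.equivFinsuppOfBasisRight b x n ∈ ⨅ i, RingHom.ker (Q.χ i) := by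
    rw [Ideal.mem_iInf]
    intro i
    have := key (Q.χ i).toLinearMap x n
    rw [hx i, map_zero] at this
    exact this.symm
  rw [Q.covering_ker.iInf_eq_bot] at h0
  exact h0

/-- A linear lift of `h ↦ 1 ⊗ h` in the chart `k`. -/
lemma exists_lift (k : I) : ∃ γ : H →ₗ[ℂ] Q.P, γ 1 = 1 ∧ ∀ h, Q.χ k (γ h) = 1 ⊗ₜ h := by
  obtain ⟨s, hs⟩ := LinearMap.exists_rightInverse_of_surjective (Q.χ k).toLinearMap
    (LinearMap.range_eq_top.2 (Q.χ_surjective k))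
  have hs' : ∀ x, Q.χ k (s x) = x := fun x => LinearMap.congr_fun hs x
  refine ⟨s ∘ₗ TensorProduct.mk ℂ _ H 1 +
    LinearMap.toSpanSingleton ℂ _ (1 - s (1 ⊗ₜ 1)) ∘ₗ (counit : H →ₗ[ℂ] ℂ), ?_, fun h => ?_⟩
  · simp
  · simp [hs', Algebra.TensorProduct.one_def]

/-- Averaging of an element with respect to the chart `k`. -/
lemma exists_average (k : I) (f : Q.P) : ∃ f' : Q.P,
    Q.χ k f' = (TensorProduct.rid ℂ (Q.Bl k) ((counit : H →ₗ[ℂ] ℂ).lTensor _ (Q.χ k f))) ⊗ₜ 1 ∧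
    ∀ m b, Q.χ m f = b ⊗ₜ 1 → Q.χ m f' = b ⊗ₜ 1 := by
  obtain ⟨γ, h1, hγ⟩ := Q.exists_lift k
  let E : Q.P →ₗ[ℂ] Q.P := LinearMap.mul' ℂ Q.P ∘ₗ
    (γ ∘ₗ HopfAlgebra.antipode ℂ).lTensor Q.P ∘ₗ Q.coact.toLinearMap
  have hE : ∀ m g, Q.χ m (E g) = LinearMap.mul' ℂ _
      (((Q.χ m).toLinearMap ∘ₗ γ ∘ₗ HopfAlgebra.antipode ℂ).lTensor _
        ((Q.χ m).toLinearMap.rTensor H (Q.coact g))) := by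
    intro m g
    change Q.χ m (LinearMap.mul' ℂ Q.P ((γ ∘ₗ HopfAlgebra.antipode ℂ).lTensor Q.P
      (Q.coact g))) = _
    induction Q.coact g using TensorProduct.induction_on with
    | zero => simp
    | add x y hx hy => simp only [map_add, hx, hy]
    | tmul x y => simp
  refine ⟨E f, ?_, ?_⟩
  · have hc : (Q.χ k).toLinearMap.rTensor H (Q.coact f) =
        (TensorProduct.assoc ℂ _ H H).symm
          ((comul : H →ₗ[ℂ] H ⊗[ℂ] H).lTensor _ (Q.χ k f)) := by
      rw [Q.χ_coact, LinearEquiv.symm_apply_apply]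
    rw [hE, hc]
    induction Q.χ k f using TensorProduct.induction_on with
    | zero => simp
    | add x y hx hy => simp only [map_add, hx, hy, TensorProduct.add_tmul]
    | tmul a h =>
      have hh : ∀ z : H ⊗[ℂ] H, LinearMap.mul' ℂ _
          (((Q.χ k).toLinearMap ∘ₗ γ ∘ₗ HopfAlgebra.antipode ℂ).lTensor _
            ((TensorProduct.assoc ℂ (Q.Bl k) H H).symm (a ⊗ₜ z))) =
          a ⊗ₜ LinearMap.mul' ℂ H ((HopfAlgebra.antipode ℂ).lTensor H z) := by
        intro z
        induction z using TensorProduct.induction_on with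
        | zero => simp
        | add x y hx hy => simp only [TensorProduct.tmul_add, map_add, hx, hy]
        | tmul x y => simp [hγ]
      rw [LinearMap.lTensor_tmul, hh, HopfAlgebra.mul_antipode_lTensor_comul_apply]
      simp [Algebra.algebraMap_eq_smul_one, TensorProduct.smul_tmul']
  · intro m b hb
    have hc : (Q.χ m).toLinearMap.rTensor H (Q.coact f) = (b ⊗ₜ 1) ⊗ₜ 1 := by
      apply (TensorProduct.assoc ℂ _ H H).injective
      rw [← Q.χ_coact, hb]
      simp [Algebra.TensorProduct.one_def]
    rw [hE, hc]
    simp [h1]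

variable [Finite I]

/-- An element vanishing in the chart `l` has, after applying the counit, coefficients from `J_l` in
the chart `k`. -/
lemma counit_χ_mem (k l : I) (g : Q.P) (hg : Q.χ l g = 0) : ∃ b ∈ Q.J l,
    TensorProduct.rid ℂ (Q.Bl k) ((counit : H →ₗ[ℂ] ℂ).lTensor _ (Q.χ k g)) =
      Ideal.Quotient.mk _ b := by
  classical
  have := Fintype.ofFinite I
  set c := TensorProduct.rid ℂ (Q.Bl k) ((counit : H →ₗ[ℂ] ℂ).lTensor _ (Q.χ k g)) with hc
  have key : ∀ s : Finset I, ∃ e, Q.χ k e = c ⊗ₜ 1 ∧ Q.χ l e = 0 ∧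
      ∀ m ∈ s, ∃ b, Q.χ m e = b ⊗ₜ 1 := by
    intro s
    induction s using Finset.induction_on with
    | empty =>
      obtain ⟨e, h1, h2⟩ := Q.exists_average k g
      refine ⟨e, h1, ?_, by simp⟩
      rw [h2 l 0 (by rw [hg, TensorProduct.zero_tmul]), TensorProduct.zero_tmul]
    | insert m s _ ih =>
      obtain ⟨e, h1, h2, h3⟩ := ih
      obtain ⟨e', h1', h2'⟩ := Q.exists_average m e
      refine ⟨e', h2' k c h1, ?_, ?_⟩
      · rw [h2' l 0 (by rw [h2, TensorProduct.zero_tmul]), TensorProduct.zero_tmul]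
      · intro n hn
        rcases Finset.mem_insert.1 hn with rfl | hn
        · exact ⟨_, h1'⟩
        · obtain ⟨b, hb⟩ := h3 n hn
          exact ⟨b, h2' n b hb⟩
  obtain ⟨e, h1, h2, h3⟩ := key Finset.univ
  have he : Q.coact e = e ⊗ₜ 1 := by
    rw [← sub_eq_zero]
    refine Q.rTensor_χ_injective _ fun m => ?_
    obtain ⟨b, hb⟩ := h3 m (Finset.mem_univ m)
    rw [map_sub, sub_eq_zero]
    apply (TensorProduct.assoc ℂ _ H H).injective
    rw [← Q.χ_coact, hb]
    simp [Algebra.TensorProduct.one_def, hb]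
  obtain ⟨b, rfl⟩ := (Q.coinvariants e).2 he
  rw [Q.χ_ι] at h1 h2
  have hinj : ∀ (m : I) (x : Q.Bl m), TensorProduct.rid ℂ (Q.Bl m)
      ((counit : H →ₗ[ℂ] ℂ).lTensor _ (x ⊗ₜ 1)) = x := by
    intro m x; simp
  refine ⟨b, ?_, ?_⟩
  · have := congrArg (fun y => TensorProduct.rid ℂ (Q.Bl l)
      ((counit : H →ₗ[ℂ] ℂ).lTensor _ y)) h2
    simp only [hinj, map_zero] at this
    exact Ideal.Quotient.eq_zero_iff_mem.1 this
  · have := congrArg (fun y => TensorProduct.rid ℂ (Q.Bl k)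
      ((counit : H →ₗ[ℂ] ℂ).lTensor _ y)) h1
    simp only [hinj] at this
    exact this.symm

section

variable {Q} {i j k l : I}

lemma resH_χ_eq_zero (h : Q.J k ⊔ Q.J l = Q.J i ⊔ Q.J j) (f : Q.P) (hf : Q.χ l f = 0) : resH h (Q.χ k f) = 0 := by
  let L : Q.P →ₗ[ℂ] Q.Bov i j := (res h).toLinearMap ∘ₗ
    (TensorProduct.rid ℂ (Q.Bl k)).toLinearMap ∘ₗ (counit : H →ₗ[ℂ] ℂ).lTensor _ ∘ₗ
      (Q.χ k).toLinearMap
  have hL : ∀ g, Q.χ l g = 0 → L g = 0 := by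
    intro g hg
    obtain ⟨b, hb, hb'⟩ := Q.counit_χ_mem k l g hg
    change res h (TensorProduct.rid ℂ (Q.Bl k) ((counit : H →ₗ[ℂ] ℂ).lTensor _ (Q.χ k g))) = 0
    rw [hb', res_mk]
    exact Ideal.Quotient.eq_zero_iff_mem.2 (h ▸ Submodule.mem_sup_right hb)
  obtain ⟨s, hs⟩ := LinearMap.exists_rightInverse_of_surjective (Q.χ l).toLinearMap
    (LinearMap.range_eq_top.2 (Q.χ_surjective l))
  have hs' : ∀ x, Q.χ l (s x) = x := fun x => LinearMap.congr_fun hs x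
  have hL' : L = (L ∘ₗ s) ∘ₗ (Q.χ l).toLinearMap := by
    ext g
    have := hL (g - s (Q.χ l g)) (by rw [map_sub, hs', sub_self])
    rw [map_sub, sub_eq_zero] at this
    exact this
  have h1 : L.rTensor H (Q.coact f) = 0 := by
    rw [hL', LinearMap.rTensor_comp, LinearMap.comp_apply]
    have : (Q.χ l).toLinearMap.rTensor H (Q.coact f) = 0 := by
      apply (TensorProduct.assoc ℂ _ H H).injective
      rw [← Q.χ_coact, hf, map_zero, map_zero]
    rw [this, map_zero]
  have h2 : L.rTensor H (Q.coact f) = resH h (Q.χ k f) := by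
    have e : L = ((res h).toLinearMap ∘ₗ (TensorProduct.rid ℂ (Q.Bl k)).toLinearMap ∘ₗ
      (counit : H →ₗ[ℂ] ℂ).lTensor _) ∘ₗ (Q.χ k).toLinearMap := rfl
    have hc : (Q.χ k).toLinearMap.rTensor H (Q.coact f) =
        (TensorProduct.assoc ℂ _ H H).symm
          ((comul : H →ₗ[ℂ] H ⊗[ℂ] H).lTensor _ (Q.χ k f)) := by
      rw [Q.χ_coact, LinearEquiv.symm_apply_apply]
    rw [e, LinearMap.rTensor_comp, LinearMap.comp_apply, hc, resH_eq]
    induction Q.χ k f using TensorProduct.induction_on with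
    | zero => simp
    | add x y hx hy => simp only [map_add, hx, hy]
    | tmul a x =>
      have hh : ∀ z : H ⊗[ℂ] H, LinearMap.rTensor H ((res h).toLinearMap ∘ₗ
          (TensorProduct.rid ℂ (Q.Bl k)).toLinearMap ∘ₗ (counit : H →ₗ[ℂ] ℂ).lTensor _)
          ((TensorProduct.assoc ℂ (Q.Bl k) H H).symm (a ⊗ₜ z)) =
          res h a ⊗ₜ TensorProduct.lid ℂ H ((counit : H →ₗ[ℂ] ℂ).rTensor H z) := by
        intro z
        induction z using TensorProduct.induction_on with
        | zero => simp
        | add x y hx hy => simp only [TensorProduct.tmul_add, map_add, hx, hy]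
        | tmul x y => simp [TensorProduct.smul_tmul]
      rw [LinearMap.lTensor_tmul, hh, Coalgebra.rTensor_counit_comul]
      simp
  rw [← h2, h1]

/-- `χ_k(ker χ_l)` is the kernel of `B_k ⊗ H → B_ij ⊗ H`. -/
lemma mem_χ_ker_iff (h : Q.J k ⊔ Q.J l = Q.J i ⊔ Q.J j) (x : Q.Bl k ⊗[ℂ] H) :
    (∃ f, Q.χ l f = 0 ∧ Q.χ k f = x) ↔ resH h x = 0 := by
  constructor
  · rintro ⟨f, hf, rfl⟩
    exact resH_χ_eq_zero h f hf
  · intro hx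
    have hex : Function.Exact (LinearMap.ker (res h).toLinearMap).subtype (res h).toLinearMap := by
      intro y
      simp
    obtain ⟨y, rfl⟩ := (rTensor_exact H hex (res_surjective h) x).1 hx
    clear hx
    induction y using TensorProduct.induction_on with
    | zero => exact ⟨0, map_zero _, by simp⟩
    | add y z hy hz =>
      obtain ⟨f, h1, h2⟩ := hy
      obtain ⟨g, h3, h4⟩ := hz
      exact ⟨f + g, by rw [map_add, h1, h3, add_zero], by rw [map_add, map_add, h2, h4]⟩
    | tmul a t =>
      obtain ⟨a, ha⟩ := a
      obtain ⟨b, rfl⟩ := Ideal.Quotient.mk_surjective a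
      have hb : b ∈ Q.J k ⊔ Q.J l := by
        rw [h]
        exact Ideal.Quotient.eq_zero_iff_mem.1 ha
      obtain ⟨b1, hb1, b2, hb2, rfl⟩ := Submodule.mem_sup.1 hb
      obtain ⟨g, hg⟩ := Q.χ_surjective k (1 ⊗ₜ t)
      refine ⟨Q.ι b2 * g, ?_, ?_⟩
      · rw [map_mul, Q.χ_ι, Ideal.Quotient.eq_zero_iff_mem.2 hb2, TensorProduct.zero_tmul, zero_mul]
      · rw [map_mul, Q.χ_ι, hg]
        simp [Ideal.Quotient.eq_zero_iff_mem.2 hb1]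

end

end LocTrivQPFB

end Bundle

/-! ## Transition functions -/

section Transition

open Coalgebra

namespace LocTrivQPFB

variable {I B H : Type*} [Ring B] [Algebra ℂ B] [Ring H] [HopfAlgebra ℂ H]
  {Q : LocTrivQPFB I B H} {i j k l : I}

lemma swap (h : Q.J k ⊔ Q.J l = Q.J i ⊔ Q.J j) : Q.J l ⊔ Q.J k = Q.J i ⊔ Q.J j :=
  (sup_comm _ _).trans h

variable (Q) in
/-- `ov i j` and `ovSwap i j` select the roles `(k, l) = (i, j)` and `(k, l) = (j, i)` over the same
algebra `B_ij`. -/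
lemma ov (i j : I) : Q.J i ⊔ Q.J j = Q.J i ⊔ Q.J j := rfl

variable (Q) in
lemma ovSwap (i j : I) : Q.J j ⊔ Q.J i = Q.J i ⊔ Q.J j := sup_comm _ _

/-- The homomorphism `P → B_ij ⊗ H`, `f ↦ (π ⊗ id)(χ_k f)`, for `J_k + J_l = J_i + J_j`. It induces
the isomorphism `χ^k : P/(ker χ_k + ker χ_l) → B_ij ⊗ H`. -/
def χOv (h : Q.J k ⊔ Q.J l = Q.J i ⊔ Q.J j) : Q.P →ₐ[ℂ] Q.Bov i j ⊗[ℂ] H :=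
  (resH h).comp (Q.χ k)

lemma χOv_surjective (h : Q.J k ⊔ Q.J l = Q.J i ⊔ Q.J j) : Function.Surjective (χOv h) :=
  (resH_surjective h).comp (Q.χ_surjective k)

variable [Finite I]

lemma χOv_eq_zero_iff (h : Q.J k ⊔ Q.J l = Q.J i ⊔ Q.J j) (f : Q.P) :
    χOv h f = 0 ↔ f ∈ RingHom.ker (Q.χ k) ⊔ RingHom.ker (Q.χ l) := by
  constructor
  · intro hf
    obtain ⟨g, h1, h2⟩ := (mem_χ_ker_iff h (Q.χ k f)).2 hf
    have h3 : f - g ∈ RingHom.ker (Q.χ k) := by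
      rw [RingHom.mem_ker, map_sub, h2, sub_self]
    have := Submodule.add_mem_sup h3 (show g ∈ RingHom.ker (Q.χ l) from h1)
    rwa [sub_add_cancel] at this
  · intro hf
    obtain ⟨x, hx, y, hy, rfl⟩ := Submodule.mem_sup.1 hf
    have h1 : χOv h x = 0 := by
      change resH h (Q.χ k x) = 0
      rw [show Q.χ k x = 0 from hx, map_zero]
    have h2 : χOv h y = 0 := resH_χ_eq_zero h y hy
    rw [map_add, h1, h2, add_zero]

/-- The isomorphism `φ_kl = χ^k ∘ (χ^l)⁻¹` of `B_ij ⊗ H`, for `J_k + J_l = J_i + J_j`. -/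
def φ (h : Q.J k ⊔ Q.J l = Q.J i ⊔ Q.J j) : Q.Bov i j ⊗[ℂ] H →ₐ[ℂ] Q.Bov i j ⊗[ℂ] H :=
  surjLift (χOv (swap h)) (χOv_surjective (swap h)) (χOv h) fun f hf => by
    rw [χOv_eq_zero_iff] at hf ⊢
    rwa [sup_comm]

lemma φ_χOv (h : Q.J k ⊔ Q.J l = Q.J i ⊔ Q.J j) (f : Q.P) : φ h (χOv (swap h) f) = χOv h f :=
  surjLift_apply _ _ _ _ f

/-- The transition function `τ_kl : H → B_ij`, `τ_kl(x) = (id ⊗ ε)(φ_lk(1 ⊗ x))`, for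
`J_k + J_l = J_i + J_j`. -/
def τ (h : Q.J k ⊔ Q.J l = Q.J i ⊔ Q.J j) : H →ₐ[ℂ] Q.Bov i j :=
  ((Algebra.TensorProduct.rid ℂ ℂ (Q.Bov i j)).toAlgHom.comp
    (Algebra.TensorProduct.map (AlgHom.id ℂ _) (Bialgebra.counitAlgHom ℂ H))).comp
      ((φ (swap h)).comp Algebra.TensorProduct.includeRight)

end LocTrivQPFB

end Transition

/-! ## Calculi on the Hopf algebra -/

section Hopf

open Coalgebra

variable {H : Type*} [Ring H] [HopfAlgebra ℂ H]

/-- The inverse of the antipode. -/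
def antipodeInv (hS : Function.Bijective (HopfAlgebra.antipode ℂ : H →ₗ[ℂ] H)) : H →ₗ[ℂ] H :=
  (LinearEquiv.ofBijective (HopfAlgebra.antipode ℂ : H →ₗ[ℂ] H) hS).symm

/-- `η(r) = ∑ S⁻¹(r₂) dr₁ ∈ Ω(H)`. -/
def ηΩ (hS : Function.Bijective (HopfAlgebra.antipode ℂ : H →ₗ[ℂ] H)) :
    H →ₗ[ℂ] (Omega H).Carrier :=
  LinearMap.mul' ℂ (Omega H).Carrier ∘ₗ
    TensorProduct.map ((Omega H).ι.toLinearMap ∘ₗ antipodeInv hS)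
      ((Omega H).d ∘ₗ (Omega H).ι.toLinearMap) ∘ₗ
    (TensorProduct.comm ℂ H H).toLinearMap ∘ₗ comul

lemma DiffCalculus.proj_zero_mul_of_gr_one {A : Type*} [Ring A] [Algebra ℂ A]
    (Γ : DiffCalculus A) (x : Γ.Carrier) {y : Γ.Carrier} (hy : y ∈ Γ.gr 1) :
    Γ.proj 0 (x * y) = 0 := by
  rw [proj_zero_mul, Γ.proj_of_mem hy, if_neg one_ne_zero, mul_zero]

lemma DiffCalculus.proj_zero_map {A M N : Type*} [Ring A] [Algebra ℂ A] [AddCommGroup M]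
    [Module ℂ M] [AddCommGroup N] [Module ℂ N]
    (Γ : DiffCalculus A) (f : M →ₗ[ℂ] A) (g : N →ₗ[ℂ] A) (z : M ⊗[ℂ] N) :
    Γ.proj 0 (LinearMap.mul' ℂ Γ.Carrier (TensorProduct.map (Γ.ι.toLinearMap ∘ₗ f)
      (Γ.d ∘ₗ Γ.ι.toLinearMap ∘ₗ g) z)) = 0 := by
  induction z using TensorProduct.induction_on with
  | zero => simp
  | add x y hx hy => rw [map_add, map_add, map_add, hx, hy, add_zero]
  | tmul x y =>
    rw [TensorProduct.map_tmul, LinearMap.mul'_apply]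
    exact Γ.proj_zero_mul_of_gr_one _ (Γ.dι_mem _)

/-- The differential ideal `J(H) ⊆ Ω(H)` determined by a right ideal `R ⊆ ker ε`: the one generated
by the elements `∑ S⁻¹(r₂) dr₁`, `r ∈ R`. -/
def idealH (hS : Function.Bijective (HopfAlgebra.antipode ℂ : H →ₗ[ℂ] H)) (R : Submodule ℂ H) :
    DiffIdeal (Omega H) :=
  DiffIdeal.generate (Omega H) (ηΩ hS '' R)

/-- The differential calculus `Γ(H) = Ω(H)/J(H)` determined by a right ideal `R ⊆ ker ε`. -/
def calcH (hS : Function.Bijective (HopfAlgebra.antipode ℂ : H →ₗ[ℂ] H)) (R : Submodule ℂ H) :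
    DiffCalculus H :=
  (Omega H).quot (idealH hS R) (AlgHom.id ℂ H) Function.surjective_id fun a =>
    DiffIdeal.ι_mem_generate (by
      rintro _ ⟨r, -, rfl⟩
      exact (Omega H).proj_zero_map (antipodeInv hS) LinearMap.id _)

/-- The linear map `r ↦ ∑ S(r₁) r₃ ⊗ r₂`. -/
def adMap : H →ₗ[ℂ] H ⊗[ℂ] H :=
  (LinearMap.mul' ℂ H ∘ₗ (HopfAlgebra.antipode ℂ).rTensor H).rTensor H ∘ₗ
    (TensorProduct.assoc ℂ H H H).symm.toLinearMap ∘ₗ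
    (TensorProduct.comm ℂ H H).toLinearMap.lTensor H ∘ₗ
    (comul : H →ₗ[ℂ] H ⊗[ℂ] H).lTensor H ∘ₗ comul

/-- Left covariance: the left coaction `h₀dh₁⋯dhₙ ↦ Δ(h₀)(id ⊗ d)Δ(h₁)⋯(id ⊗ d)Δ(hₙ)` exists and
makes `Γ` a left `H`-comodule algebra. -/
def DiffCalculus.LeftCovariant (Γ : DiffCalculus H) : Prop :=
  ∃ δ : Γ.Carrier →ₐ[ℂ] H ⊗[ℂ] Γ.Carrier,
    (∀ h, δ (Γ.ι h) = Γ.ι.toLinearMap.lTensor H (comul h)) ∧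
    (∀ h, δ (Γ.d (Γ.ι h)) = (Γ.d ∘ₗ Γ.ι.toLinearMap).lTensor H (comul h)) ∧
    (∀ x, TensorProduct.assoc ℂ H H Γ.Carrier ((comul : H →ₗ[ℂ] H ⊗[ℂ] H).rTensor _ (δ x)) =
      δ.toLinearMap.lTensor H (δ x)) ∧
    ∀ x, TensorProduct.lid ℂ Γ.Carrier ((counit : H →ₗ[ℂ] ℂ).rTensor _ (δ x)) = x

/-- Right covariance: the right coaction `h₀dh₁⋯dhₙ ↦ Δ(h₀)(d ⊗ id)Δ(h₁)⋯(d ⊗ id)Δ(hₙ)` exists and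
makes `Γ` a right `H`-comodule algebra. -/
def DiffCalculus.RightCovariant (Γ : DiffCalculus H) : Prop :=
  ∃ δ : Γ.Carrier →ₐ[ℂ] Γ.Carrier ⊗[ℂ] H,
    (∀ h, δ (Γ.ι h) = Γ.ι.toLinearMap.rTensor H (comul h)) ∧
    (∀ h, δ (Γ.d (Γ.ι h)) = (Γ.d ∘ₗ Γ.ι.toLinearMap).rTensor H (comul h)) ∧
    (∀ x, TensorProduct.assoc ℂ Γ.Carrier H H (δ.toLinearMap.rTensor H (δ x)) =
      (comul : H →ₗ[ℂ] H ⊗[ℂ] H).lTensor _ (δ x)) ∧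
    ∀ x, TensorProduct.rid ℂ Γ.Carrier ((counit : H →ₗ[ℂ] ℂ).lTensor _ (δ x)) = x

/-- Bicovariance. -/
def DiffCalculus.Bicovariant (Γ : DiffCalculus H) : Prop := Γ.LeftCovariant ∧ Γ.RightCovariant

end Hopf

/-! ## The calculi on the total space and on the overlaps -/

section Calculi

open Coalgebra

/-- Isomorphism of differential calculi over the same algebra: an isomorphism of differential
algebras which is the identity on the algebra. -/
def DiffCalculus.Isomorphic {A : Type*} [Ring A] [Algebra ℂ A] (Γ Γ' : DiffCalculus A) : Prop :=
  ∃ F : DiffHom Γ Γ', Function.Bijective F.toAlgHom ∧ ∀ a, F.toAlgHom (Γ.ι a) = Γ'.ι a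

/-- Homomorphisms from a factor calculus. -/
def DiffHom.quotLift {A A' A'' : Type*} [Ring A] [Algebra ℂ A] [Ring A'] [Algebra ℂ A']
    [Ring A''] [Algebra ℂ A''] {Γ : DiffCalculus A} {Γ' : DiffCalculus A''} (F : DiffHom Γ Γ')
    (J : DiffIdeal Γ) (hF : ∀ x ∈ J.toIdeal, F.toAlgHom x = 0) (f : A →ₐ[ℂ] A')
    (hf : Function.Surjective f) (hJ : ∀ a, Γ.ι a ∈ J.toIdeal ↔ f a = 0) :
    DiffHom (Γ.quot J f hf hJ) Γ' where
  toAlgHom := Ideal.Quotient.liftₐ J.toIdeal F.toAlgHom hF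
  map_d := by
    intro x
    obtain ⟨x, rfl⟩ := Ideal.Quotient.mkₐ_surjective ℂ J.toIdeal x
    exact F.map_d x
  map_gr := by
    rintro n _ ⟨x, hx, rfl⟩
    exact F.map_gr n x hx

namespace LocTrivQPFB

variable {I B H : Type*} [Ring B] [Algebra ℂ B] [Ring H] [HopfAlgebra ℂ H]

section

variable (Q : LocTrivQPFB I B H) (Γ : ∀ i, DiffCalculus (Q.Bl i)) (ΓH : DiffCalculus H)

/-- The extension `Ω(P) → Γ(Bᵢ) ⊗̂ Γ(H)` of `χᵢ`. -/
def χΩΓ (i : I) : DiffHom (Omega Q.P) (skew (Γ i) ΓH) := Omega.ext (Q.χ i) (skew (Γ i) ΓH)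

/-- The differential ideal `J(P) = ⋂ᵢ ker(Ω(P) → Γ(Bᵢ) ⊗̂ Γ(H))`. -/
def idealP : DiffIdeal (Omega Q.P) := DiffIdeal.iInf fun i => (Q.χΩΓ Γ ΓH i).ker

lemma ι_mem_idealP (f : Q.P) : (Omega Q.P).ι f ∈ (Q.idealP Γ ΓH).toIdeal ↔ f = 0 := by
  constructor
  · intro h
    have h0 : f ∈ ⨅ i, RingHom.ker (Q.χ i) := by
      rw [Ideal.mem_iInf]
      intro i
      have h1 : (Q.χΩΓ Γ ΓH i).toAlgHom ((Omega Q.P).ι f) = 0 := DiffIdeal.mem_iInf.1 h i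
      rw [χΩΓ, Omega.ext_ι] at h1
      exact (skew (Γ i) ΓH).ι_injective (h1.trans (map_zero _).symm)
    rw [Q.covering_ker.iInf_eq_bot] at h0
    exact h0
  · rintro rfl
    rw [map_zero]; exact zero_mem _

/-- The differential structure `Γ(P) = Ω(P)/J(P)` on the bundle. -/
def calcP : DiffCalculus Q.P :=
  (Omega Q.P).quot (Q.idealP Γ ΓH) (AlgHom.id ℂ Q.P) Function.surjective_id (Q.ι_mem_idealP Γ ΓH)

/-- The extension `Γ(P) → Γ(Bᵢ) ⊗̂ Γ(H)` of `χᵢ`. -/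
def χΓ (i : I) : DiffHom (Q.calcP Γ ΓH) (skew (Γ i) ΓH) :=
  (Q.χΩΓ Γ ΓH i).quotLift (Q.idealP Γ ΓH) (fun _ hx => DiffIdeal.mem_iInf.1 hx i) _ _ _

lemma χΓ_surjective (i : I) : Function.Surjective (Q.χΓ Γ ΓH i).toAlgHom := by
  intro y
  obtain ⟨x, rfl⟩ := Omega.ext_surjective (Q.χ i) (Q.χ_surjective i) (skew (Γ i) ΓH) y
  exact ⟨Ideal.Quotient.mkₐ ℂ (Q.idealP Γ ΓH).toIdeal x, rfl⟩

lemma χΓ_ι (i : I) (f : Q.P) :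
    (Q.χΓ Γ ΓH i).toAlgHom ((Q.calcP Γ ΓH).ι f) = (skew (Γ i) ΓH).ι (Q.χ i f) := by
  have h : (Q.calcP Γ ΓH).ι f =
      Ideal.Quotient.mkₐ ℂ (Q.idealP Γ ΓH).toIdeal ((Omega Q.P).ι f) :=
    quotι_apply (Omega Q.P) (Q.idealP Γ ΓH) (AlgHom.id ℂ Q.P) Function.surjective_id
      (Q.ι_mem_idealP Γ ΓH) f
  rw [h]
  exact Omega.ext_ι (Q.χ i) (skew (Γ i) ΓH) f

/-- The differential ideal `χ_k(ker χ_l)` of `Γ(B_k) ⊗̂ Γ(H)`, with `χ_k, χ_l` extended to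
`Γ(P)`. -/
def idealOv (k l : I) : DiffIdeal (skew (Γ k) ΓH) :=
  ((Q.χΓ Γ ΓH l).ker).map (Q.χΓ Γ ΓH k) (Q.χΓ_surjective Γ ΓH k)

end

variable [Finite I] {Q : LocTrivQPFB I B H} (Γ : ∀ i, DiffCalculus (Q.Bl i))
  (ΓH : DiffCalculus H) {i j k l : I}

lemma ι_mem_idealOv (h : Q.J k ⊔ Q.J l = Q.J i ⊔ Q.J j) (x : Q.Bl k ⊗[ℂ] H) :
    (skew (Γ k) ΓH).ι x ∈ (Q.idealOv Γ ΓH k l).toIdeal ↔ resH h x = 0 := by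
  rw [← mem_χ_ker_iff h]
  constructor
  · rintro ⟨ω, hω, hx⟩
    have h0 := (Q.calcP Γ ΓH).proj_mem 0 ω
    rw [(Q.calcP Γ ΓH).gr_zero] at h0
    obtain ⟨f, hf⟩ := h0
    rw [AlgHom.toLinearMap_apply] at hf
    refine ⟨f, ?_, ?_⟩
    · have h1 : (Q.χΓ Γ ΓH l).toAlgHom ((Q.calcP Γ ΓH).proj 0 ω) = 0 :=
        (Q.χΓ Γ ΓH l).ker.proj_mem ω hω 0
      rw [← hf, χΓ_ι] at h1
      exact (skew (Γ l) ΓH).ι_injective (h1.trans (map_zero _).symm)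
    · have h1 := congrArg ((skew (Γ k) ΓH).proj 0) hx
      rw [← DiffHom.map_proj, ← hf, χΓ_ι,
        (skew (Γ k) ΓH).proj_of_mem ((skew (Γ k) ΓH).ι_mem x), if_pos rfl] at h1
      exact (skew (Γ k) ΓH).ι_injective h1
  · rintro ⟨f, hf, rfl⟩
    refine ⟨(Q.calcP Γ ΓH).ι f, ?_, Q.χΓ_ι Γ ΓH k f⟩
    change (Q.χΓ Γ ΓH l).toAlgHom ((Q.calcP Γ ΓH).ι f) = 0
    rw [χΓ_ι, hf, map_zero]

/-- The induced calculus `Γᵏ(B_ij ⊗ H) = (Γ(B_k) ⊗̂ Γ(H)) / χ_k(ker χ_l)` over `B_ij ⊗ H`, for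
`J_k + J_l = J_i + J_j`. -/
def calcOv (k l : I) (h : Q.J k ⊔ Q.J l = Q.J i ⊔ Q.J j) : DiffCalculus (Q.Bov i j ⊗[ℂ] H) :=
  (skew (Γ k) ΓH).quot (Q.idealOv Γ ΓH k l) (resH h) (resH_surjective h)
    (ι_mem_idealOv Γ ΓH h)

/-- The generators of the differential ideal `J_m(B_ij) ⊆ Ω(B_ij)`, for `J_k + J_l = J_i + J_j`:
the images of `J(B_k)` and `J(B_l)`, the elements `∑ τ_lk(r₁) dτ_kl(r₂)` for `r ∈ R`, and the
elements `(dτ_lk(x)) a - a dτ_lk(x)`. -/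
inductive JmGen (R : Submodule ℂ H) (k l : I) (h : Q.J k ⊔ Q.J l = Q.J i ⊔ Q.J j) :
    (Omega (Q.Bov i j)).Carrier → Prop
  | left (x : (Omega (Q.Bl k)).Carrier) (hx : x ∈ (Γ k).ideal.toIdeal) :
      JmGen R k l h ((Omega.ext (res h) (Omega (Q.Bov i j))).toAlgHom x)
  | right (x : (Omega (Q.Bl l)).Carrier) (hx : x ∈ (Γ l).ideal.toIdeal) :
      JmGen R k l h ((Omega.ext (res (swap h)) (Omega (Q.Bov i j))).toAlgHom x)
  | ofR (r : H) (hr : r ∈ R) :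
      JmGen R k l h (LinearMap.mul' ℂ (Omega (Q.Bov i j)).Carrier
        (TensorProduct.map ((Omega (Q.Bov i j)).ι.toLinearMap ∘ₗ (τ (swap h)).toLinearMap)
          ((Omega (Q.Bov i j)).d ∘ₗ (Omega (Q.Bov i j)).ι.toLinearMap ∘ₗ (τ h).toLinearMap)
          (comul r)))
  | comm (x : H) (a : Q.Bov i j) :
      JmGen R k l h
        ((Omega (Q.Bov i j)).d ((Omega (Q.Bov i j)).ι (τ (swap h) x)) * (Omega (Q.Bov i j)).ι a -
          (Omega (Q.Bov i j)).ι a * (Omega (Q.Bov i j)).d ((Omega (Q.Bov i j)).ι (τ (swap h) x)))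

/-- The differential ideal `J_m(B_ij) ⊆ Ω(B_ij)`. -/
def idealM (R : Submodule ℂ H) (k l : I) (h : Q.J k ⊔ Q.J l = Q.J i ⊔ Q.J j) :
    DiffIdeal (Omega (Q.Bov i j)) :=
  DiffIdeal.generate (Omega (Q.Bov i j)) {x | JmGen Γ R k l h x}

lemma ext_ideal_proj_zero {A A' : Type*} [Ring A] [Algebra ℂ A] [Ring A'] [Algebra ℂ A']
    (Γ : DiffCalculus A) (f : A →ₐ[ℂ] A') (x : (Omega A).Carrier) (hx : x ∈ Γ.ideal.toIdeal) :
    (Omega A').proj 0 ((Omega.ext f (Omega A')).toAlgHom x) = 0 := by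
  rw [← DiffHom.map_proj, Γ.proj_zero_of_mem_ideal hx, map_zero]

/-- The differential calculus `Γ_m(B_ij) = Ω(B_ij)/J_m(B_ij)`. -/
def calcM (R : Submodule ℂ H) (k l : I) (h : Q.J k ⊔ Q.J l = Q.J i ⊔ Q.J j) :
    DiffCalculus (Q.Bov i j) :=
  (Omega (Q.Bov i j)).quot (idealM Γ R k l h) (AlgHom.id ℂ _) Function.surjective_id fun a =>
    DiffIdeal.ι_mem_generate (by
      rintro _ (⟨x, hx⟩ | ⟨x, hx⟩ | ⟨r, hr⟩ | ⟨x, a⟩)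
      · exact ext_ideal_proj_zero (Γ k) (res h) x hx
      · exact ext_ideal_proj_zero (Γ l) (res (swap h)) x hx
      · exact (Omega (Q.Bov i j)).proj_zero_map _ _ _
      · rw [map_sub, proj_zero_mul,
          (Omega (Q.Bov i j)).proj_zero_mul_of_gr_one _ ((Omega (Q.Bov i j)).dι_mem _),
          (Omega (Q.Bov i j)).proj_of_mem ((Omega (Q.Bov i j)).dι_mem _), if_neg one_ne_zero,
          zero_mul, sub_zero])

/-- The condition `∑ τ_ij(S(r₁) r₃) ⊗ r₂ ∈ B_ij ⊗ R` for all `r ∈ R` and all `i, j`. -/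
def TransitionInvariant (Q : LocTrivQPFB I B H) (R : Submodule ℂ H) : Prop :=
  ∀ i j, ∀ r ∈ R, (τ (Q.ov i j)).toLinearMap.rTensor H (adMap r) ∈
    LinearMap.range (R.subtype.lTensor (Q.Bov i j))

end LocTrivQPFB

end Calculi

end

/-!
Call a homomorphism `f : A → E` differentiable with respect to calculi over `A` and `E` if its
extension to the universal calculi carries one differential ideal into the other; a calculus is
determined by the homomorphisms which are differentiable with respect to it. A homomorphism is
differentiable on `Γᵏ(B_kl ⊗ H)` iff it is so in both trivialisations, which differ by
`φ(1 ⊗ h) = ∑ τ(h₁) ⊗ h₂`. Expanding the differential of this formula by convolution identities,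
differentiability in the second trivialisation becomes the vanishing of the generators of `J_m`,
because `(*)` annihilates the conjugates by `τ` of the generators of `J(H)`. Hence `Γᵏ(B_kl ⊗ H)`
and `Γ_m(B_kl) ⊗̂ Γ(H)` admit the same differentiable homomorphisms.

For a left covariant calculus the coaction maps the class of `η(r) = ∑ S⁻¹(r₂) dr₁`, `r ∈ R`, to
zero in `H ⊗ Γ(H)`. A representation of `Ω(H)` on `H × H/R` recovers `R` from `η`, so the adjoint
coaction of `r` vanishes in `H ⊗ H/R`; applying `τ` gives `(*)`.
-/

noncomputable section

/-! ## Convolution with respect to the opposite comultiplication -/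

/-- The convolution product `(f ⋇ g)(x) = ∑ f(x₂) g(x₁)` with respect to the opposite
comultiplication, in which `ηΩ` is a product. -/
def copConv {K C G : Type*} [CommSemiring K] [AddCommMonoid C] [Module K C] [Coalgebra K C]
    [Semiring G] [Algebra K G] (f g : C →ₗ[K] G) : C →ₗ[K] G :=
  LinearMap.mul' K G ∘ₗ TensorProduct.map f g ∘ₗ (TensorProduct.comm K C C).toLinearMap ∘ₗ
    Coalgebra.comul

local infixl:70 " ⋇ " => copConv

section CopConv

open Coalgebra

variable {K C G G' : Type*} [CommSemiring K] [AddCommMonoid C] [Module K C] [Semiring G]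
  [Algebra K G] [Semiring G'] [Algebra K G']

/-- The map `f` with values in the opposite algebra, as an element of the convolution ring: it turns
`⋇` into the reversed product of that ring. -/
def opConv (f : C →ₗ[K] G) : WithConv (C →ₗ[K] Gᵐᵒᵖ) :=
  WithConv.toConv ((MulOpposite.opLinearEquiv K).toLinearMap ∘ₗ f)

lemma opConv_injective : Function.Injective (opConv : (C →ₗ[K] G) → _) := fun f g h => by
  ext x
  exact MulOpposite.op_injective (LinearMap.congr_fun (congrArg WithConv.ofConv h) x)

variable [Coalgebra K C]

variable (K C G) in
/-- The unit `x ↦ ε(x) 1` of the convolution product. -/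
def copOne : C →ₗ[K] G := Algebra.linearMap K G ∘ₗ counit

lemma copConv_apply (f g : C →ₗ[K] G) (x : C) :
    (f ⋇ g) x = LinearMap.mul' K G (TensorProduct.map f g (TensorProduct.comm K C C (comul x))) :=
  rfl

lemma copOne_apply (x : C) : copOne K C G x = counit (R := K) x • (1 : G) :=
  Algebra.algebraMap_eq_smul_one _

lemma copConv_apply_repr {ι : Type*} (f g : C →ₗ[K] G) {x : C} (𝓡 : Repr K x ι) :
    (f ⋇ g) x = ∑ i ∈ 𝓡.index, f (𝓡.right i) * g (𝓡.left i) := by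
  simp only [copConv_apply, ← 𝓡.eq, map_sum, TensorProduct.comm_tmul, TensorProduct.map_tmul,
    LinearMap.mul'_apply]

lemma opConv_copConv (f g : C →ₗ[K] G) : opConv (f ⋇ g) = opConv g * opConv f := by
  ext x
  rw [(ℛ K x).convMul_apply]
  change MulOpposite.op ((f ⋇ g) x) = _
  rw [copConv_apply_repr f g (ℛ K x), Finset.op_sum]
  rfl

lemma opConv_copOne : opConv (copOne K C G) = 1 := rfl

lemma copConv_assoc (f g k : C →ₗ[K] G) : f ⋇ g ⋇ k = f ⋇ (g ⋇ k) :=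
  opConv_injective <| by simp only [opConv_copConv, mul_assoc]

lemma copOne_copConv (f : C →ₗ[K] G) : copOne K C G ⋇ f = f :=
  opConv_injective <| by rw [opConv_copConv, opConv_copOne, mul_one]

lemma copConv_copOne (f : C →ₗ[K] G) : f ⋇ copOne K C G = f :=
  opConv_injective <| by rw [opConv_copConv, opConv_copOne, one_mul]

lemma copConv_add (f g k : C →ₗ[K] G) : f ⋇ (g + k) = f ⋇ g + f ⋇ k := by
  ext x; simp [copConv_apply, TensorProduct.map_add_right]

lemma map_copConv (F : G →ₐ[K] G') (f g : C →ₗ[K] G) :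
    F.toLinearMap ∘ₗ (f ⋇ g) = (F.toLinearMap ∘ₗ f) ⋇ (F.toLinearMap ∘ₗ g) := by
  ext x
  simp [copConv_apply_repr _ _ (ℛ K x)]

lemma map_copOne (F : G →ₐ[K] G') : F.toLinearMap ∘ₗ copOne K C G = copOne K C G' := by
  ext x; simp [copOne_apply]

lemma copConv_apply_of_commute {f g : C →ₗ[K] G} (h : ∀ x y, Commute (f x) (g y)) (x : C) :
    (f ⋇ g) x = LinearMap.mul' K G (TensorProduct.map g f (comul x)) := by
  rw [copConv_apply]
  induction (comul x : C ⊗[K] C) using TensorProduct.induction_on with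
  | zero => simp
  | add x y hx hy => simp only [map_add, hx, hy]
  | tmul x y => simp [(h y x).eq]

lemma copConv_mem (S : Subalgebra K G) {f g : C →ₗ[K] G} (hf : ∀ x, f x ∈ S) (hg : ∀ x, g x ∈ S)
    (x : C) : (f ⋇ g) x ∈ S := by
  rw [copConv_apply_repr f g (ℛ K x)]
  exact sum_mem fun i _ => mul_mem (hf _) (hg _)

lemma commute_copConv {c : G} {f g : C →ₗ[K] G} (hf : ∀ x, Commute c (f x))
    (hg : ∀ x, Commute c (g x)) (x : C) : Commute c ((f ⋇ g) x) :=
  (Subalgebra.mem_centralizer_iff K).1 (copConv_mem (Subalgebra.centralizer K {c})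
    (fun y => (Subalgebra.mem_centralizer_iff K).2 fun _ h => (Set.mem_singleton_iff.1 h) ▸ hf y)
    (fun y => (Subalgebra.mem_centralizer_iff K).2 fun _ h => (Set.mem_singleton_iff.1 h) ▸ hg y)
    x) c rfl

lemma eq_copConv_of_copConv_eq {f f' g k : C →ₗ[K] G} (hf : f' ⋇ f = copOne K C G)
    (h : f ⋇ g = k) : g = f' ⋇ k := by
  rw [← h, ← copConv_assoc, hf, copOne_copConv]

lemma left_inv_eq_right_inv_copConv {f f' g : C →ₗ[K] G} (hf : f' ⋇ f = copOne K C G)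
    (hg : f ⋇ g = copOne K C G) : f' = g :=
  ((eq_copConv_of_copConv_eq hf hg).trans (copConv_copOne f')).symm

end CopConv

section Antipode

open Coalgebra HopfAlgebra

variable {H G : Type*} [Ring H] [HopfAlgebra ℂ H] [Ring G] [Algebra ℂ G]
  (hS : Function.Bijective (antipode ℂ : H →ₗ[ℂ] H))

lemma antipode_antipodeInv (x : H) : antipode ℂ (antipodeInv hS x) = x :=
  LinearEquiv.apply_symm_apply (LinearEquiv.ofBijective _ hS) x

lemma antipodeInv_copConv_id : antipodeInv hS ⋇ LinearMap.id = copOne ℂ H H := by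
  ext x
  refine hS.1 ?_
  rw [copConv_apply_repr _ _ (ℛ ℂ x), map_sum]
  simp only [antipode_mul_antidistrib, antipode_antipodeInv, LinearMap.id_apply]
  simpa [copOne_apply, Algebra.algebraMap_eq_smul_one] using
    sum_antipode_mul_eq_algebraMap_counit (ℛ ℂ x)

lemma id_copConv_antipodeInv : LinearMap.id ⋇ antipodeInv hS = copOne ℂ H H := by
  ext x
  refine hS.1 ?_
  rw [copConv_apply_repr _ _ (ℛ ℂ x), map_sum]
  simp only [antipode_mul_antidistrib, antipode_antipodeInv, LinearMap.id_apply]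
  simpa [copOne_apply, Algebra.algebraMap_eq_smul_one] using
    sum_mul_antipode_eq_algebraMap_counit (ℛ ℂ x)

lemma antipodeInv_copConv (γ : H →ₐ[ℂ] G) :
    (γ.toLinearMap ∘ₗ antipodeInv hS) ⋇ γ.toLinearMap = copOne ℂ H G := by
  rw [← map_copOne γ, ← antipodeInv_copConv_id hS, map_copConv, LinearMap.comp_id]

lemma copConv_antipodeInv (γ : H →ₐ[ℂ] G) :
    γ.toLinearMap ⋇ (γ.toLinearMap ∘ₗ antipodeInv hS) = copOne ℂ H G := by
  rw [← map_copOne γ, ← id_copConv_antipodeInv hS, map_copConv, LinearMap.comp_id]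

end Antipode

/-! ## Differentiable homomorphisms -/

section Differentiable

variable {A A' A'' : Type*} [Ring A] [Algebra ℂ A] [Ring A'] [Algebra ℂ A'] [Ring A'']
  [Algebra ℂ A'']

namespace DiffIdeal

variable {Γ : DiffCalculus A} {S : Set Γ.Carrier} {J J' : DiffIdeal Γ}

lemma toIdeal_injective (h : J.toIdeal = J'.toIdeal) : J = J' := by
  cases J; cases J'; cases h; rfl

lemma generate_le_iff : (generate Γ S).toIdeal ≤ J.toIdeal ↔ S ⊆ J.toIdeal :=
  ⟨fun h _ hx => h (mem_iInf.2 fun J => J.2 hx), fun h _ hx => mem_iInf.1 hx ⟨J, h⟩⟩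

end DiffIdeal

namespace Omega

lemma algHom_ext {C : Type*} [Ring C] [Algebra ℂ C] {F F' : (Omega A).Carrier →ₐ[ℂ] C}
    (hι : ∀ a, F ((Omega A).ι a) = F' ((Omega A).ι a))
    (hd : ∀ a, F ((Omega A).d ((Omega A).ι a)) = F' ((Omega A).d ((Omega A).ι a))) : F = F' :=
  OmegaAlg.hom_ext hι fun a => by
    rw [← OmegaAlg.d_of]
    exact hd a

lemma ext_dι (f : A →ₐ[ℂ] A') (Γ : DiffCalculus A') (a : A) :
    (ext f Γ).toAlgHom ((Omega A).d ((Omega A).ι a)) = Γ.d (Γ.ι (f a)) := by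
  rw [DiffHom.map_d, ext_ι]

lemma ext_id_surjective (Γ : DiffCalculus A) :
    Function.Surjective (ext (AlgHom.id ℂ A) Γ).toAlgHom :=
  ext_surjective _ Function.surjective_id Γ

lemma exists_mem_gr_ext_eq (Γ : DiffCalculus A) {n : ℕ} {x : Γ.Carrier} (hx : x ∈ Γ.gr n) :
    ∃ y ∈ (Omega A).gr n, (ext (AlgHom.id ℂ A) Γ).toAlgHom y = x := by
  obtain ⟨y, rfl⟩ := ext_id_surjective Γ x
  refine ⟨(Omega A).proj n y, (Omega A).proj_mem n y, ?_⟩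
  rw [DiffHom.map_proj, Γ.proj_of_mem hx, if_pos rfl]

lemma ext_unique {f : A →ₐ[ℂ] A'} {Γ : DiffCalculus A'}
    {F : (Omega A).Carrier →ₐ[ℂ] Γ.Carrier} (hι : ∀ a, F ((Omega A).ι a) = Γ.ι (f a))
    (hd : ∀ a, F ((Omega A).d ((Omega A).ι a)) = Γ.d (Γ.ι (f a))) : F = (ext f Γ).toAlgHom :=
  algHom_ext (fun a => by rw [hι, ext_ι]) fun a => by rw [hd, ext_dι]

end Omega

lemma DiffHom.map_ext {Γ : DiffCalculus A'} {Γ' : DiffCalculus A''} (F : DiffHom Γ Γ')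
    {f : A →ₐ[ℂ] A'} {g : A →ₐ[ℂ] A''} (h : ∀ a, F.toAlgHom (Γ.ι (f a)) = Γ'.ι (g a))
    (x : (Omega A).Carrier) :
    F.toAlgHom ((Omega.ext f Γ).toAlgHom x) = (Omega.ext g Γ').toAlgHom x :=
  DFunLike.congr_fun (Omega.ext_unique (F := F.toAlgHom.comp (Omega.ext f Γ).toAlgHom)
    (fun a => by rw [AlgHom.comp_apply, Omega.ext_ι, h])
    fun a => by rw [AlgHom.comp_apply, Omega.ext_dι, F.map_d, h]) x

lemma Omega.ext_ext (f : A →ₐ[ℂ] A') (g : A' →ₐ[ℂ] A'') (Γ : DiffCalculus A'')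
    (x : (Omega A).Carrier) : (Omega.ext g Γ).toAlgHom ((Omega.ext f (Omega A')).toAlgHom x) =
      (Omega.ext (g.comp f) Γ).toAlgHom x :=
  (Omega.ext g Γ).map_ext (fun a => Omega.ext_ι g Γ (f a)) x

lemma Omega.ext_mem_ideal_iff {f : A →ₐ[ℂ] A'} {Γ : DiffCalculus A'} {x : (Omega A).Carrier} :
    (ext f (Omega A')).toAlgHom x ∈ Γ.ideal.toIdeal ↔ (ext f Γ).toAlgHom x = 0 := by
  change (ext (AlgHom.id ℂ A') Γ).toAlgHom _ = 0 ↔ _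
  rw [ext_ext, AlgHom.id_comp]

lemma Omega.ext_id_omega (x : (Omega A).Carrier) :
    (Omega.ext (AlgHom.id ℂ A) (Omega A)).toAlgHom x = x :=
  (DFunLike.congr_fun (Omega.ext_unique (F := AlgHom.id ℂ _) (f := AlgHom.id ℂ A)
    (fun _ => rfl) fun _ => rfl) x).symm

/-- An algebra homomorphism `f : A → A'` is differentiable with respect to calculi `Γ` over `A` and
`Γ'` over `A'` if the relations of `Γ` hold in `Γ'`, so that `f` extends to `Γ → Γ'`. -/
def IsDifferentiable (Γ : DiffCalculus A) (Γ' : DiffCalculus A') (f : A →ₐ[ℂ] A') : Prop :=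
  ∀ x ∈ Γ.ideal.toIdeal, (Omega.ext f Γ').toAlgHom x = 0

namespace IsDifferentiable

variable {Γ : DiffCalculus A} {Γ' : DiffCalculus A'} {Γ'' : DiffCalculus A''} {f : A →ₐ[ℂ] A'}
  {g : A' →ₐ[ℂ] A''}

/-- The extension `Γ → Γ'` of a differentiable homomorphism. -/
def lift (hf : IsDifferentiable Γ Γ' f) : DiffHom Γ Γ' where
  toAlgHom := surjLift _ (Omega.ext_id_surjective Γ) (Omega.ext f Γ').toAlgHom
    fun x hx => hf x hx
  map_d x := by
    obtain ⟨x, rfl⟩ := Omega.ext_id_surjective Γ x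
    rw [← DiffHom.map_d, surjLift_apply, surjLift_apply, DiffHom.map_d]
  map_gr n x hx := by
    obtain ⟨y, hy, rfl⟩ := Omega.exists_mem_gr_ext_eq Γ hx
    rw [surjLift_apply]
    exact (Omega.ext f Γ').map_gr n y hy

lemma lift_ext (hf : IsDifferentiable Γ Γ' f) (x : (Omega A).Carrier) :
    hf.lift.toAlgHom ((Omega.ext (AlgHom.id ℂ A) Γ).toAlgHom x) = (Omega.ext f Γ').toAlgHom x :=
  surjLift_apply _ _ _ _ x

lemma lift_ι (hf : IsDifferentiable Γ Γ' f) (a : A) :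
    hf.lift.toAlgHom (Γ.ι a) = Γ'.ι (f a) := by
  simpa only [Omega.ext_ι, AlgHom.id_apply] using hf.lift_ext ((Omega A).ι a)

lemma lift_dι (hf : IsDifferentiable Γ Γ' f) (a : A) :
    hf.lift.toAlgHom (Γ.d (Γ.ι a)) = Γ'.d (Γ'.ι (f a)) := by
  rw [DiffHom.map_d, lift_ι]

lemma lift_ext_comp (hg : IsDifferentiable Γ' Γ'' g) (f : A →ₐ[ℂ] A') (x : (Omega A).Carrier) :
    hg.lift.toAlgHom ((Omega.ext f Γ').toAlgHom x) = (Omega.ext (g.comp f) Γ'').toAlgHom x :=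
  hg.lift.map_ext (fun a => hg.lift_ι (f a)) x

lemma comp (hg : IsDifferentiable Γ' Γ'' g) (hf : IsDifferentiable Γ Γ' f) :
    IsDifferentiable Γ Γ'' (g.comp f) := fun x hx => by
  rw [← hg.lift_ext_comp, hf x hx, map_zero]

end IsDifferentiable

lemma isDifferentiable_id (Γ : DiffCalculus A) : IsDifferentiable Γ Γ (AlgHom.id ℂ A) :=
  fun _ hx => hx

lemma DiffHom.isDifferentiable {Γ : DiffCalculus A} {Γ' : DiffCalculus A'} (F : DiffHom Γ Γ')
    {f : A →ₐ[ℂ] A'} (h : ∀ a, F.toAlgHom (Γ.ι a) = Γ'.ι (f a)) : IsDifferentiable Γ Γ' f :=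
  fun x hx => by
    rw [← F.map_ext (f := AlgHom.id ℂ A) h, show (Omega.ext _ Γ).toAlgHom x = 0 from hx, map_zero]

lemma DiffCalculus.ideal_eq_of_isDifferentiable {Γ Γ' : DiffCalculus A}
    (h : IsDifferentiable Γ Γ' (AlgHom.id ℂ A)) (h' : IsDifferentiable Γ' Γ (AlgHom.id ℂ A)) :
    Γ.ideal = Γ'.ideal :=
  DiffIdeal.toIdeal_injective (le_antisymm h h')

lemma DiffCalculus.isomorphic_of_ideal_eq {Γ Γ' : DiffCalculus A} (h : Γ.ideal = Γ'.ideal) :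
    Γ.Isomorphic Γ' := by
  have hid : IsDifferentiable Γ Γ' (AlgHom.id ℂ A) := fun x hx => by rwa [h] at hx
  refine ⟨hid.lift, ⟨(injective_iff_map_eq_zero _).2 fun x hx => ?_, fun y => ?_⟩, hid.lift_ι⟩
  · obtain ⟨x, rfl⟩ := Omega.ext_id_surjective Γ x
    rw [hid.lift_ext] at hx
    have hx : x ∈ Γ'.ideal.toIdeal := hx
    rwa [← h] at hx
  · obtain ⟨y, rfl⟩ := Omega.ext_id_surjective Γ' y
    exact ⟨_, hid.lift_ext y⟩

section Quotient

variable {J : DiffIdeal (Omega A)} {hJ : ∀ a, (Omega A).ι a ∈ J.toIdeal ↔ AlgHom.id ℂ A a = 0}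

lemma ext_quot_omega (x : (Omega A).Carrier) :
    (Omega.ext (AlgHom.id ℂ A)
      ((Omega A).quot J (AlgHom.id ℂ A) Function.surjective_id hJ)).toAlgHom x =
      Ideal.Quotient.mkₐ ℂ J.toIdeal x := by
  rw [← ((Omega A).quotMk J (AlgHom.id ℂ A) Function.surjective_id hJ).map_ext (f := .id ℂ A)
    fun a => (quotι_apply _ J _ _ hJ a).symm, Omega.ext_id_omega]
  rfl

lemma mem_ideal_quot_omega {x : (Omega A).Carrier} :
    x ∈ ((Omega A).quot J (AlgHom.id ℂ A) Function.surjective_id hJ).ideal.toIdeal ↔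
      x ∈ J.toIdeal := by
  change (Omega.ext _ _).toAlgHom x = 0 ↔ _
  rw [ext_quot_omega]
  exact Ideal.Quotient.eq_zero_iff_mem

lemma isDifferentiable_quot_omega_iff {Γ : DiffCalculus A'} {f : A →ₐ[ℂ] A'} :
    IsDifferentiable ((Omega A).quot J (AlgHom.id ℂ A) Function.surjective_id hJ) Γ f ↔
      J.toIdeal ≤ (Omega.ext f Γ).ker.toIdeal :=
  forall_congr' fun _ => imp_congr_left mem_ideal_quot_omega

end Quotient

namespace DiffCalculus

variable (G : DiffCalculus A) {a b : A}

lemma d_ι_mul (a b : A) :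
    G.d (G.ι (a * b)) = G.d (G.ι a) * G.ι b + G.ι a * G.d (G.ι b) := by
  rw [map_mul, G.leibniz_zero]

lemma d_one : G.d 1 = 0 := by
  simpa only [map_one, one_mul, mul_one, left_eq_add] using G.leibniz_zero 1 1

variable {G}

lemma commute_ι_d (h : Commute a b) (hd : Commute (G.d (G.ι a)) (G.ι b)) :
    Commute (G.ι a) (G.d (G.ι b)) := by
  have hab := congrArg (fun x => G.d (G.ι x)) h.eq
  simp only [d_ι_mul, hd.eq] at hab
  rw [add_comm] at hab
  exact add_right_cancel hab

lemma d_mul_d_eq_neg (hd : Commute (G.d (G.ι a)) (G.ι b)) :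
    G.d (G.ι a) * G.d (G.ι b) = -(G.d (G.ι b) * G.d (G.ι a)) := by
  have h := congrArg G.d hd.eq
  rw [G.leibniz 1 _ (G.dι_mem _), G.leibniz_zero, G.d_d] at h
  simpa only [zero_mul, zero_add, pow_one, mul_zero, add_zero, neg_smul, one_smul,
    neg_eq_iff_eq_neg] using h

end DiffCalculus

end Differentiable

/-! ## The universal property of the skew tensor product -/

section SkewUniversal

open GradedTensorProduct

variable {A B E : Type*} [Ring A] [Algebra ℂ A] [Ring B] [Algebra ℂ B] [Ring E] [Algebra ℂ E]

lemma OmegaAlg.map_mul_eq_smul {C : Type*} [Ring C] [Algebra ℂ C] (F : OmegaAlg A →ₐ[ℂ] C) {c : C}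
    {s : ℂ} (h_of : ∀ a, Commute (F (of A a)) c)
    (h_del : ∀ a, F (del A a) * c = s • (c * F (del A a))) {n : ℕ} {x : OmegaAlg A}
    (hx : x ∈ gr A n) : F x * c = s ^ n • (c * F x) := by
  induction n generalizing x with
  | zero =>
    obtain ⟨a, rfl⟩ := hx
    rw [pow_zero, one_smul]
    exact h_of a
  | succ n ih =>
    refine Submodule.mul_induction_on (C := fun x => F x * c = s ^ (n + 1) • (c * F x)) hx ?_ ?_
    · rintro y hy _ ⟨b, rfl⟩
      rw [map_mul, mul_assoc, h_del, mul_smul_comm, ← mul_assoc, ih hy, smul_mul_assoc, smul_smul,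
        mul_assoc, pow_succ, mul_comm s]
    · intro y z hy hz
      rw [map_add, add_mul, mul_add, hy, hz, smul_add]

variable {Γ : DiffCalculus A} {Δ : DiffCalculus B} {G : DiffCalculus E}

namespace Omega

variable {f : A →ₐ[ℂ] E} {g : B →ₐ[ℂ] E} {m n : ℕ} {x : (Omega A).Carrier} {y : (Omega B).Carrier}

lemma commute_ext_ι {e : E} (h : ∀ a, Commute (f a) e)
    (hd : ∀ a, Commute (G.d (G.ι (f a))) (G.ι e)) (hx : x ∈ (Omega A).gr m) :
    Commute ((ext f G).toAlgHom x) (G.ι e) := by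
  have := OmegaAlg.map_mul_eq_smul (OmegaAlg.ext f G) (c := G.ι e) (s := 1)
    (fun a => by rw [OmegaAlg.ext_of]; exact (h a).map G.ι)
    (fun a => by rw [OmegaAlg.ext_del, one_smul]; exact hd a) hx
  rwa [one_pow, one_smul] at this

lemma ext_mul_dι {e : E} (h : ∀ a, Commute (f a) e)
    (hd : ∀ a, Commute (G.d (G.ι (f a))) (G.ι e)) (hx : x ∈ (Omega A).gr m) :
    (ext f G).toAlgHom x * G.d (G.ι e) = (-1 : ℂ) ^ m • (G.d (G.ι e) * (ext f G).toAlgHom x) :=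
  OmegaAlg.map_mul_eq_smul (OmegaAlg.ext f G)
    (fun a => by rw [OmegaAlg.ext_of]; exact DiffCalculus.commute_ι_d (h a) (hd a))
    (fun a => by rw [OmegaAlg.ext_del, neg_one_smul]; exact DiffCalculus.d_mul_d_eq_neg (hd a)) hx

lemma ext_mul_ext (h : ∀ a b, Commute (f a) (g b))
    (hd : ∀ a b, Commute (G.d (G.ι (f a))) (G.ι (g b))) (hx : x ∈ (Omega A).gr m)
    (hy : y ∈ (Omega B).gr n) :
    (ext f G).toAlgHom x * (ext g G).toAlgHom y =
      (-1 : ℤˣ) ^ (n * m) • ((ext g G).toAlgHom y * (ext f G).toAlgHom x) := by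
  have hs (k : ℕ) : (-1 : ℂ) ^ k * (-1) ^ k = 1 := by rw [← mul_pow]; norm_num
  have hyx := OmegaAlg.map_mul_eq_smul (OmegaAlg.ext g G) (c := (ext f G).toAlgHom x)
    (s := (-1) ^ m)
    (fun b => by
      rw [OmegaAlg.ext_of]
      exact (commute_ext_ι (fun a => h a b) (fun a => hd a b) hx).symm)
    (fun b => by
      rw [OmegaAlg.ext_del, ext_mul_dι (fun a => h a b) (fun a => hd a b) hx, smul_smul, hs,
        one_smul]) hy
  change (ext g G).toAlgHom y * (ext f G).toAlgHom x =
    _ • ((ext f G).toAlgHom x * (ext g G).toAlgHom y) at hyx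
  rw [hyx, ← pow_mul, mul_comm m n]
  rcases Nat.even_or_odd (n * m) with h | h <;>
    simp only [h.neg_one_pow, one_smul, Units.smul_def, Units.val_neg, Units.val_one, neg_smul,
      neg_neg]

end Omega

section Lift

variable {f : A ⊗[ℂ] B →ₐ[ℂ] E}
  (hA : IsDifferentiable Γ G (f.comp Algebra.TensorProduct.includeLeft))
  (hB : IsDifferentiable Δ G (f.comp Algebra.TensorProduct.includeRight))
  (hd : ∀ a b, Commute (G.d (G.ι (f (a ⊗ₜ 1)))) (G.ι (f (1 ⊗ₜ b))))

/-- The homomorphism `γ ⊗ ρ ↦ γ ρ` from `Γ ⊗̂ Δ` into a calculus in which the differentials of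
`A` commute with `B`. -/
def skewLift : SkewAlg Γ Δ →ₐ[ℂ] G.Carrier :=
  GradedTensorProduct.lift Γ.gr Δ.gr hA.lift.toAlgHom hB.lift.toAlgHom <| by
    rintro m n ⟨a, ha⟩ ⟨b, hb⟩
    obtain ⟨a, ha', rfl⟩ := Omega.exists_mem_gr_ext_eq Γ ha
    obtain ⟨b, hb', rfl⟩ := Omega.exists_mem_gr_ext_eq Δ hb
    simp only [IsDifferentiable.lift_ext]
    refine Omega.ext_mul_ext (fun a b => Commute.map ?_ f) hd ha' hb'
    exact (Commute.one_right a).tmul (Commute.one_left b)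

lemma skewLift_tmul (x : Γ.Carrier) (y : Δ.Carrier) :
    skewLift hA hB hd (x ᵍ⊗ₜ[ℂ] y) = hA.lift.toAlgHom x * hB.lift.toAlgHom y :=
  GradedTensorProduct.lift_tmul _ _ _ _ _ x y

lemma skewLift_ι (z : A ⊗[ℂ] B) : skewLift hA hB hd (skewι Γ Δ z) = G.ι (f z) := by
  induction z using TensorProduct.induction_on with
  | zero => simp only [map_zero]
  | add x y hx hy => simp only [map_add, hx, hy]
  | tmul a b =>
    rw [skewι_tmul, skewLift_tmul, hA.lift_ι, hB.lift_ι, ← map_mul, AlgHom.comp_apply,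
      AlgHom.comp_apply, ← map_mul, Algebra.TensorProduct.includeLeft_apply,
      Algebra.TensorProduct.includeRight_apply, Algebra.TensorProduct.tmul_mul_tmul, mul_one,
      one_mul]

lemma skewLift_d_ι (z : A ⊗[ℂ] B) :
    skewLift hA hB hd (skewD Γ Δ (skewι Γ Δ z)) = G.d (G.ι (f z)) := by
  induction z using TensorProduct.induction_on with
  | zero => simp only [map_zero]
  | add x y hx hy => simp only [map_add, hx, hy]
  | tmul a b =>
    rw [← skewLift_ι hA hB hd, skewι_tmul, skewD_tmul Γ Δ (Γ.ι_mem a), map_add, map_smul,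
      skewLift_tmul, skewLift_tmul, skewLift_tmul, DiffHom.map_d, DiffHom.map_d, pow_zero,
      one_smul, hA.lift_ι, hB.lift_ι, ← G.leibniz_zero]

lemma IsDifferentiable.of_skewLift
    (hA : IsDifferentiable Γ G (f.comp Algebra.TensorProduct.includeLeft))
    (hB : IsDifferentiable Δ G (f.comp Algebra.TensorProduct.includeRight))
    (hd : ∀ a b, Commute (G.d (G.ι (f (a ⊗ₜ 1)))) (G.ι (f (1 ⊗ₜ b)))) :
    IsDifferentiable (skew Γ Δ) G f := fun x hx => by
  let F : (skew Γ Δ).Carrier →ₐ[ℂ] G.Carrier := skewLift hA hB hd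
  have hF : F.comp (Omega.ext (.id ℂ _) (skew Γ Δ)).toAlgHom = (Omega.ext f G).toAlgHom :=
    Omega.ext_unique
      (fun z => by rw [AlgHom.comp_apply, Omega.ext_ι]; exact skewLift_ι hA hB hd z)
      (fun z => by rw [AlgHom.comp_apply, Omega.ext_dι]; exact skewLift_d_ι hA hB hd z)
  have hx : (Omega.ext (.id ℂ _) (skew Γ Δ)).toAlgHom x = 0 := hx
  rw [← hF, AlgHom.comp_apply, hx, map_zero]

end Lift

variable (Γ Δ)

/-- The inclusion `Γ → Γ ⊗̂ Δ`. -/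
def skewInl : DiffHom Γ (skew Γ Δ) where
  toAlgHom := includeLeft Γ.gr Δ.gr
  map_d x := by
    refine Γ.gr_induction (p := fun x => (Γ.d x ᵍ⊗ₜ[ℂ] 1 : SkewAlg Γ Δ) =
      skewD Γ Δ (x ᵍ⊗ₜ[ℂ] 1)) ?_ (fun n x hx => ?_) (fun x y hx hy => ?_) x
    · rw [map_zero, zero_gtmul Γ Δ, map_zero]
    · rw [skewD_tmul Γ Δ hx, Δ.d_one, gtmul_zero, smul_zero, add_zero]
    · have h_add (u v : Γ.Carrier) : ((u + v) ᵍ⊗ₜ[ℂ] (1 : Δ.Carrier) : SkewAlg Γ Δ) =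
          u ᵍ⊗ₜ[ℂ] 1 + v ᵍ⊗ₜ[ℂ] 1 := map_add (includeLeft Γ.gr Δ.gr) u v
      rw [map_add, h_add, h_add, map_add, hx, hy]
  map_gr n x hx := tmul_mem_skewGr (Γ := Γ) (Δ := Δ) (add_zero n) hx (SetLike.one_mem_graded Δ.gr)

/-- The inclusion `Δ → Γ ⊗̂ Δ`. -/
def skewInr : DiffHom Δ (skew Γ Δ) where
  toAlgHom := includeRight Γ.gr Δ.gr
  map_d x := by
    change (1 ᵍ⊗ₜ[ℂ] Δ.d x : SkewAlg Γ Δ) = skewD Γ Δ (1 ᵍ⊗ₜ[ℂ] x)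
    rw [skewD_tmul Γ Δ (SetLike.one_mem_graded Γ.gr), Γ.d_one, zero_gtmul Γ Δ, zero_add, pow_zero,
      one_smul]
  map_gr n x hx := tmul_mem_skewGr (Γ := Γ) (Δ := Δ) (zero_add n) (SetLike.one_mem_graded Γ.gr) hx

lemma skewInl_ι (a : A) : (skewInl Γ Δ).toAlgHom (Γ.ι a) = (skew Γ Δ).ι (a ⊗ₜ 1) := by
  refine Eq.trans ?_ (skewι_tmul Γ Δ a 1).symm
  rw [map_one]
  rfl

lemma skewInr_ι (b : B) : (skewInr Γ Δ).toAlgHom (Δ.ι b) = (skew Γ Δ).ι (1 ⊗ₜ b) := by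
  refine Eq.trans ?_ (skewι_tmul Γ Δ 1 b).symm
  rw [map_one]
  rfl

lemma skew_commute_d_ι (a : A) (b : B) :
    Commute ((skew Γ Δ).d ((skew Γ Δ).ι (a ⊗ₜ 1))) ((skew Γ Δ).ι (1 ⊗ₜ b)) := by
  rw [← skewInl_ι, ← skewInr_ι, ← DiffHom.map_d]
  change (Γ.d (Γ.ι a) ᵍ⊗ₜ[ℂ] (1 : Δ.Carrier) : SkewAlg Γ Δ) *
    ((1 : Γ.Carrier) ᵍ⊗ₜ[ℂ] Δ.ι b : SkewAlg Γ Δ) = ((1 : Γ.Carrier) ᵍ⊗ₜ[ℂ] Δ.ι b : SkewAlg Γ Δ) *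
    (Γ.d (Γ.ι a) ᵍ⊗ₜ[ℂ] (1 : Δ.Carrier) : SkewAlg Γ Δ)
  rw [tmul_one_mul_one_tmul, skew_mul Γ Δ _ (Δ.ι_mem b) (Γ.dι_mem a), zero_mul, pow_zero, one_smul,
    one_mul, mul_one]

variable {Γ Δ}

theorem isDifferentiable_skew_iff {f : A ⊗[ℂ] B →ₐ[ℂ] E} :
    IsDifferentiable (skew Γ Δ) G f ↔
      IsDifferentiable Γ G (f.comp Algebra.TensorProduct.includeLeft) ∧
      IsDifferentiable Δ G (f.comp Algebra.TensorProduct.includeRight) ∧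
      ∀ a b, Commute (G.d (G.ι (f (a ⊗ₜ 1)))) (G.ι (f (1 ⊗ₜ b))) := by
  refine ⟨fun hf => ⟨hf.comp ((skewInl Γ Δ).isDifferentiable (skewInl_ι Γ Δ)),
    hf.comp ((skewInr Γ Δ).isDifferentiable (skewInr_ι Γ Δ)), fun a b => ?_⟩,
    fun ⟨hA, hB, hd⟩ => .of_skewLift hA hB hd⟩
  rw [← hf.lift_dι, ← hf.lift_ι]
  exact (skew_commute_d_ι Γ Δ a b).map hf.lift.toAlgHom

end SkewUniversal

/-! ## Transition functions -/

section FreeComodule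

open Coalgebra

variable {A A' H : Type*} [Ring A] [Algebra ℂ A] [Ring A'] [Algebra ℂ A'] [Ring H]
  [HopfAlgebra ℂ H]

lemma commute_tmul_one_one_tmul (a : A) (x : H) :
    Commute (a ⊗ₜ[ℂ] (1 : H)) ((1 : A) ⊗ₜ[ℂ] x) :=
  (Commute.one_right a).tmul (Commute.one_left x)

variable (A H) in
/-- The homomorphism `id ⊗ ε`. -/
def counitRight : A ⊗[ℂ] H →ₐ[ℂ] A :=
  (Algebra.TensorProduct.rid ℂ ℂ A).toAlgHom.comp
    (Algebra.TensorProduct.map (AlgHom.id ℂ _) (Bialgebra.counitAlgHom ℂ H))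

variable (A H) in
/-- The coaction `id ⊗ Δ` of `H` on `A ⊗ H`. -/
def freeCoact : A ⊗[ℂ] H →ₗ[ℂ] (A ⊗[ℂ] H) ⊗[ℂ] H :=
  (TensorProduct.assoc ℂ A H H).symm.toLinearMap ∘ₗ (comul : H →ₗ[ℂ] H ⊗[ℂ] H).lTensor A

lemma counitRight_tmul (a : A) (x : H) :
    counitRight A H (a ⊗ₜ x) = (counit x : ℂ) • a :=
  rfl

lemma counitRight_map (T : A →ₐ[ℂ] A') (z : A ⊗[ℂ] H) :
    counitRight A' H (Algebra.TensorProduct.map T (AlgHom.id ℂ H) z) = T (counitRight A H z) := by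
  induction z using TensorProduct.induction_on with
  | zero => simp only [map_zero]
  | add x y hx hy => simp only [map_add, hx, hy]
  | tmul a x => simp [counitRight_tmul]

lemma freeCoact_tmul (a : A) (x : H) :
    freeCoact A H (a ⊗ₜ x) = (TensorProduct.mk ℂ A H a).rTensor H (comul x) := by
  change (TensorProduct.assoc ℂ A H H).symm (a ⊗ₜ comul x) = _
  induction (comul x : H ⊗[ℂ] H) using TensorProduct.induction_on with
  | zero => simp
  | add x y hx hy => simp only [TensorProduct.tmul_add, map_add, hx, hy]
  | tmul x y => rfl

lemma rTensor_counitRight_freeCoact (z : A ⊗[ℂ] H) :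
    (counitRight A H).toLinearMap.rTensor H (freeCoact A H z) = z := by
  induction z using TensorProduct.induction_on with
  | zero => simp only [map_zero]
  | add x y hx hy => simp only [map_add, hx, hy]
  | tmul a x =>
    rw [freeCoact_tmul, ← LinearMap.rTensor_comp_apply,
      show (counitRight A H).toLinearMap ∘ₗ TensorProduct.mk ℂ A H a =
        LinearMap.toSpanSingleton ℂ A a ∘ₗ counit from rfl, LinearMap.rTensor_comp,
      LinearMap.comp_apply, rTensor_counit_comul, LinearMap.rTensor_tmul,
      LinearMap.toSpanSingleton_apply, one_smul]

end FreeComodule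

section TransitionProperties

open Coalgebra

namespace LocTrivQPFB

variable {I B H : Type*} [Ring B] [Algebra ℂ B] [Ring H] [HopfAlgebra ℂ H]
  {Q : LocTrivQPFB I B H} {i j k l m n : I}

lemma freeCoact_χ (k : I) (f : Q.P) :
    freeCoact (Q.Bl k) H (Q.χ k f) = (Q.χ k).toLinearMap.rTensor H (Q.coact f) :=
  (LinearEquiv.symm_apply_eq _).2 (Q.χ_coact k f)

lemma freeCoact_resH (h : Q.J k ⊔ Q.J l = Q.J i ⊔ Q.J j) (z : Q.Bl k ⊗[ℂ] H) :
    freeCoact (Q.Bov i j) H (resH h z) = (resH h).toLinearMap.rTensor H (freeCoact _ H z) := by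
  induction z using TensorProduct.induction_on with
  | zero => simp only [map_zero]
  | add x y hx hy => simp only [map_add, hx, hy]
  | tmul a x =>
    change freeCoact _ H (res h a ⊗ₜ x) = _
    rw [freeCoact_tmul, freeCoact_tmul, ← LinearMap.rTensor_comp_apply]
    rfl

lemma freeCoact_χOv (h : Q.J k ⊔ Q.J l = Q.J i ⊔ Q.J j) (f : Q.P) :
    freeCoact (Q.Bov i j) H (χOv h f) = (χOv h).toLinearMap.rTensor H (Q.coact f) := by
  change freeCoact _ H (resH h (Q.χ k f)) = _
  rw [freeCoact_resH, freeCoact_χ, ← LinearMap.rTensor_comp_apply]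
  rfl

lemma χOv_ι (h : Q.J k ⊔ Q.J l = Q.J i ⊔ Q.J j) (b : B) :
    χOv h (Q.ι b) = Ideal.Quotient.mk _ b ⊗ₜ 1 := by
  change resH h (Q.χ k (Q.ι b)) = _
  rw [Q.χ_ι]
  rfl

lemma map_factor_χOv (e : Q.J m ⊔ Q.J n = Q.J k ⊔ Q.J l) (h : Q.J k ⊔ Q.J l = Q.J i ⊔ Q.J j)
    (f : Q.P) : Algebra.TensorProduct.map (Ideal.Quotient.factorₐ ℂ h.le) (AlgHom.id ℂ H)
      (χOv e f) = χOv (e.trans h) f := by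
  change Algebra.TensorProduct.map _ _ (resH e (Q.χ m f)) = resH (e.trans h) (Q.χ m f)
  rw [resH, ← AlgHom.comp_apply, ← Algebra.TensorProduct.map_comp, AlgHom.id_comp]
  refine congrArg (Algebra.TensorProduct.map · (AlgHom.id ℂ H) (Q.χ m f)) ?_
  exact Ideal.Quotient.algHom_ext _ rfl

variable [Finite I]

lemma φ_tmul_one (h : Q.J k ⊔ Q.J l = Q.J i ⊔ Q.J j) (b : Q.Bov i j) : φ h (b ⊗ₜ 1) = b ⊗ₜ 1 := by
  obtain ⟨b, rfl⟩ := Ideal.Quotient.mk_surjective b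
  exact (congrArg (φ h) (χOv_ι (swap h) b)).symm.trans ((φ_χOv h _).trans (χOv_ι h b))

lemma φ_φ (h : Q.J k ⊔ Q.J l = Q.J i ⊔ Q.J j) (z : Q.Bov i j ⊗[ℂ] H) : φ (swap h) (φ h z) = z := by
  obtain ⟨f, rfl⟩ := χOv_surjective (swap h) z
  rw [φ_χOv]
  exact φ_χOv (swap h) f

lemma freeCoact_φ (h : Q.J k ⊔ Q.J l = Q.J i ⊔ Q.J j) (z : Q.Bov i j ⊗[ℂ] H) :
    freeCoact _ H (φ h z) = (φ h).toLinearMap.rTensor H (freeCoact _ H z) := by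
  obtain ⟨f, rfl⟩ := χOv_surjective (swap h) z
  rw [φ_χOv, freeCoact_χOv, freeCoact_χOv, ← LinearMap.rTensor_comp_apply]
  exact congrArg (fun F : Q.P →ₗ[ℂ] _ => F.rTensor H (Q.coact f))
    (LinearMap.ext fun f => (φ_χOv h f).symm)

lemma φ_one_tmul (h : Q.J k ⊔ Q.J l = Q.J i ⊔ Q.J j) (x : H) :
    φ h (1 ⊗ₜ x) = (τ (swap h)).toLinearMap.rTensor H (comul x) := by
  rw [← rTensor_counitRight_freeCoact (φ h (1 ⊗ₜ x)), freeCoact_φ, freeCoact_tmul,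
    ← LinearMap.rTensor_comp_apply, ← LinearMap.rTensor_comp_apply]
  rfl

lemma counitRight_φ_tmul (h : Q.J k ⊔ Q.J l = Q.J i ⊔ Q.J j) (b : Q.Bov i j) (x : H) :
    counitRight _ H (φ (swap h) (b ⊗ₜ x)) = b * τ h x := by
  have hbx : b ⊗ₜ[ℂ] x = (b ⊗ₜ 1) * (1 ⊗ₜ x) := by
    rw [Algebra.TensorProduct.tmul_mul_tmul, mul_one, one_mul]
  rw [hbx, map_mul, map_mul, φ_tmul_one, counitRight_tmul, Bialgebra.counit_one, one_smul]
  rfl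

lemma commute_τ (h : Q.J k ⊔ Q.J l = Q.J i ⊔ Q.J j) (x : H) (b : Q.Bov i j) :
    Commute (τ h x) b := by
  have hb : counitRight _ H (φ (swap h) (b ⊗ₜ 1)) = b := by
    rw [counitRight_φ_tmul h, map_one, mul_one]
  have hτ : counitRight _ H (φ (swap h) (1 ⊗ₜ x)) = τ h x := rfl
  simpa only [hb, hτ] using ((commute_tmul_one_one_tmul b x).symm.map (φ (swap h))).map
    (counitRight (Q.Bov i j) H)

lemma τ_copConv_τ (h : Q.J k ⊔ Q.J l = Q.J i ⊔ Q.J j) :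
    (τ h).toLinearMap ⋇ (τ (swap h)).toLinearMap = copOne ℂ H _ := by
  have h_mul (w : Q.Bov i j ⊗[ℂ] H) : counitRight _ H (φ (swap h) w) =
      LinearMap.mul' ℂ _ ((τ h).toLinearMap.lTensor _ w) := by
    induction w using TensorProduct.induction_on with
    | zero => simp only [map_zero]
    | add x y hx hy => simp only [map_add, hx, hy]
    | tmul b x => exact counitRight_φ_tmul h b x
  ext x
  rw [copConv_apply_of_commute fun y _ => commute_τ h y _, ← LinearMap.lTensor_comp_rTensor,
    LinearMap.comp_apply, ← φ_one_tmul h, ← h_mul, φ_φ h, counitRight_tmul, copOne_apply]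

/-- Both sides are convolution inverses of `τ h`. -/
lemma τ_antipode (h : Q.J k ⊔ Q.J l = Q.J i ⊔ Q.J j) (x : H) :
    τ h (HopfAlgebra.antipode ℂ x) = τ (swap h) x := by
  have h_inv : ((τ h).toLinearMap ∘ₗ HopfAlgebra.antipode ℂ) ⋇ (τ h).toLinearMap =
      copOne ℂ H _ := by
    ext x
    rw [copConv_apply_repr _ _ (ℛ ℂ x), copOne_apply, ← Algebra.algebraMap_eq_smul_one,
      ← (τ h).commutes, ← HopfAlgebra.sum_mul_antipode_eq_algebraMap_counit (ℛ ℂ x), map_sum]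
    exact Finset.sum_congr rfl fun i _ => by
      rw [map_mul]
      exact (commute_τ h _ _).eq
  exact LinearMap.congr_fun (left_inv_eq_right_inv_copConv h_inv (τ_copConv_τ h)) x

lemma φ_map_factor (h : Q.J k ⊔ Q.J l = Q.J i ⊔ Q.J j) (z : Q.Bov k l ⊗[ℂ] H) :
    φ (swap h) (Algebra.TensorProduct.map (Ideal.Quotient.factorₐ ℂ h.le) (AlgHom.id ℂ H) z) =
      Algebra.TensorProduct.map (Ideal.Quotient.factorₐ ℂ h.le) (AlgHom.id ℂ H)
        (φ (swap (Q.ov k l)) z) := by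
  obtain ⟨f, rfl⟩ := χOv_surjective (Q.ov k l) z
  rw [map_factor_χOv _ h, φ_χOv (swap (Q.ov k l)) f, map_factor_χOv _ h]
  exact φ_χOv (swap h) f

lemma τ_eq_factor (h : Q.J k ⊔ Q.J l = Q.J i ⊔ Q.J j) (x : H) :
    τ h x = Ideal.Quotient.factorₐ ℂ h.le (τ (Q.ov k l) x) := by
  have hφ := φ_map_factor h (1 ⊗ₜ x)
  rw [Algebra.TensorProduct.map_tmul, map_one] at hφ
  exact (congrArg _ hφ).trans (counitRight_map _ _)

lemma TransitionInvariant.rTensor_mem {R : Submodule ℂ H} (hQ : Q.TransitionInvariant R)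
    (h : Q.J k ⊔ Q.J l = Q.J i ⊔ Q.J j) {r : H} (hr : r ∈ R) :
    (τ h).toLinearMap.rTensor H (adMap r) ∈ LinearMap.range (R.subtype.lTensor (Q.Bov i j)) := by
  let T : Q.Bov k l →ₐ[ℂ] Q.Bov i j := Ideal.Quotient.factorₐ ℂ h.le
  have hT : (τ h).toLinearMap = T.toLinearMap ∘ₗ (τ (Q.ov k l)).toLinearMap :=
    LinearMap.ext (τ_eq_factor h)
  obtain ⟨z, hz⟩ := hQ k l r hr
  refine ⟨T.toLinearMap.rTensor R z, ?_⟩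
  rw [hT, LinearMap.rTensor_comp_apply, ← hz, ← LinearMap.comp_apply,
    ← LinearMap.comp_apply, LinearMap.lTensor_comp_rTensor, LinearMap.rTensor_comp_lTensor]

end LocTrivQPFB

end TransitionProperties

/-! ## Transformation of the generating forms -/

section ConvolutionForms

open Coalgebra

variable {A H : Type*} [Ring A] [Algebra ℂ A]

lemma DiffCalculus.d_copConv [AddCommGroup H] [Module ℂ H] [Coalgebra ℂ H] (G : DiffCalculus A)
    (f g : H →ₗ[ℂ] A) :
    G.d ∘ₗ ((G.ι.toLinearMap ∘ₗ f) ⋇ (G.ι.toLinearMap ∘ₗ g)) =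
      (G.d ∘ₗ G.ι.toLinearMap ∘ₗ f) ⋇ (G.ι.toLinearMap ∘ₗ g) +
        (G.ι.toLinearMap ∘ₗ f) ⋇ (G.d ∘ₗ G.ι.toLinearMap ∘ₗ g) := by
  ext x
  simp [copConv_apply_repr _ _ (ℛ ℂ x), G.leibniz_zero, Finset.sum_add_distrib]

variable [Ring H] [HopfAlgebra ℂ H]
  (hS : Function.Bijective (HopfAlgebra.antipode ℂ : H →ₗ[ℂ] H))

lemma ext_comp_ηΩ (G : DiffCalculus A) (γ : H →ₐ[ℂ] A) :
    (Omega.ext γ G).toAlgHom.toLinearMap ∘ₗ ηΩ hS =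
      ((G.ι.comp γ).toLinearMap ∘ₗ antipodeInv hS) ⋇ (G.d ∘ₗ (G.ι.comp γ).toLinearMap) := by
  refine (map_copConv (Omega.ext γ G).toAlgHom _ _).trans (congrArg₂ copConv ?_ ?_)
  · exact LinearMap.ext fun x => Omega.ext_ι γ G _
  · exact LinearMap.ext fun x => Omega.ext_dι γ G x

lemma copConv_ext_ηΩ (G : DiffCalculus A) (γ : H →ₐ[ℂ] A) :
    (G.ι.comp γ).toLinearMap ⋇ ((Omega.ext γ G).toAlgHom.toLinearMap ∘ₗ ηΩ hS) =
      G.d ∘ₗ (G.ι.comp γ).toLinearMap := by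
  rw [ext_comp_ηΩ, ← copConv_assoc, copConv_antipodeInv, copOne_copConv]

lemma commute_ext_ηΩ {G : DiffCalculus A} {γ : H →ₐ[ℂ] A} {c : G.Carrier}
    (hι : ∀ y, Commute c (G.ι (γ y))) (hd : ∀ y, Commute c (G.d (G.ι (γ y)))) (x : H) :
    Commute c ((Omega.ext γ G).toAlgHom (ηΩ hS x)) := by
  rw [← AlgHom.toLinearMap_apply, ← LinearMap.comp_apply, ext_comp_ηΩ]
  exact commute_copConv (fun y => hι _) hd x

/-- In Sweedler notation, `(f ⋇ g ⋇ k)(x) = ∑ f(x₃) g(x₂) k(x₁)`. -/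
lemma map_copConv_copConv_apply {C D : Type*} [Ring C] [Algebra ℂ C] [AddCommGroup D] [Module ℂ D]
    {f g k : H →ₗ[ℂ] C} {L : C →ₗ[ℂ] D} {M : H ⊗[ℂ] H →ₗ[ℂ] D}
    (h : ∀ u v w, L (f u * g v * k w) = M ((HopfAlgebra.antipode ℂ w * u) ⊗ₜ v)) (x : H) :
    L ((f ⋇ g ⋇ k) x) = M (adMap x) := by
  rw [copConv_assoc, ← copConv_assoc, copConv_apply]
  simp only [adMap, LinearMap.comp_apply, LinearEquiv.coe_coe]
  induction (comul x : H ⊗[ℂ] H) using TensorProduct.induction_on with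
  | zero => simp
  | add x y hx hy => simp only [map_add, hx, hy]
  | tmul w y =>
    rw [TensorProduct.comm_tmul, TensorProduct.map_tmul, LinearMap.mul'_apply, copConv_apply,
      LinearMap.lTensor_tmul]
    induction (comul y : H ⊗[ℂ] H) using TensorProduct.induction_on with
    | zero => simp
    | add u v hu hv => simp only [map_add, add_mul, TensorProduct.tmul_add, hu, hv]
    | tmul v u => simp [h]

end ConvolutionForms

namespace LocTrivQPFB

open Coalgebra

variable {I B H : Type*} [Finite I] [Ring B] [Algebra ℂ B] [Ring H] [HopfAlgebra ℂ H]
  {Q : LocTrivQPFB I B H} {i j k l : I}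

lemma copConv_τ_conj_eq_zero {R : Submodule ℂ H} (hQ : Q.TransitionInvariant R)
    (h : Q.J k ⊔ Q.J l = Q.J i ⊔ Q.J j) {C : Type*} [Ring C] [Algebra ℂ C]
    {g : Q.Bov i j →ₐ[ℂ] C} {F : H →ₗ[ℂ] C} (hF : ∀ x y, Commute (F x) (g (τ (swap h) y)))
    (hFR : ∀ r ∈ R, F r = 0) {r : H} (hr : r ∈ R) :
    ((g.comp (τ h)).toLinearMap ⋇ F ⋇ (g.comp (τ (swap h))).toLinearMap) r = 0 := by
  have h_ad := map_copConv_copConv_apply (f := (g.comp (τ h)).toLinearMap) (g := F)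
    (k := (g.comp (τ (swap h))).toLinearMap) (L := LinearMap.id)
    (M := LinearMap.mul' ℂ C ∘ₗ TensorProduct.map g.toLinearMap F ∘ₗ
      (τ h).toLinearMap.rTensor H) (fun u v w => ?_) r
  · obtain ⟨z, hz⟩ := hQ.rTensor_mem h hr
    refine h_ad.trans ?_
    rw [LinearMap.comp_apply, LinearMap.comp_apply, ← hz]
    have hF0 : F ∘ₗ R.subtype = 0 := LinearMap.ext fun r => hFR r r.2
    rw [LinearMap.map_lTensor, hF0, TensorProduct.map_zero_right, LinearMap.zero_apply, map_zero]
  · simp only [LinearMap.id_apply, LinearMap.comp_apply, LinearMap.rTensor_tmul,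
      TensorProduct.map_tmul, LinearMap.mul'_apply, AlgHom.toLinearMap_apply, AlgHom.comp_apply,
      map_mul, τ_antipode]
    rw [mul_assoc, (hF v w).eq, ← mul_assoc, ← map_mul, (commute_τ h u _).eq, map_mul]

/-- The one-form `∑ τ_lk(x₁) dτ_kl(x₂)` over `B_ij`. -/
def transitionForm (h : Q.J k ⊔ Q.J l = Q.J i ⊔ Q.J j) : H →ₗ[ℂ] (Omega (Q.Bov i j)).Carrier :=
  LinearMap.mul' ℂ _ ∘ₗ TensorProduct.map
    ((Omega (Q.Bov i j)).ι.toLinearMap ∘ₗ (τ (swap h)).toLinearMap)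
    ((Omega (Q.Bov i j)).d ∘ₗ (Omega (Q.Bov i j)).ι.toLinearMap ∘ₗ (τ h).toLinearMap) ∘ₗ comul

section Calculus

variable {E : Type*} [Ring E] [Algebra ℂ E] {G : DiffCalculus E}
  {h : Q.J k ⊔ Q.J l = Q.J i ⊔ Q.J j} {g : Q.Bov i j →ₐ[ℂ] E}

lemma commute_d_τ_of_swap
    (hτ : ∀ x b, Commute (G.d (G.ι (g (τ (swap h) x)))) (G.ι (g b))) (x : H) (b : Q.Bov i j) :
    Commute (G.d (G.ι (g (τ h x)))) (G.ι (g b)) := by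
  rw [← τ_antipode (swap h) x]
  exact hτ _ b

lemma ext_transitionForm_eq_copConv
    (hτ : ∀ x b, Commute (G.d (G.ι (g (τ h x)))) (G.ι (g b))) (x : H) :
    (Omega.ext g G).toAlgHom (transitionForm h x) =
      ((G.d ∘ₗ (G.ι.comp (g.comp (τ h))).toLinearMap) ⋇
        (G.ι.comp (g.comp (τ (swap h)))).toLinearMap) x := by
  rw [copConv_apply_of_commute fun x y => hτ x (τ (swap h) y), transitionForm,
    LinearMap.comp_apply, LinearMap.comp_apply]
  induction (comul x : H ⊗[ℂ] H) using TensorProduct.induction_on with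
  | zero => simp only [map_zero]
  | add x y hx hy => simp only [map_add, hx, hy]
  | tmul x y => simp [Omega.ext_ι, Omega.ext_dι]

variable (G h g) in
lemma map_τ_copConv_τ :
    (G.ι.comp (g.comp (τ h))).toLinearMap ⋇ (G.ι.comp (g.comp (τ (swap h)))).toLinearMap =
      copOne ℂ H _ := by
  rw [← map_copOne (G.ι.comp g), ← τ_copConv_τ h, map_copConv]
  rfl

lemma ext_transitionForm_eq_neg_copConv
    (hτ : ∀ x b, Commute (G.d (G.ι (g (τ h x)))) (G.ι (g b))) (x : H) :
    (Omega.ext g G).toAlgHom (transitionForm h x) =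
      -((G.ι.comp (g.comp (τ h))).toLinearMap ⋇
        (G.d ∘ₗ (G.ι.comp (g.comp (τ (swap h)))).toLinearMap)) x := by
  have hd := G.d_copConv (g.comp (τ h)).toLinearMap (g.comp (τ (swap h))).toLinearMap
  have h0 : G.d ∘ₗ copOne ℂ H _ = 0 := by
    ext y
    rw [LinearMap.comp_apply, copOne_apply, map_smul, G.d_one, smul_zero, LinearMap.zero_apply]
  rw [ext_transitionForm_eq_copConv hτ, eq_neg_iff_add_eq_zero]
  exact LinearMap.congr_fun (hd.symm.trans ((congrArg _ (map_τ_copConv_τ G h g)).trans h0)) x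

lemma ext_transitionForm_swap_eq_zero {R : Submodule ℂ H} (hQ : Q.TransitionInvariant R)
    (hτ : ∀ x b, Commute (G.d (G.ι (g (τ (swap h) x)))) (G.ι (g b)))
    (hR : ∀ r ∈ R, (Omega.ext g G).toAlgHom (transitionForm h r) = 0) {r : H} (hr : r ∈ R) :
    (Omega.ext g G).toAlgHom (transitionForm (swap h) r) = 0 := by
  have hτ' := commute_d_τ_of_swap (h := h) hτ
  let T : H →ₗ[ℂ] G.Carrier := (G.ι.comp (g.comp (τ h))).toLinearMap
  let T' : H →ₗ[ℂ] G.Carrier := (G.ι.comp (g.comp (τ (swap h)))).toLinearMap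
  have hT : (G.d ∘ₗ T) ⋇ T' ⋇ T = G.d ∘ₗ T := by
    rw [copConv_assoc, map_τ_copConv_τ G (swap h) g, copConv_copOne]
  have h_conj : (T' ⋇ ((G.d ∘ₗ T) ⋇ T') ⋇ T) r = 0 :=
    copConv_τ_conj_eq_zero hQ (swap h) (g := G.ι.comp g)
      (fun x y => (commute_copConv (fun z => (hτ' z _).symm)
        (fun z => ((commute_τ h y _).map g).map G.ι) x).symm)
      (fun r hr => (ext_transitionForm_eq_copConv hτ' r).symm.trans (hR r hr)) hr
  rw [copConv_assoc, hT] at h_conj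
  rw [ext_transitionForm_eq_neg_copConv hτ]
  exact neg_eq_zero.2 h_conj

end Calculus

section TensorCalculus

variable {G : DiffCalculus (Q.Bov i j ⊗[ℂ] H)} (h : Q.J k ⊔ Q.J l = Q.J i ⊔ Q.J j)

/-- The restriction of `φ_kl` to `H`. -/
def φH : H →ₐ[ℂ] Q.Bov i j ⊗[ℂ] H := (φ h).comp Algebra.TensorProduct.includeRight

variable (G) in
lemma ι_comp_φH : (G.ι.comp (φH h)).toLinearMap =
    (G.ι.comp Algebra.TensorProduct.includeRight).toLinearMap ⋇
      (G.ι.comp (Algebra.TensorProduct.includeLeft.comp (τ (swap h)))).toLinearMap := by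
  ext x
  rw [copConv_apply_of_commute fun x y =>
    (commute_tmul_one_one_tmul (τ (swap h) y) x).symm.map G.ι]
  change G.ι (φ h (1 ⊗ₜ x)) = _
  rw [φ_one_tmul]
  induction (comul x : H ⊗[ℂ] H) using TensorProduct.induction_on with
  | zero => simp
  | add x y hx hy => simp only [map_add, hx, hy]
  | tmul x y => simp [← map_mul]

variable (G) in
lemma d_comp_φH : G.d ∘ₗ (G.ι.comp (φH h)).toLinearMap =
    (G.d ∘ₗ (G.ι.comp Algebra.TensorProduct.includeRight).toLinearMap) ⋇
      (G.ι.comp (Algebra.TensorProduct.includeLeft.comp (τ (swap h)))).toLinearMap +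
    (G.ι.comp Algebra.TensorProduct.includeRight).toLinearMap ⋇
      (G.d ∘ₗ (G.ι.comp (Algebra.TensorProduct.includeLeft.comp (τ (swap h)))).toLinearMap) := by
  rw [ι_comp_φH]
  exact G.d_copConv Algebra.TensorProduct.includeRight.toLinearMap
    (Algebra.TensorProduct.includeLeft.comp (τ (swap h))).toLinearMap

variable {h} (hc : ∀ (b : Q.Bov i j) (x : H), Commute (G.d (G.ι (b ⊗ₜ 1))) (G.ι (1 ⊗ₜ x)))
  (hS : Function.Bijective (HopfAlgebra.antipode ℂ : H →ₗ[ℂ] H))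

include hc hS

lemma forall_commute_d_φH_iff (b : Q.Bov i j) :
    (∀ x, Commute (G.ι (b ⊗ₜ 1)) (G.d (G.ι (φH h x)))) ↔
      ∀ x, Commute (G.ι (b ⊗ₜ 1)) (G.d (G.ι (τ (swap h) x ⊗ₜ 1))) := by
  let γ := G.ι.comp (Algebra.TensorProduct.includeRight : H →ₐ[ℂ] Q.Bov i j ⊗[ℂ] H)
  have hγ (x : H) : Commute (G.ι (b ⊗ₜ 1)) (γ x) := (commute_tmul_one_one_tmul b x).map G.ι
  have hdT := commute_copConv (f := G.d ∘ₗ γ.toLinearMap)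
    (g := (G.ι.comp (Algebra.TensorProduct.includeLeft.comp (τ (swap h)))).toLinearMap)
    (fun x => DiffCalculus.commute_ι_d (commute_tmul_one_one_tmul b x) (hc b x))
    (fun x => (((commute_τ (swap h) x b).symm.tmul (Commute.one_right 1)).map G.ι))
  have hd := d_comp_φH G h
  constructor
  · intro hφ
    have hγd := eq_copConv_of_copConv_eq (antipodeInv_copConv hS γ)
      (sub_eq_of_eq_add' hd).symm
    intro x
    refine (LinearMap.congr_fun hγd x).symm ▸ commute_copConv (fun y => hγ _) (fun y => ?_) x
    exact (hφ y).sub_right (hdT y)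
  · intro hτ x
    refine (LinearMap.congr_fun hd x).symm ▸ (hdT x).add_right (commute_copConv hγ hτ x)

lemma ext_φH_ηΩ {R : Submodule ℂ H} (hQ : Q.TransitionInvariant R)
    (hτ : ∀ x b, Commute (G.d (G.ι (τ (swap h) x ⊗ₜ 1))) (G.ι (b ⊗ₜ 1)))
    (hR : ∀ r ∈ R, (Omega.ext Algebra.TensorProduct.includeRight G).toAlgHom (ηΩ hS r) = 0)
    {r : H} (hr : r ∈ R) :
    (Omega.ext (φH h) G).toAlgHom (ηΩ hS r) =
      -(Omega.ext Algebra.TensorProduct.includeLeft G).toAlgHom (transitionForm h r) := by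
  let gB : Q.Bov i j →ₐ[ℂ] Q.Bov i j ⊗[ℂ] H := Algebra.TensorProduct.includeLeft
  let γ := G.ι.comp (Algebra.TensorProduct.includeRight : H →ₐ[ℂ] Q.Bov i j ⊗[ℂ] H)
  let T : H →ₗ[ℂ] G.Carrier := (G.ι.comp (gB.comp (τ h))).toLinearMap
  let T' : H →ₗ[ℂ] G.Carrier := (G.ι.comp (gB.comp (τ (swap h)))).toLinearMap
  let η := (Omega.ext Algebra.TensorProduct.includeRight G).toAlgHom.toLinearMap ∘ₗ ηΩ hS
  let ηφ := (Omega.ext (φH h) G).toAlgHom.toLinearMap ∘ₗ ηΩ hS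
  have h_dφ : γ.toLinearMap ⋇ (T' ⋇ ηφ) = γ.toLinearMap ⋇ (η ⋇ T' + G.d ∘ₗ T') := by
    rw [← copConv_assoc, copConv_add, ← copConv_assoc, ← ι_comp_φH G h, copConv_ext_ηΩ,
      copConv_ext_ηΩ, d_comp_φH]
  have h_ηφ : ηφ = T ⋇ η ⋇ T' + T ⋇ (G.d ∘ₗ T') := by
    have h_cancel := eq_copConv_of_copConv_eq (antipodeInv_copConv hS γ) h_dφ
    rw [← copConv_assoc, antipodeInv_copConv, copOne_copConv] at h_cancel
    rw [copConv_assoc, ← copConv_add]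
    exact eq_copConv_of_copConv_eq (map_τ_copConv_τ G h gB) h_cancel
  have h_conj : (T ⋇ η ⋇ T') r = 0 := by
    refine copConv_τ_conj_eq_zero hQ h (g := G.ι.comp gB) (fun x y => ?_) hR hr
    exact (commute_ext_ηΩ hS (fun z => (commute_tmul_one_one_tmul _ z).map G.ι)
      (fun z => DiffCalculus.commute_ι_d (commute_tmul_one_one_tmul _ z) (hc _ z)) x).symm
  rw [ext_transitionForm_eq_neg_copConv (commute_d_τ_of_swap hτ), neg_neg]
  refine (LinearMap.congr_fun h_ηφ r).trans ?_
  rw [LinearMap.add_apply, h_conj, zero_add]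

end TensorCalculus

end LocTrivQPFB

/-! ## The calculi on the overlaps -/

lemma isDifferentiable_calcH_iff {H E : Type*} [Ring H] [HopfAlgebra ℂ H] [Ring E]
    [Algebra ℂ E] {hS : Function.Bijective (HopfAlgebra.antipode ℂ : H →ₗ[ℂ] H)}
    {R : Submodule ℂ H} {G : DiffCalculus E} {f : H →ₐ[ℂ] E} :
    IsDifferentiable (calcH hS R) G f ↔ ∀ r ∈ R, (Omega.ext f G).toAlgHom (ηΩ hS r) = 0 :=
  isDifferentiable_quot_omega_iff.trans (DiffIdeal.generate_le_iff.trans Set.image_subset_iff)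

namespace LocTrivQPFB

variable {I B H E : Type*} [Ring B] [Algebra ℂ B] [Ring H] [HopfAlgebra ℂ H] [Ring E] [Algebra ℂ E]

section Overlap

variable {Q : LocTrivQPFB I B H} {Γ : ∀ i, DiffCalculus (Q.Bl i)} {ΓH : DiffCalculus H}
  {G : DiffCalculus E} {i j k l : I}

lemma χΩΓ_mem_idealOv {y : (Omega Q.P).Carrier} :
    (Q.χΩΓ Γ ΓH k).toAlgHom y ∈ (Q.idealOv Γ ΓH k l).toIdeal ↔
      ∃ z, (Q.χΩΓ Γ ΓH l).toAlgHom z = 0 ∧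
        (Q.χΩΓ Γ ΓH k).toAlgHom z = (Q.χΩΓ Γ ΓH k).toAlgHom y := by
  constructor
  · rintro ⟨ω, hω, hy⟩
    obtain ⟨z, rfl⟩ := Ideal.Quotient.mkₐ_surjective ℂ (Q.idealP Γ ΓH).toIdeal ω
    exact ⟨z, hω, hy⟩
  · rintro ⟨z, hz, hy⟩
    exact ⟨Ideal.Quotient.mkₐ ℂ (Q.idealP Γ ΓH).toIdeal z, hz, hy⟩

lemma isDifferentiable_skew_resH_iff {h : Q.J k ⊔ Q.J l = Q.J i ⊔ Q.J j}
    {G : DiffCalculus (Q.Bov i j ⊗[ℂ] H)} :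
    IsDifferentiable (skew (Γ k) ΓH) G (resH h) ↔
      IsDifferentiable (Γ k) G (Algebra.TensorProduct.includeLeft.comp (res h)) ∧
      IsDifferentiable ΓH G Algebra.TensorProduct.includeRight ∧
      ∀ b x, Commute (G.d (G.ι (b ⊗ₜ 1))) (G.ι (1 ⊗ₜ x)) := by
  have h_left : (resH h).comp Algebra.TensorProduct.includeLeft =
      (Algebra.TensorProduct.includeLeft : _ →ₐ[ℂ] Q.Bov i j ⊗[ℂ] H).comp (res h) :=
    Algebra.TensorProduct.map_comp_includeLeft _ _
  have h_right : (resH h).comp Algebra.TensorProduct.includeRight =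
      (Algebra.TensorProduct.includeRight : H →ₐ[ℂ] Q.Bov i j ⊗[ℂ] H) :=
    Algebra.TensorProduct.map_comp_includeRight _ _
  rw [isDifferentiable_skew_iff, h_left, h_right, (res_surjective h).forall]
  simp only [resH, Algebra.TensorProduct.map_tmul, map_one, AlgHom.id_apply]

variable [Finite I] (h : Q.J k ⊔ Q.J l = Q.J i ⊔ Q.J j)

variable (Γ ΓH) in
/-- The canonical projection `Γ(B_k) ⊗̂ Γ(H) → Γᵏ(B_ij ⊗ H)`. -/
def calcOvMk : DiffHom (skew (Γ k) ΓH) (calcOv Γ ΓH k l h) :=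
  (skew (Γ k) ΓH).quotMk (Q.idealOv Γ ΓH k l) (resH h) (resH_surjective h) (ι_mem_idealOv Γ ΓH h)

lemma calcOvMk_ι (z : Q.Bl k ⊗[ℂ] H) :
    (calcOvMk Γ ΓH h).toAlgHom ((skew (Γ k) ΓH).ι z) = (calcOv Γ ΓH k l h).ι (resH h z) :=
  (quotι_apply _ _ _ _ (ι_mem_idealOv Γ ΓH h) z).symm

lemma ext_χOv_calcOv_eq_zero_iff {y : (Omega Q.P).Carrier} :
    (Omega.ext (χOv h) (calcOv Γ ΓH k l h)).toAlgHom y = 0 ↔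
      ∃ z, (Q.χΩΓ Γ ΓH l).toAlgHom z = 0 ∧
        (Q.χΩΓ Γ ΓH k).toAlgHom z = (Q.χΩΓ Γ ΓH k).toAlgHom y := by
  rw [← (calcOvMk Γ ΓH h).map_ext (f := Q.χ k) fun f => calcOvMk_ι h (Q.χ k f),
    ← χΩΓ_mem_idealOv]
  exact Ideal.Quotient.eq_zero_iff_mem

lemma isDifferentiable_φ_comp_resH :
    IsDifferentiable (skew (Γ l) ΓH) (calcOv Γ ΓH k l h) ((φ h).comp (resH (swap h))) := by
  intro x hx
  obtain ⟨y, rfl⟩ := Omega.ext_surjective (Q.χ l) (Q.χ_surjective l) (Omega _) x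
  have hφ : ((φ h).comp (resH (swap h))).comp (Q.χ l) = χOv h := AlgHom.ext fun f => φ_χOv h f
  rw [Omega.ext_ext, hφ]
  exact (ext_χOv_calcOv_eq_zero_iff h).2 ⟨y, Omega.ext_mem_ideal_iff.1 hx, rfl⟩

variable {h}

theorem isDifferentiable_calcOv_iff {f : Q.Bov i j ⊗[ℂ] H →ₐ[ℂ] E} :
    IsDifferentiable (calcOv Γ ΓH k l h) G f ↔
      IsDifferentiable (skew (Γ k) ΓH) G (f.comp (resH h)) ∧
      IsDifferentiable (skew (Γ l) ΓH) G (f.comp ((φ h).comp (resH (swap h)))) := by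
  refine ⟨fun hf => ⟨hf.comp ((calcOvMk Γ ΓH h).isDifferentiable (calcOvMk_ι h)),
    hf.comp (isDifferentiable_φ_comp_resH h)⟩, fun ⟨hk, hl⟩ x hx => ?_⟩
  have hf : f.comp (χOv h) = (f.comp ((φ h).comp (resH (swap h)))).comp (Q.χ l) :=
    AlgHom.ext fun a => congrArg f (φ_χOv h a).symm
  obtain ⟨y, rfl⟩ := Omega.ext_surjective (χOv h) (χOv_surjective h) (Omega _) x
  obtain ⟨z, hz, hzy⟩ := (ext_χOv_calcOv_eq_zero_iff h).1 (Omega.ext_mem_ideal_iff.1 hx)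
  calc (Omega.ext f G).toAlgHom ((Omega.ext (χOv h) (Omega _)).toAlgHom y)
      = (Omega.ext (f.comp (χOv h)) G).toAlgHom y := Omega.ext_ext _ _ _ _
    _ = hk.lift.toAlgHom ((Q.χΩΓ Γ ΓH k).toAlgHom y) := (hk.lift_ext_comp (Q.χ k) y).symm
    _ = hk.lift.toAlgHom ((Q.χΩΓ Γ ΓH k).toAlgHom z) := by rw [hzy]
    _ = (Omega.ext (f.comp (χOv h)) G).toAlgHom z := hk.lift_ext_comp (Q.χ k) z
    _ = hl.lift.toAlgHom ((Q.χΩΓ Γ ΓH l).toAlgHom z) := by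
      rw [hf]
      exact (hl.lift_ext_comp (Q.χ l) z).symm
    _ = 0 := by rw [hz, map_zero]

theorem isDifferentiable_calcM_iff {R : Submodule ℂ H} {g : Q.Bov i j →ₐ[ℂ] E} :
    IsDifferentiable (calcM Γ R k l h) G g ↔
      IsDifferentiable (Γ k) G (g.comp (res h)) ∧
      IsDifferentiable (Γ l) G (g.comp (res (swap h))) ∧
      (∀ r ∈ R, (Omega.ext g G).toAlgHom (transitionForm h r) = 0) ∧
      ∀ x b, Commute (G.d (G.ι (g (τ (swap h) x)))) (G.ι (g b)) := by
  have h_comm (x : H) (b : Q.Bov i j) : (Omega.ext g G).toAlgHom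
      ((Omega _).d ((Omega _).ι (τ (swap h) x)) * (Omega _).ι b -
        (Omega _).ι b * (Omega _).d ((Omega _).ι (τ (swap h) x))) = 0 ↔
      Commute (G.d (G.ι (g (τ (swap h) x)))) (G.ι (g b)) := by
    rw [map_sub, map_mul, map_mul, Omega.ext_dι, Omega.ext_ι, sub_eq_zero]
    rfl
  refine isDifferentiable_quot_omega_iff.trans
    (DiffIdeal.generate_le_iff.trans ⟨fun hJ => ?_, ?_⟩)
  · refine ⟨fun x hx => ?_, fun x hx => ?_, fun r hr => hJ (JmGen.ofR r hr),
      fun x b => (h_comm x b).1 (hJ (JmGen.comm x b))⟩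
    · rw [← Omega.ext_ext]
      exact hJ (JmGen.left x hx)
    · rw [← Omega.ext_ext]
      exact hJ (JmGen.right x hx)
  · rintro ⟨hk, hl, hR, hτ⟩ _ (⟨x, hx⟩ | ⟨x, hx⟩ | ⟨r, hr⟩ | ⟨x, b⟩)
    · exact (Omega.ext_ext _ _ _ _).trans (hk x hx)
    · exact (Omega.ext_ext _ _ _ _).trans (hl x hx)
    · exact hR r hr
    · exact (h_comm x b).2 (hτ x b)

end Overlap

section Main

variable [Finite I] {Q : LocTrivQPFB I B H} {Γ : ∀ i, DiffCalculus (Q.Bl i)} {i j k l : I}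
  {R : Submodule ℂ H}
  {h : Q.J k ⊔ Q.J l = Q.J i ⊔ Q.J j}

lemma isDifferentiable_skew_φ_comp_resH_iff {ΓH : DiffCalculus H}
    {G : DiffCalculus (Q.Bov i j ⊗[ℂ] H)} :
    IsDifferentiable (skew (Γ l) ΓH) G ((φ h).comp (resH (swap h))) ↔
      IsDifferentiable (Γ l) G (Algebra.TensorProduct.includeLeft.comp (res (swap h))) ∧
      IsDifferentiable ΓH G (φH h) ∧
      ∀ b x, Commute (G.ι (b ⊗ₜ 1)) (G.d (G.ι (φH h x))) := by
  have h_left : ((φ h).comp (resH (swap h))).comp Algebra.TensorProduct.includeLeft =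
      (Algebra.TensorProduct.includeLeft : _ →ₐ[ℂ] Q.Bov i j ⊗[ℂ] H).comp (res (swap h)) :=
    AlgHom.ext fun a => by simp [resH, φ_tmul_one]
  have h_right : ((φ h).comp (resH (swap h))).comp Algebra.TensorProduct.includeRight = φH h :=
    AlgHom.ext fun x => by simp [resH, φH]
  have hφ (b : Q.Bov i j) (x : H) : Commute (b ⊗ₜ[ℂ] 1) (φH h x) := by
    rw [← φ_tmul_one h b]
    exact (commute_tmul_one_one_tmul b x).map (φ h)
  have hι (a : Q.Bl l) :
      ((φ h).comp (resH (swap h))) (a ⊗ₜ 1) = res (swap h) a ⊗ₜ 1 := AlgHom.congr_fun h_left a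
  have hι' (x : H) : ((φ h).comp (resH (swap h))) (1 ⊗ₜ x) = φH h x := AlgHom.congr_fun h_right x
  rw [isDifferentiable_skew_iff, h_left, h_right, (res_surjective (swap h)).forall]
  simp only [hι, hι']
  exact and_congr_right' (and_congr_right' (forall₂_congr fun a x =>
    ⟨DiffCalculus.commute_ι_d (hφ _ x),
      fun hd => (DiffCalculus.commute_ι_d (hφ _ x).symm hd.symm).symm⟩))

variable {hS : Function.Bijective (HopfAlgebra.antipode ℂ : H →ₗ[ℂ] H)}

theorem isDifferentiable_calcOv_iff_skew (hQ : Q.TransitionInvariant R)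
    {G : DiffCalculus (Q.Bov i j ⊗[ℂ] H)} :
    IsDifferentiable (calcOv Γ (calcH hS R) k l h) G (AlgHom.id ℂ _) ↔
      IsDifferentiable (skew (calcM Γ R k l h) (calcH hS R)) G (AlgHom.id ℂ _) := by
  refine isDifferentiable_calcOv_iff.trans (Iff.trans ?_ isDifferentiable_skew_iff.symm)
  rw [AlgHom.id_comp, AlgHom.id_comp, AlgHom.id_comp, AlgHom.id_comp,
    isDifferentiable_skew_resH_iff, isDifferentiable_skew_φ_comp_resH_iff,
    isDifferentiable_calcM_iff, isDifferentiable_calcH_iff, isDifferentiable_calcH_iff]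
  constructor
  · rintro ⟨⟨hk, hη, hc⟩, hl, hφη, hφ⟩
    have hτ (x : H) (b : Q.Bov i j) :
        Commute (G.d (G.ι (τ (swap h) x ⊗ₜ 1))) (G.ι (b ⊗ₜ 1)) :=
      ((forall_commute_d_φH_iff hc hS b).1 (hφ b) x).symm
    refine ⟨⟨hk, hl, fun r hr => ?_, hτ⟩, hη, hc⟩
    rw [← neg_eq_zero, ← ext_φH_ηΩ hc hS hQ hτ hη hr, hφη r hr]
  · rintro ⟨⟨hk, hl, hR, hτ⟩, hη, hc⟩
    refine ⟨⟨hk, hη, hc⟩, hl, fun r hr => ?_, fun b x => ?_⟩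
    · rw [ext_φH_ηΩ hc hS hQ hτ hη hr, hR r hr, neg_zero]
    · exact (forall_commute_d_φH_iff hc hS b).2 (fun y => (hτ y b).symm) x

variable (hS) in
theorem ideal_calcOv_eq (hQ : Q.TransitionInvariant R) :
    (calcOv Γ (calcH hS R) k l h).ideal = (skew (calcM Γ R k l h) (calcH hS R)).ideal :=
  DiffCalculus.ideal_eq_of_isDifferentiable
    ((isDifferentiable_calcOv_iff_skew hQ).2 (isDifferentiable_id _))
    ((isDifferentiable_calcOv_iff_skew hQ).1 (isDifferentiable_id _))

lemma isDifferentiable_calcM_swap (hQ : Q.TransitionInvariant R) :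
    IsDifferentiable (calcM Γ R l k (swap h)) (calcM Γ R k l h) (AlgHom.id ℂ _) := by
  obtain ⟨hk, hl, hR, hτ⟩ := isDifferentiable_calcM_iff.1 (isDifferentiable_id (calcM Γ R k l h))
  exact isDifferentiable_calcM_iff.2
    ⟨hl, hk, fun r hr => ext_transitionForm_swap_eq_zero hQ hτ hR hr, commute_d_τ_of_swap hτ⟩

theorem idealM_swap (hQ : Q.TransitionInvariant R) :
    idealM Γ R k l h = idealM Γ R l k (swap h) :=
  DiffIdeal.toIdeal_injective <| le_antisymm
    (fun _ hx => mem_ideal_quot_omega.1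
      (isDifferentiable_calcM_swap (h := swap h) hQ _ (mem_ideal_quot_omega.2 hx)))
    (fun _ hx => mem_ideal_quot_omega.1
      (isDifferentiable_calcM_swap (h := h) hQ _ (mem_ideal_quot_omega.2 hx)))

end Main

end LocTrivQPFB

/-! ## Left covariance and the adjoint coaction -/

section DegreeOne

variable {A : Type*} [Ring A] [Algebra ℂ A] {Γ : DiffCalculus A}

lemma DiffCalculus.proj_one_mul (x y : Γ.Carrier) :
    Γ.proj 1 (x * y) = Γ.proj 0 x * Γ.proj 1 y + Γ.proj 1 x * Γ.proj 0 y := by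
  induction x using Γ.gr_induction with
  | h0 => simp
  | h2 u v hu hv => simp only [add_mul, map_add, hu, hv]; abel
  | h1 m x hx =>
    induction y using Γ.gr_induction with
    | h0 => simp
    | h2 u v hu hv => simp only [mul_add, map_add, hu, hv]; abel
    | h1 n y hy =>
      rw [Γ.proj_of_mem (SetLike.mul_mem_graded hx hy), Γ.proj_of_mem hx, Γ.proj_of_mem hx,
        Γ.proj_of_mem hy, Γ.proj_of_mem hy]
      rcases m with _ | _ | m <;> rcases n with _ | _ | n <;> simp
      omega

lemma DiffCalculus.proj_succ_d (n : ℕ) (x : Γ.Carrier) :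
    Γ.proj (n + 1) (Γ.d x) = Γ.d (Γ.proj n x) := by
  refine LinearMap.congr_fun (Γ.hom_ext_gr (f := Γ.proj (n + 1) ∘ₗ Γ.d) (g := Γ.d ∘ₗ Γ.proj n)
    fun m x hx => ?_) x
  rw [LinearMap.comp_apply, LinearMap.comp_apply, Γ.proj_of_mem (Γ.d_mem m x hx), Γ.proj_of_mem hx]
  split_ifs with h <;> simp_all

/-- The differential ideal of the elements without component of degree zero whose component of
degree one is annihilated by `g`. It reduces statements about a differential ideal to its
generators in degree one, without having to control the higher degrees. -/
def DiffIdeal.ofDegreeOne {C : Type*} [Ring C] [Algebra ℂ C] (g : Γ.Carrier →ₐ[ℂ] C) :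
    DiffIdeal Γ where
  toIdeal :=
    { carrier := {x | Γ.proj 0 x = 0 ∧ g (Γ.proj 1 x) = 0}
      add_mem' := fun ⟨hx, hx'⟩ ⟨hy, hy'⟩ =>
        ⟨by rw [map_add, hx, hy, add_zero], by rw [map_add, map_add, hx', hy', add_zero]⟩
      zero_mem' := ⟨map_zero _, by rw [map_zero, map_zero]⟩
      smul_mem' := fun c x ⟨hx, hx'⟩ =>
        ⟨by rw [smul_eq_mul, proj_zero_mul, hx, mul_zero],
          by rw [smul_eq_mul, Γ.proj_one_mul, hx, mul_zero, add_zero, map_mul, hx', mul_zero]⟩ }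
  isTwoSided := ⟨fun b ⟨hx, hx'⟩ =>
    ⟨by rw [proj_zero_mul, hx, zero_mul],
      by rw [Γ.proj_one_mul, hx, zero_mul, zero_add, map_mul, hx', zero_mul]⟩⟩
  d_mem x hx := ⟨(DiffIdeal.positive Γ).d_mem x hx.1, by
    rw [Γ.proj_succ_d 0, hx.1, map_zero, map_zero]⟩
  proj_mem x hx n := by
    change Γ.proj 0 (Γ.proj n x) = 0 ∧ g (Γ.proj 1 (Γ.proj n x)) = 0
    rw [Γ.proj_of_mem (Γ.proj_mem n x), Γ.proj_of_mem (Γ.proj_mem n x)]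
    constructor
    · split_ifs with hn
      · exact hn ▸ hx.1
      · rfl
    · split_ifs with hn
      · exact hn ▸ hx.2
      · exact map_zero g

lemma DiffIdeal.mem_ofDegreeOne_of_mem_gr {C : Type*} [Ring C] [Algebra ℂ C]
    {g : Γ.Carrier →ₐ[ℂ] C} {x : Γ.Carrier} (hx : x ∈ Γ.gr 1) (hg : g x = 0) :
    x ∈ (ofDegreeOne g).toIdeal :=
  ⟨by rw [Γ.proj_of_mem hx, if_neg one_ne_zero], by rw [Γ.proj_of_mem hx, if_pos rfl, hg]⟩

end DegreeOne

section Representation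

open Coalgebra

variable {H : Type*} [Ring H]

section Inner

variable [Algebra ℂ H] {E : Type*} [Ring E] [Algebra ℂ E] (f : H →ₐ[ℂ] E) (N : E)

/-- The homomorphism `Ω(H) → E` which extends `f` and sends `da` to the commutator `[N, f a]`. -/
def Omega.innerLift : (Omega H).Carrier →ₐ[ℂ] E :=
  OmegaAlg.lift f ((LinearMap.mulLeft ℂ N - LinearMap.mulRight ℂ N) ∘ₗ f.toLinearMap) fun a b => by
    simp only [LinearMap.comp_apply, LinearMap.sub_apply, AlgHom.toLinearMap_apply, map_mul,
      LinearMap.mulLeft_apply, LinearMap.mulRight_apply]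
    noncomm_ring

lemma Omega.innerLift_ι (a : H) : innerLift f N ((Omega H).ι a) = f a :=
  OmegaAlg.lift_of _ _ _ a

lemma Omega.innerLift_dι (a : H) :
    innerLift f N ((Omega H).d ((Omega H).ι a)) = N * f a - f a * N :=
  (congrArg (innerLift f N) (OmegaAlg.d_of a)).trans (OmegaAlg.lift_del _ _ _ a)

end Inner

variable [HopfAlgebra ℂ H] (hS : Function.Bijective (HopfAlgebra.antipode ℂ : H →ₗ[ℂ] H))

lemma ηΩ_mem_gr_one (r : H) : ηΩ hS r ∈ (Omega H).gr 1 := by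
  change (((Omega H).ι.toLinearMap ∘ₗ antipodeInv hS) ⋇ ((Omega H).d ∘ₗ (Omega H).ι.toLinearMap)) r
    ∈ _
  rw [copConv_apply_repr _ _ (ℛ ℂ r)]
  exact sum_mem fun i _ => zero_add 1 ▸
    SetLike.mul_mem_graded ((Omega H).ι_mem _) ((Omega H).dι_mem _)

variable (R : Submodule ℂ H)

/-- The representation `a (x, y) = (a x, ε(a) y)`, `da (x, y) = (0, [a x] - ε(a) [x])` of `Ω(H)` on
`H × H/R`. It detects `R` among the forms `η(r)`. -/
def quotRep : (Omega H).Carrier →ₐ[ℂ] Module.End ℂ (H × (H ⧸ R)) :=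
  Omega.innerLift
    ((LinearMap.prodMapAlgHom ℂ H (H ⧸ R)).comp
      ((Algebra.lmul ℂ H).prod ((Algebra.ofId ℂ _).comp (Bialgebra.counitAlgHom ℂ H))))
    (LinearMap.inr ℂ H (H ⧸ R) ∘ₗ R.mkQ ∘ₗ LinearMap.fst ℂ H (H ⧸ R))

lemma quotRep_ι (a : H) (w : H × (H ⧸ R)) :
    quotRep R ((Omega H).ι a) w = (a * w.1, (counit a : ℂ) • w.2) := by
  rw [quotRep, Omega.innerLift_ι]
  rfl

lemma quotRep_dι (a : H) (w : H × (H ⧸ R)) :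
    quotRep R ((Omega H).d ((Omega H).ι a)) w =
      (0, R.mkQ (a * w.1) - (counit a : ℂ) • R.mkQ w.1) := by
  rw [quotRep, Omega.innerLift_dι]
  refine Prod.ext ?_ rfl
  simp

lemma quotRep_ηΩ (r : H) (w : H × (H ⧸ R)) :
    quotRep R (ηΩ hS r) w = (0, R.mkQ (r * w.1) - (counit r : ℂ) • R.mkQ w.1) := by
  let f : H →ₐ[ℂ] Module.End ℂ (H × (H ⧸ R)) := (quotRep R).comp (Omega H).ι
  let D := (quotRep R).toLinearMap ∘ₗ (Omega H).d ∘ₗ (Omega H).ι.toLinearMap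
  have h_fD : f.toLinearMap ⋇ D = D := by
    refine Eq.trans (LinearMap.ext fun x => ?_) (copOne_copConv D)
    rw [copConv_apply_repr _ _ (ℛ ℂ x), copConv_apply_repr _ _ (ℛ ℂ x)]
    refine Finset.sum_congr rfl fun i _ => LinearMap.ext fun w => ?_
    simp [f, D, quotRep_ι, quotRep_dι, copOne_apply]
  have h_η : (quotRep R).toLinearMap ∘ₗ ηΩ hS = D :=
    (map_copConv (quotRep R) _ _).trans
      (eq_copConv_of_copConv_eq (antipodeInv_copConv hS f) h_fD).symm
  exact (LinearMap.congr_fun (LinearMap.congr_fun h_η r) w).trans (quotRep_dι R r w)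

variable {R}

lemma quotRep_proj_one_eq_zero (hR : ∀ r ∈ R, ∀ x : H, r * x ∈ R)
    (hRε : ∀ r ∈ R, (counit r : ℂ) = 0) {x : (Omega H).Carrier} (hx : x ∈ (idealH hS R).toIdeal) :
    quotRep R ((Omega H).proj 1 x) = 0 := by
  have h_gen : ηΩ hS '' R ⊆ (DiffIdeal.ofDegreeOne (quotRep R)).toIdeal := by
    rintro _ ⟨r, hr, rfl⟩
    refine DiffIdeal.mem_ofDegreeOne_of_mem_gr (ηΩ_mem_gr_one hS r) (LinearMap.ext fun w => ?_)
    rw [quotRep_ηΩ, hRε r hr, zero_smul, sub_zero, Submodule.mkQ_apply,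
      (Submodule.Quotient.mk_eq_zero R).2 (hR r hr w.1)]
    rfl
  exact (DiffIdeal.generate_le_iff.2 h_gen hx).2

lemma exists_linearMap_ηΩ_eq_mkQ (hR : ∀ r ∈ R, ∀ x : H, r * x ∈ R)
    (hRε : ∀ r ∈ R, (counit r : ℂ) = 0) :
    ∃ v : (calcH hS R).Carrier →ₗ[ℂ] H ⧸ R, ∀ r,
      v ((Omega.ext (AlgHom.id ℂ H) (calcH hS R)).toAlgHom (ηΩ hS r)) =
        R.mkQ r - (counit r : ℂ) • R.mkQ 1 := by
  let v : (Omega H).Carrier →ₗ[ℂ] H ⧸ R := LinearMap.snd ℂ H (H ⧸ R) ∘ₗ LinearMap.applyₗ (1, 0) ∘ₗ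
    (quotRep R).toLinearMap ∘ₗ (Omega H).proj 1
  have hv (x) : v x = (quotRep R ((Omega H).proj 1 x) (1, 0)).2 := rfl
  refine ⟨quotLinLift (idealH hS R).toIdeal v fun x hx => ?_, fun r => ?_⟩
  · rw [hv, quotRep_proj_one_eq_zero hS hR hRε hx]
    rfl
  · refine (congrArg _ (ext_quot_omega _)).trans ((quotLinLift_mk _ _ _ _).trans ?_)
    rw [hv, (Omega H).proj_of_mem (ηΩ_mem_gr_one hS r), if_pos rfl, quotRep_ηΩ, mul_one]

end Representation

section Covariance

open Coalgebra

variable {H : Type*} [Ring H] [HopfAlgebra ℂ H]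

lemma lTensor_counit_adMap (r : H) :
    (counit : H →ₗ[ℂ] ℂ).lTensor H (adMap r) = (counit r : ℂ) • (1 ⊗ₜ 1) := by
  have h_rid : TensorProduct.rid ℂ H ((counit : H →ₗ[ℂ] ℂ).lTensor H (adMap r)) =
      LinearMap.mul' ℂ H ((HopfAlgebra.antipode ℂ).rTensor H (comul r)) := by
    simp only [adMap, LinearMap.comp_apply, LinearEquiv.coe_coe]
    induction (comul r : H ⊗[ℂ] H) using TensorProduct.induction_on with
    | zero => simp
    | add x y hx hy => simp only [map_add, hx, hy]
    | tmul x y =>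
      have hy : y = TensorProduct.lid ℂ H ((counit : H →ₗ[ℂ] ℂ).rTensor H (comul y)) := by
        simp
      conv_rhs => rw [hy]
      rw [LinearMap.lTensor_tmul]
      induction (comul y : H ⊗[ℂ] H) using TensorProduct.induction_on with
      | zero => simp
      | add u v hu hv =>
        simp only [map_add, TensorProduct.tmul_add] at hu hv ⊢
        rw [hu, hv]
      | tmul u v => simp
  refine (TensorProduct.rid ℂ H).injective ?_
  rw [h_rid, HopfAlgebra.mul_antipode_rTensor_comul_apply]
  simp [Algebra.algebraMap_eq_smul_one]

lemma copConv_includeLeft_apply {C : Type*} [Ring C] [Algebra ℂ C] (f : H →ₗ[ℂ] C) (x : H) :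
    (((Algebra.TensorProduct.includeRight : C →ₐ[ℂ] H ⊗[ℂ] C).toLinearMap ∘ₗ f) ⋇
      (Algebra.TensorProduct.includeLeft : H →ₐ[ℂ] H ⊗[ℂ] C).toLinearMap) x =
      f.lTensor H (comul x) := by
  rw [copConv_apply_repr _ _ (ℛ ℂ x), ← (ℛ ℂ x).eq]
  simp

variable (hS : Function.Bijective (HopfAlgebra.antipode ℂ : H →ₗ[ℂ] H))

/-- Since `δ(η(r)) = ∑ S⁻¹(r₃) r₁ ⊗ η(r₂)`, applying `S` produces the adjoint coaction. -/
lemma rTensor_antipode_coact_ηΩ {G : DiffCalculus H} {δ : G.Carrier →ₐ[ℂ] H ⊗[ℂ] G.Carrier}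
    (hι : ∀ x, δ (G.ι x) = G.ι.toLinearMap.lTensor H (comul x))
    (hd : ∀ x, δ (G.d (G.ι x)) = (G.d ∘ₗ G.ι.toLinearMap).lTensor H (comul x)) (r : H) :
    (HopfAlgebra.antipode ℂ).rTensor G.Carrier
        (δ ((Omega.ext (AlgHom.id ℂ H) G).toAlgHom (ηΩ hS r))) =
      ((Omega.ext (AlgHom.id ℂ H) G).toAlgHom.toLinearMap ∘ₗ ηΩ hS).lTensor H (adMap r) := by
  let η := (Omega.ext (AlgHom.id ℂ H) G).toAlgHom.toLinearMap ∘ₗ ηΩ hS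
  let gL : H →ₐ[ℂ] H ⊗[ℂ] G.Carrier := Algebra.TensorProduct.includeLeft
  let gR : G.Carrier →ₐ[ℂ] H ⊗[ℂ] G.Carrier := Algebra.TensorProduct.includeRight
  have hδι : (δ.comp G.ι).toLinearMap = (gR.comp G.ι).toLinearMap ⋇ gL.toLinearMap :=
    LinearMap.ext fun x => (hι x).trans (copConv_includeLeft_apply _ x).symm
  have hδd : δ.toLinearMap ∘ₗ G.d ∘ₗ G.ι.toLinearMap =
      (gR.toLinearMap ∘ₗ G.d ∘ₗ G.ι.toLinearMap) ⋇ gL.toLinearMap :=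
    LinearMap.ext fun x => (hd x).trans (copConv_includeLeft_apply _ x).symm
  have hη : G.ι.toLinearMap ⋇ η = G.d ∘ₗ G.ι.toLinearMap := copConv_ext_ηΩ hS G (AlgHom.id ℂ H)
  have h_conv : (gR.comp G.ι).toLinearMap ⋇ (gL.toLinearMap ⋇ (δ.toLinearMap ∘ₗ η)) =
      (gR.comp G.ι).toLinearMap ⋇ ((gR.toLinearMap ∘ₗ η) ⋇ gL.toLinearMap) := by
    rw [← hη, map_copConv, map_copConv] at hδd
    rw [← copConv_assoc, ← copConv_assoc, ← hδι]
    exact hδd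
  have h_cancel : gL.toLinearMap ⋇ (δ.toLinearMap ∘ₗ η) =
      (gR.toLinearMap ∘ₗ η) ⋇ gL.toLinearMap := by
    rw [eq_copConv_of_copConv_eq (antipodeInv_copConv hS (gR.comp G.ι)) h_conv, ← copConv_assoc,
      antipodeInv_copConv, copOne_copConv]
  have hδη : δ.toLinearMap ∘ₗ η =
      (gL.toLinearMap ∘ₗ antipodeInv hS) ⋇ (gR.toLinearMap ∘ₗ η) ⋇ gL.toLinearMap := by
    rw [copConv_assoc]
    exact eq_copConv_of_copConv_eq (antipodeInv_copConv hS gL) h_cancel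
  refine (congrArg _ (LinearMap.congr_fun hδη r)).trans
    (map_copConv_copConv_apply (fun u v w => ?_) r)
  simp [η, gL, gR, HopfAlgebra.antipode_mul_antidistrib, antipode_antipodeInv]

variable {hS} {R : Submodule ℂ H}

theorem DiffCalculus.LeftCovariant.adMap_mem (hR : ∀ r ∈ R, ∀ x : H, r * x ∈ R)
    (hRε : ∀ r ∈ R, (counit r : ℂ) = 0) (hL : (calcH hS R).LeftCovariant) {r : H} (hr : r ∈ R) :
    adMap r ∈ LinearMap.range (R.subtype.lTensor H) := by
  obtain ⟨v, hv⟩ := exists_linearMap_ηΩ_eq_mkQ hS hR hRε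
  obtain ⟨δ, hι, hd, -, -⟩ := hL
  let η := (Omega.ext (AlgHom.id ℂ H) (calcH hS R)).toAlgHom.toLinearMap ∘ₗ ηΩ hS
  have hηr : η r = 0 := isDifferentiable_calcH_iff.1 (isDifferentiable_id _) r hr
  have hη : η.lTensor H (adMap r) = 0 := by
    rw [← rTensor_antipode_coact_ηΩ hS hι hd]
    exact (congrArg _ ((congrArg δ hηr).trans (map_zero δ))).trans (map_zero _)
  have hvη : v ∘ₗ η = R.mkQ - LinearMap.toSpanSingleton ℂ _ (R.mkQ 1) ∘ₗ counit :=
    LinearMap.ext hv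
  refine (lTensor_exact H (LinearMap.exact_subtype_mkQ R) R.mkQ_surjective _).1 ?_
  calc R.mkQ.lTensor H (adMap r)
      = (v ∘ₗ η).lTensor H (adMap r) := by
        rw [hvη, LinearMap.lTensor_sub, LinearMap.sub_apply, LinearMap.lTensor_comp,
          LinearMap.comp_apply, lTensor_counit_adMap, hRε r hr, zero_smul, map_zero, sub_zero]
    _ = 0 := by rw [LinearMap.lTensor_comp, LinearMap.comp_apply, hη, map_zero]

theorem LocTrivQPFB.transitionInvariant_of_leftCovariant {I B : Type*} [Finite I] [Ring B]
    [Algebra ℂ B] (Q : LocTrivQPFB I B H) (hR : ∀ r ∈ R, ∀ x : H, r * x ∈ R)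
    (hRε : ∀ r ∈ R, (counit r : ℂ) = 0) (hL : (calcH hS R).LeftCovariant) :
    Q.TransitionInvariant R := by
  intro i j r hr
  obtain ⟨z, hz⟩ := hL.adMap_mem hR hRε hr
  refine ⟨(τ (Q.ov i j)).toLinearMap.rTensor R z, ?_⟩
  rw [← hz, ← LinearMap.comp_apply, ← LinearMap.comp_apply, LinearMap.lTensor_comp_rTensor,
    LinearMap.rTensor_comp_lTensor]

end Covariance

end

theorem proposition8_general {I B H : Type*} [Finite I] [Ring B] [Algebra ℂ B] [Ring H]
    [HopfAlgebra ℂ H] (hS : Function.Bijective (HopfAlgebra.antipode ℂ : H →ₗ[ℂ] H))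
    (Q : LocTrivQPFB I B H) (Γ : ∀ i, DiffCalculus (Q.Bl i)) (R : Submodule ℂ H) :
    (Q.TransitionInvariant R → ∀ i j : I,
      (Q.calcOv Γ (calcH hS R) i j (Q.ov i j)).ideal =
        (Q.calcOv Γ (calcH hS R) j i (Q.ovSwap i j)).ideal ∧
      (Q.calcOv Γ (calcH hS R) i j (Q.ov i j)).Isomorphic
        (skew (Q.calcM Γ R i j (Q.ov i j)) (calcH hS R)) ∧
      (Q.calcOv Γ (calcH hS R) j i (Q.ovSwap i j)).Isomorphic
        (skew (Q.calcM Γ R i j (Q.ov i j)) (calcH hS R)) ∧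
      Q.idealM Γ R i j (Q.ov i j) = Q.idealM Γ R j i (Q.ovSwap i j)) ∧
    ((∀ r ∈ R, ∀ x : H, r * x ∈ R) → (∀ r ∈ R, (Coalgebra.counit r : ℂ) = 0) →
      (calcH hS R).LeftCovariant → Q.TransitionInvariant R) := by
  refine ⟨fun hQ i j => ?_, Q.transitionInvariant_of_leftCovariant⟩
  have h_swap : Q.idealM Γ R i j (Q.ov i j) = Q.idealM Γ R j i (Q.ovSwap i j) :=
    LocTrivQPFB.idealM_swap hQ
  have h_calcM : Q.calcM Γ R j i (Q.ovSwap i j) = Q.calcM Γ R i j (Q.ov i j) := by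
    unfold LocTrivQPFB.calcM
    congr 1
    exact h_swap.symm
  have h_ij := LocTrivQPFB.ideal_calcOv_eq (Γ := Γ) hS hQ (h := Q.ov i j)
  have h_ji := LocTrivQPFB.ideal_calcOv_eq (Γ := Γ) hS hQ (h := Q.ovSwap i j)
  rw [h_calcM] at h_ji
  exact ⟨h_ij.trans h_ji.symm, DiffCalculus.isomorphic_of_ideal_eq h_ij,
    DiffCalculus.isomorphic_of_ideal_eq h_ji, h_swap⟩

theorem proposition8 {I B H : Type*} [Finite I] [Ring B] [Algebra ℂ B] [Ring H] [HopfAlgebra ℂ H]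
    (hS : Function.Bijective (HopfAlgebra.antipode ℂ : H →ₗ[ℂ] H))
    (Q : LocTrivQPFB I B H) (Γ : ∀ i, DiffCalculus (Q.Bl i))
    (R : Submodule ℂ H) (hR : ∀ r ∈ R, ∀ x : H, r * x ∈ R)
    (hRε : ∀ r ∈ R, (Coalgebra.counit r : ℂ) = 0) :
    (Q.TransitionInvariant R → ∀ i j : I,
      (Q.calcOv Γ (calcH hS R) i j (Q.ov i j)).ideal =
        (Q.calcOv Γ (calcH hS R) j i (Q.ovSwap i j)).ideal ∧
      (Q.calcOv Γ (calcH hS R) i j (Q.ov i j)).Isomorphic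
        (skew (Q.calcM Γ R i j (Q.ov i j)) (calcH hS R)) ∧
      (Q.calcOv Γ (calcH hS R) j i (Q.ovSwap i j)).Isomorphic
        (skew (Q.calcM Γ R i j (Q.ov i j)) (calcH hS R)) ∧
      Q.idealM Γ R i j (Q.ov i j) = Q.idealM Γ R j i (Q.ovSwap i j)) ∧
    ((calcH hS R).Bicovariant → Q.TransitionInvariant R) :=
  have h_general := proposition8_general hS Q Γ R
  ⟨h_general.1, fun h_bicov => h_general.2 hR hRε h_bicov.1⟩
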